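/- The \textsc{Pathwidth} problem can be solved in $O^*(3^k)$ time, where $k$ is the size of a minimum vertex cover of the input graph. Precisely: there are a deterministic algorithm (a fixed random access machine program, with running time measured in the logarithmic cost model) and constants $c,d\in\mathbb N$ such that, for every finite simple undirected graph $G$ with $n\ge 1$ vertices, given by $n$ and its adjacency matrix, the algorithm halts on $G$ after time at most $c\cdot 3^{k}\cdot n^{d}$ and outputs the pathwidth of $G$, where $k$ is the minimum size of a vertex cover of $G$ (a set of vertices meeting every edge); $k$ is not part of the input. Here a path decomposition of $G=(V,E)$ is a path $T$ together with a set (bag) $X_i\subseteq V$ for each node $i$ of $T$, such that every vertex of $G$ lies in some bag, every edge of $G$ has both ends in some common bag, and for each $v\in V$ the nodes $i$ with $v\in X_i$ induce a connected subpath of $T$. Its width is $\max_i|X_i|-1$, and the pathwidth of $G$ is the minimum width of a path decomposition of $G$. -/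

import Mathlib

/-! ### Tree decompositions, path decompositions and pathwidth -/

/-- A tree decomposition of the graph `G` along the tree `T`. -/
structure TreeDecomposition {V ι : Type} (G : SimpleGraph V) (T : SimpleGraph ι) where
  isTree : T.IsTree
  bag : ι → Finset V
  exists_mem_bag : ∀ v : V, ∃ i : ι, v ∈ bag i
  exists_bag_of_adj : ∀ u v : V, G.Adj u v → ∃ i : ι, u ∈ bag i ∧ v ∈ bag i
  connected : ∀ v : V, (T.induce {i : ι | v ∈ bag i}).Connected

/-- The width: the maximum size of a bag, minus one (an integer, as all bags may be empty). -/
def TreeDecomposition.width {V ι : Type} [Fintype ι] {G : SimpleGraph V} {T : SimpleGraph ι}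
    (D : TreeDecomposition G T) : ℤ :=
  ((Finset.univ.sup fun i : ι => (D.bag i).card : ℕ) : ℤ) - 1

/-- A path decomposition is a tree decomposition whose tree is a path (with `m` nodes; a tree
is non-empty, so `m` cannot be `0`). -/
abbrev PathDecomposition {V : Type} (G : SimpleGraph V) (m : ℕ) : Type :=
  TreeDecomposition G (SimpleGraph.pathGraph m)

/-- `w` is the pathwidth of `G`: the minimum width of a path decomposition of `G`. -/
def IsPathwidth {V : Type} (G : SimpleGraph V) (w : ℤ) : Prop :=
  IsLeast {x : ℤ | ∃ (m : ℕ) (D : PathDecomposition G m), D.width = x} w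

/-! ### Random access machines with logarithmic cost -/

namespace RAM

/-- The arithmetic operations, on natural numbers: subtraction is truncated at `0`, division is
rounded down and division by `0` gives `0`. -/
inductive ArithOp where
  | add
  | sub
  | mul
  | div

/-- The value of an arithmetic operation. -/
def ArithOp.eval : ArithOp → ℕ → ℕ → ℕ
  | add, a, b => a + b
  | sub, a, b => a - b
  | mul, a, b => a * b
  | div, a, b => a / b

/-- A configuration: registers, which a program names directly, and an unbounded memory, which a
program reaches by indirect addressing. Every cell holds a natural number. -/
structure State where
  reg : ℕ → ℕ
  mem : ℕ → ℕ

/-- Set register `r` to `x`. -/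
def State.setReg (s : State) (r x : ℕ) : State :=
  { s with reg := Function.update s.reg r x }

/-- Set memory cell `a` to `x`. -/
def State.setMem (s : State) (a x : ℕ) : State :=
  { s with mem := Function.update s.mem a x }

/-- Programs. A program is a finite object and so names only finitely many registers.
* `const r c`: `reg r := c`;
* `arith o r a b`: `reg r := reg a o reg b`;
* `load r a`: `reg r := mem (reg a)`;
* `store a r`: `mem (reg a) := reg r`;
* `branch r p q`: run `p` if `reg r ≠ 0`, and `q` otherwise;
* `loop r p`: run `p` as long as `reg r ≠ 0`. -/
inductive Program where
  | skip
  | const (r c : ℕ)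
  | arith (o : ArithOp) (r a b : ℕ)
  | load (r a : ℕ)
  | store (a r : ℕ)
  | seq (p q : Program)
  | branch (r : ℕ) (p q : Program)
  | loop (r : ℕ) (p : Program)

/-- `Exec p s s' t`: started in the configuration `s`, the program `p` halts in the configuration
`s'` after a run of cost `t`. The cost is logarithmic: each instruction and each test costs one
plus the numbers of binary digits of the operands and of the memory address that it uses. -/
inductive Exec : Program → State → State → ℕ → Prop
  | skip (s : State) : Exec Program.skip s s 1
  | const (s : State) (r c : ℕ) :
      Exec (Program.const r c) s (s.setReg r c) (1 + Nat.size c)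
  | arith (s : State) (o : ArithOp) (r a b : ℕ) :
      Exec (Program.arith o r a b) s (s.setReg r (o.eval (s.reg a) (s.reg b)))
        (1 + Nat.size (s.reg a) + Nat.size (s.reg b))
  | load (s : State) (r a : ℕ) :
      Exec (Program.load r a) s (s.setReg r (s.mem (s.reg a)))
        (1 + Nat.size (s.reg a) + Nat.size (s.mem (s.reg a)))
  | store (s : State) (a r : ℕ) :
      Exec (Program.store a r) s (s.setMem (s.reg a) (s.reg r))
        (1 + Nat.size (s.reg a) + Nat.size (s.reg r))
  | seq (p q : Program) (s s' s'' : State) (t t' : ℕ)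
      (hp : Exec p s s' t) (hq : Exec q s' s'' t') :
      Exec (Program.seq p q) s s'' (t + t')
  | branch_true (r : ℕ) (p q : Program) (s s' : State) (t : ℕ)
      (hr : s.reg r ≠ 0) (hp : Exec p s s' t) :
      Exec (Program.branch r p q) s s' (1 + Nat.size (s.reg r) + t)
  | branch_false (r : ℕ) (p q : Program) (s s' : State) (t : ℕ)
      (hr : s.reg r = 0) (hq : Exec q s s' t) :
      Exec (Program.branch r p q) s s' (1 + t)
  | loop_done (r : ℕ) (p : Program) (s : State) (hr : s.reg r = 0) :
      Exec (Program.loop r p) s s 1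
  | loop_step (r : ℕ) (p : Program) (s s' s'' : State) (t t' : ℕ)
      (hr : s.reg r ≠ 0) (hp : Exec p s s' t) (hl : Exec (Program.loop r p) s' s'' t') :
      Exec (Program.loop r p) s s'' (1 + Nat.size (s.reg r) + t + t')

open Classical in
/-- The initial configuration on a graph with vertices `0, …, n - 1`: cell `0` of the memory holds
`n`, cell `1 + (n * u + v)` holds the entry `(u, v)` of the adjacency matrix, and everything else
is `0`. -/
noncomputable def graphInput {n : ℕ} (G : SimpleGraph (Fin n)) : State where
  reg := fun _ => 0
  mem := fun a =>
    if a = 0 then n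
    else if ∃ u v : Fin n, a = 1 + (n * (u : ℕ) + (v : ℕ)) ∧ G.Adj u v then 1
    else 0

end RAM

/-! ### Pathwidth as vertex separation -/

section Pathwidth

variable {V : Type}

/-! Pathwidth is first replaced by vertex separation: `G` has a path decomposition of width at most
`w` iff its vertices can be added one at a time so that the set `S` of added vertices never has more
than `w` members with a neighbour outside `S` (`Separable`).

Let `C` be a vertex cover. Of such a process only the trace on `C` is kept: `A = C ∩ S`, and the set
`B` of those vertices of `C ∩ S` whose neighbours all lie in `S`. Each vertex of `C` is new,
introduced or forgotten, so there are `3 ^ |C|` traces. The vertices outside `C` are independent and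
can be reconstructed: such a vertex is placed at the latest when a neighbour is forgotten, and costs
nothing once all its neighbours are present. It occupies a place in the boundary only while it has a
forgotten neighbour and a neighbour not yet introduced. Hence the size of the boundary can be read
off from `(A, B)`; this is the size of `active`.

A step introduces a vertex `x` of `C`, forgets a vertex `b`, or does both at once (`Sweep.replace`).
The double step is needed because adding `x` may close `b`, while the state between the two would
exceed the bound. It is illegitimate if some vertex outside `C`, adjacent to `x` and `b`, has all
neighbours introduced and `b` as its only forgotten neighbour: that vertex has to be placed before
`b` can be forgotten, and `active` never counts it. `Sweep.sound` and `Sweep.of_separable` show that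
sweeps from `(∅, ∅)` to `(C, C)` exist exactly when `G` is separable with the same bound.

The algorithm fills a bottleneck table over the traces. The vertices of the cover get the weights
`1, 3, 9, …`, so a trace is a ternary number and its predecessors are smaller numbers. The entry is
the maximum of the cost of the state and the least entry of a predecessor, and the last entry is the
pathwidth (`Encodes.last_le_iff`).

The cover is found by trying `y = 0, 1, 2, …`: the ternary digits of `y` say which end of the next
uncovered edge to take, and digit `0` means failure. If a cover of size `k` exists, some `y < 3 ^ k`
succeeds (`Search.exists_guess`), and any `y < 3 ^ k` chooses at most `k` vertices
(`Search.Valid.pow_le_run`). So both unbounded loops run at most `3 ^ k` times with polynomial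
bodies, and all numbers have `O(n)` binary digits, which bounds the logarithmic cost. -/

theorem SimpleGraph.pathGraph_isTree {m : ℕ} (hm : 0 < m) : (SimpleGraph.pathGraph m).IsTree := by
  obtain ⟨k, rfl⟩ : ∃ k, m = k + 1 := ⟨m - 1, by omega⟩
  refine ⟨SimpleGraph.pathGraph_connected k, ?_⟩
  rw [SimpleGraph.isAcyclic_iff_forall_adj_isBridge]
  have key : ∀ v w : Fin (k + 1), v.val + 1 = w.val →
      (SimpleGraph.pathGraph (k + 1)).IsBridge s(v, w) := by
    intro v w hvw
    rw [SimpleGraph.isBridge_iff]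
    intro hr
    rw [SimpleGraph.reachable_iff_reflTransGen] at hr
    -- Without the edge from `v` to its successor `w`, a walk from `v` cannot get beyond `v`.
    have : ∀ x, Relation.ReflTransGen
        ((SimpleGraph.pathGraph (k + 1)).deleteEdges {s(v, w)}).Adj v x → x.val ≤ v.val := by
      intro x hx
      induction hx with
      | refl => rfl
      | tail _ h ih =>
        rename_i b c _
        simp only [SimpleGraph.deleteEdges_adj, SimpleGraph.pathGraph_adj,
          Set.mem_singleton_iff, Sym2.eq_iff, not_or, not_and, Fin.ext_iff] at h
        omega
    have := this w hr
    omega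
  intro v w h
  rw [SimpleGraph.pathGraph_adj] at h
  rcases h with h | h
  · exact key v w h
  · rw [Sym2.eq_swap]; exact key w v h

theorem SimpleGraph.pathGraph_induce_connected {m : ℕ} (s : Set (Fin m)) (hne : s.Nonempty)
    (hs : ∀ i ∈ s, ∀ k ∈ s, ∀ j, i ≤ j → j ≤ k → j ∈ s) :
    ((SimpleGraph.pathGraph m).induce s).Connected := by
  have key : ∀ d : ℕ, ∀ i k : s, i.1.val + d = k.1.val →
      ((SimpleGraph.pathGraph m).induce s).Reachable i k := by
    intro d
    induction d with
    | zero =>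
      intro i k h
      obtain rfl : i = k := Subtype.ext (Fin.ext (by omega))
      rfl
    | succ d ih =>
      intro i k h
      have hj : (⟨i.1.val + d, by omega⟩ : Fin m) ∈ s :=
        hs i.1 i.2 k.1 k.2 _ (Fin.mk_le_mk.2 (by simp)) (by
          rw [Fin.le_def]; simp; omega)
      refine (ih i ⟨_, hj⟩ rfl).trans (SimpleGraph.Adj.reachable ?_)
      simp only [SimpleGraph.comap_adj, Function.Embedding.subtype_apply,
        SimpleGraph.pathGraph_adj]
      omega
  obtain ⟨a, ha⟩ := hne
  have : Nonempty s := ⟨⟨a, ha⟩⟩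
  refine ⟨fun i k => ?_⟩
  rcases le_total i.1.val k.1.val with h | h
  · exact key (k.1.val - i.1.val) i k (by omega)
  · exact (key (i.1.val - k.1.val) k i (by omega)).symm

theorem SimpleGraph.mem_of_pathGraph_induce_connected {m : ℕ} {s : Set (Fin m)}
    (h : ((SimpleGraph.pathGraph m).induce s).Connected) {i j k : Fin m} (hi : i ∈ s)
    (hk : k ∈ s) (hij : i ≤ j) (hjk : j ≤ k) : j ∈ s := by
  by_contra hj
  have hr := h.preconnected ⟨i, hi⟩ ⟨k, hk⟩
  rw [SimpleGraph.reachable_iff_reflTransGen] at hr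
  -- Indices change by one along an edge, so a walk in `s` cannot jump over the missing `j`.
  have : ∀ x : s, Relation.ReflTransGen ((SimpleGraph.pathGraph m).induce s).Adj ⟨i, hi⟩ x →
      x.1.val < j.val := by
    intro x hx
    induction hx with
    | refl =>
      have : i ≠ j := fun e => hj (e ▸ hi)
      have := Fin.val_ne_of_ne this
      have hij' : i.val ≤ j.val := hij
      show i.val < j.val
      omega
    | tail _ h ih =>
      rename_i b c _
      simp only [SimpleGraph.comap_adj, Function.Embedding.subtype_apply,
        SimpleGraph.pathGraph_adj] at h
      have : c.1.val ≠ j.val := fun e => hj (Fin.ext e ▸ c.2)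
      omega
  have := this ⟨k, hk⟩ hr
  simp at this
  exact absurd hjk (by rw [Fin.le_def]; omega)

open Classical in
/-- The vertices of `S` that have a neighbour outside `S`. -/
noncomputable def boundary (G : SimpleGraph V) (S : Finset V) : Finset V :=
  S.filter fun v => ∃ u, G.Adj v u ∧ u ∉ S

theorem mem_boundary {G : SimpleGraph V} {S : Finset V} {v : V} :
    v ∈ boundary G S ↔ v ∈ S ∧ ∃ u, G.Adj v u ∧ u ∉ S := by
  simp [boundary]

theorem TreeDecomposition.width_nonneg [Nonempty V] {G : SimpleGraph V} {m : ℕ}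
    (D : PathDecomposition G m) : 0 ≤ D.width := by
  obtain ⟨v⟩ := ‹Nonempty V›
  obtain ⟨i, hi⟩ := D.exists_mem_bag v
  have h1 := Finset.le_sup (f := fun i => (D.bag i).card) (Finset.mem_univ i)
  have h2 : 0 < (D.bag i).card := Finset.card_pos.2 ⟨v, hi⟩
  simp only [TreeDecomposition.width]
  omega

variable [DecidableEq V]

/-- The sets that arise by adding vertices one at a time, such that no set on the way has more
than `w` boundary vertices. -/
inductive Separable (G : SimpleGraph V) (w : ℕ) : Finset V → Prop
  | empty : Separable G w ∅
  | add (x : V) (S : Finset V) (hS : Separable G w S)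
      (h : (boundary G (insert x S)).card ≤ w) : Separable G w (insert x S)

namespace Separable

variable {G : SimpleGraph V} {w : ℕ}

theorem card_boundary_le {S : Finset V} (h : Separable G w S) : (boundary G S).card ≤ w := by
  cases h with
  | empty => simp [boundary]
  | add x S hS h => exact h

/-- Such a vertex does not enter the boundary itself, and adding it can only close other vertices,
so the boundary does not grow. -/
theorem insert_of_forall_adj {S : Finset V} (hS : Separable G w S) {v : V}
    (hv : ∀ u, G.Adj v u → u ∈ S) : Separable G w (insert v S) := by
  refine .add v S hS ((Finset.card_le_card fun y hy => ?_).trans hS.card_boundary_le)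
  rw [mem_boundary] at hy ⊢
  obtain ⟨hy, u, hu, huS⟩ := hy
  rw [Finset.mem_insert, not_or] at huS
  rcases Finset.mem_insert.1 hy with rfl | hy
  · exact absurd (hv u hu) huS.2
  · exact ⟨hy, u, hu, huS.2⟩

theorem union_of_forall_adj {S : Finset V} (hS : Separable G w S) (Z : Finset V)
    (hZ : ∀ v ∈ Z, ∀ u, G.Adj v u → u ∈ S) : Separable G w (S ∪ Z) := by
  induction Z using Finset.induction_on with
  | empty => simpa using hS
  | insert v Z _ ih =>
    rw [Finset.union_insert]
    refine (ih fun v hv => hZ v (Finset.mem_insert_of_mem hv)).insert_of_forall_adj fun u hu => ?_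
    exact Finset.mem_union_left _ (hZ v (Finset.mem_insert_self _ _) u hu)

/-- The sequence is constant from index `m` on, which makes it a total function. A step may add
nothing, hence `≤ 1`. -/
theorem exists_sequence {S : Finset V} (h : Separable G w S) :
    ∃ (m : ℕ) (T : ℕ → Finset V), T 0 = ∅ ∧ T m = S ∧ Monotone T ∧
      (∀ i, (T (i + 1) \ T i).card ≤ 1) ∧ ∀ i, (boundary G (T i)).card ≤ w := by
  induction h with
  | empty => exact ⟨0, fun _ => ∅, rfl, rfl, monotone_const, by simp, by simp [boundary]⟩
  | add x S hS h ih =>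
    obtain ⟨m, T, h0, hm, hmono, h1, hb⟩ := ih
    refine ⟨m + 1, fun i => if i ≤ m then T i else insert x S, by simp [h0], by simp, ?_, ?_, ?_⟩
    · refine monotone_nat_of_le_succ fun i => ?_
      by_cases hi : i + 1 ≤ m
      · simpa [hi, (by omega : i ≤ m)] using hmono (Nat.le_succ i)
      · by_cases hi' : i = m
        · subst hi'; simp [hm]
        · have hi2 : ¬ i ≤ m := by omega
          simp only [if_neg hi, if_neg hi2, le_refl]
    · intro i
      by_cases hi : i + 1 ≤ m
      · simpa [hi, (by omega : i ≤ m)] using h1 i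
      · by_cases hi' : i = m
        · subst hi'
          simp only [le_refl, if_true, hi, if_false, hm]
          exact (Finset.card_le_card (by
            intro v; simp only [Finset.mem_sdiff, Finset.mem_insert, Finset.mem_singleton]
            tauto)).trans (Finset.card_singleton x).le
        · have hi2 : ¬ i ≤ m := by omega
          simp only [if_neg hi, if_neg hi2, Finset.sdiff_self, Finset.card_empty, zero_le]
    · intro i
      by_cases hi : i ≤ m
      · simpa [hi] using hb i
      · simpa [hi] using h

/-- The bag of step `i` consists of the boundary before the step and the vertex being added, hence
at most `w + 1` vertices. A vertex stays in the bags from its entrance until its last neighbour has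
entered, which is an interval. -/
theorem exists_pathDecomposition [Fintype V] [Nonempty V] (h : Separable G w Finset.univ) :
    ∃ (m : ℕ) (D : PathDecomposition G m), D.width ≤ w := by
  obtain ⟨m, T, h0, hm, hmono, h1, hb⟩ := h.exists_sequence
  have hmpos : 0 < m := by
    rcases Nat.eq_zero_or_pos m with h | h
    · subst h
      rw [h0] at hm
      exact absurd hm.symm (Finset.univ_nonempty.ne_empty)
    · exact h
  have hmem : ∀ (i : ℕ) (v : V), v ∈ boundary G (T i) ∪ (T (i + 1) \ T i) ↔
      v ∈ T (i + 1) ∧ (v ∈ T i → ∃ u, G.Adj v u ∧ u ∉ T i) := by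
    intro i v
    have : v ∈ T i → v ∈ T (i + 1) := @hmono i (i + 1) (by omega) v
    simp only [Finset.mem_union, mem_boundary, Finset.mem_sdiff]
    by_cases hv : v ∈ T i
    · simp [hv, this hv]
    · simp [hv]
  have hfirst : ∀ v : V, ∃ i, i < m ∧ v ∈ T (i + 1) ∧ v ∉ T i := by
    intro v
    classical
    have hex : ∃ i, v ∈ T i := ⟨m, by simp [hm]⟩
    have hs := Nat.find_spec hex
    have hpos : Nat.find hex ≠ 0 := by
      intro e; rw [e, h0] at hs; simp at hs
    have hle : Nat.find hex ≤ m := Nat.find_min' hex (by simp [hm])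
    refine ⟨Nat.find hex - 1, by omega, ?_, Nat.find_min hex (by omega)⟩
    rwa [Nat.sub_add_cancel (by omega)]
  refine ⟨m, ⟨SimpleGraph.pathGraph_isTree hmpos,
    fun i => boundary G (T i) ∪ (T (i + 1) \ T i), ?_, ?_, ?_⟩, ?_⟩
  · intro v
    obtain ⟨i, hi, hv, hv'⟩ := hfirst v
    exact ⟨⟨i, hi⟩, by rw [hmem]; exact ⟨hv, fun h => absurd h hv'⟩⟩
  -- The common bag is the one where the later vertex `v` enters: `u` is still in the boundary,
  -- because `v` is missing.
  · have key : ∀ u v i j, G.Adj u v → i ≤ j → j < m → u ∈ T (i + 1) → v ∈ T (j + 1) → v ∉ T j →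
        ∃ i : Fin m, u ∈ boundary G (T i) ∪ (T (i + 1) \ T i) ∧
          v ∈ boundary G (T i) ∪ (T (i + 1) \ T i) := by
      intro u v i j ha hij hj hu hv hv'
      refine ⟨⟨j, hj⟩, ?_, ?_⟩
      · rw [hmem]
        exact ⟨hmono (Nat.succ_le_succ hij) hu, fun _ => ⟨v, ha, hv'⟩⟩
      · rw [hmem]
        exact ⟨hv, fun h => absurd h hv'⟩
    intro u v ha
    obtain ⟨i, hi, hu, hu'⟩ := hfirst u
    obtain ⟨j, hj, hv, hv'⟩ := hfirst v
    rcases le_total i j with h | h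
    · exact key u v i j ha h hj hu hv hv'
    · obtain ⟨x, hx, hx'⟩ := key v u j i ha.symm h hi hv hu hu'
      exact ⟨x, hx', hx⟩
  · intro v
    apply SimpleGraph.pathGraph_induce_connected
    · obtain ⟨i, hi, hv, hv'⟩ := hfirst v
      exact ⟨⟨i, hi⟩, by rw [Set.mem_ofPred_eq, hmem]; exact ⟨hv, fun h => absurd h hv'⟩⟩
    · intro i hi k hk j hij hjk
      rw [Set.mem_ofPred_eq, hmem] at *
      refine ⟨hmono (by simpa using hij) hi.1, fun hj => ?_⟩
      obtain ⟨u, hu, hu'⟩ := hk.2 (hmono (by simpa using hjk) hj)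
      exact ⟨u, hu, fun h => hu' (hmono (by simpa using hjk) h)⟩
  · have : (Finset.univ.sup fun i : Fin m =>
        (boundary G (T i) ∪ (T (i + 1) \ T i)).card) ≤ w + 1 := by
      refine Finset.sup_le fun i _ => (Finset.card_union_le _ _).trans ?_
      have := h1 i; have := hb i; omega
    simp only [TreeDecomposition.width]
    omega

/-- The vertices are added in the order of the first bag that contains them, with ties broken
arbitrarily. -/
theorem of_pathDecomposition [Fintype V] {m : ℕ} (D : PathDecomposition G m)
    (hD : D.width ≤ w) : Separable G w Finset.univ := by
  classical
  have hcard : ∀ i, (D.bag i).card ≤ w + 1 := by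
    intro i
    have := Finset.le_sup (f := fun i => (D.bag i).card) (Finset.mem_univ i)
    simp only [TreeDecomposition.width] at hD
    omega
  have hmin : ∀ v, ∃ i, v ∈ D.bag i ∧ ∀ j, v ∈ D.bag j → i ≤ j := by
    intro v
    obtain ⟨i, hi, hm⟩ := Finset.exists_min_image (Finset.univ.filter fun i => v ∈ D.bag i) id
      (by obtain ⟨i, hi⟩ := D.exists_mem_bag v; exact ⟨i, by simpa using hi⟩)
    exact ⟨i, by simpa using hi, fun j hj => hm j (by simpa using hj)⟩
  choose first hfirst hfirst' using hmin
  have hb : ∀ S : Finset V, (∀ v ∈ S, ∀ u ∉ S, first v ≤ first u) →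
      (boundary G S).card ≤ w := by
    intro S hS
    by_cases hne : ∃ x, x ∉ S
    · obtain ⟨x, hx, hxm⟩ := Finset.exists_min_image (Finset.univ \ S) first
        (by obtain ⟨x, hx⟩ := hne; exact ⟨x, by simpa using hx⟩)
      simp only [Finset.mem_sdiff, Finset.mem_univ, true_and] at hx hxm
      -- A boundary vertex `v` starts no later than `x`, and shares a bag with an outside neighbour
      -- `u`, which starts no earlier than `x`. By connectedness `v` is in the first bag of `x`;
      -- since `x` itself is not in `S`, one place is saved.
      have hsub : boundary G S ⊆ (D.bag (first x)).erase x := by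
        intro v hv
        rw [mem_boundary] at hv
        obtain ⟨hv, u, ha, hu⟩ := hv
        obtain ⟨j, hvj, huj⟩ := D.exists_bag_of_adj v u ha
        rw [Finset.mem_erase]
        refine ⟨fun e => hx (e ▸ hv), ?_⟩
        exact SimpleGraph.mem_of_pathGraph_induce_connected (D.connected v)
          (hfirst v) hvj (hS v hv x hx) ((hxm u hu).trans (hfirst' u j huj))
      have h1 := Finset.card_le_card hsub
      rw [Finset.card_erase_of_mem (hfirst x)] at h1
      have := hcard (first x)
      omega
    · push Not at hne
      have : boundary G S = ∅ := by
        ext v; simp [mem_boundary, hne]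
      simp [this]
  have key : ∀ q ≤ Fintype.card V, ∃ S : Finset V, S.card = q ∧ Separable G w S ∧
      ∀ v ∈ S, ∀ u ∉ S, first v ≤ first u := by
    intro q
    induction q with
    | zero => intro _; exact ⟨∅, by simp, .empty, by simp⟩
    | succ q ih =>
      intro hq
      obtain ⟨S, hSc, hS, hdown⟩ := ih (by omega)
      obtain ⟨x, hx, hxm⟩ := Finset.exists_min_image (Finset.univ \ S) first (by
        rw [← Finset.card_pos, Finset.card_sdiff_of_subset (Finset.subset_univ S),
          Finset.card_univ]
        omega)
      simp only [Finset.mem_sdiff, Finset.mem_univ, true_and] at hx hxm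
      have hd : ∀ v ∈ insert x S, ∀ u ∉ insert x S, first v ≤ first u := by
        intro v hv u hu
        rw [Finset.mem_insert, not_or] at hu
        rcases Finset.mem_insert.1 hv with rfl | hv
        · exact hxm u hu.2
        · exact hdown v hv u hu.2
      exact ⟨insert x S, by rw [Finset.card_insert_of_notMem hx, hSc],
        .add x S hS (hb _ hd), hd⟩
  obtain ⟨S, hSc, hS, _⟩ := key _ le_rfl
  rwa [(Finset.card_eq_iff_eq_univ S).1 hSc] at hS

/-- The whole vertex set has no boundary, and a proper subset has fewer than `|V|` elements. -/
theorem of_card_le [Fintype V] (h : Fintype.card V ≤ w + 1) (S : Finset V) :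
    Separable G w S := by
  have hb : ∀ S : Finset V, (boundary G S).card ≤ w := by
    intro S
    by_cases hS : S = Finset.univ
    · have : boundary G S = ∅ := by ext v; simp [mem_boundary, hS]
      simp [this]
    · have h1 : S.card < Fintype.card V := (Finset.card_lt_iff_ne_univ S).2 hS
      have h2 : (boundary G S).card ≤ S.card :=
        Finset.card_le_card fun v hv => (mem_boundary.1 hv).1
      omega
  induction S using Finset.induction_on with
  | empty => exact .empty
  | insert x S _ ih => exact .add x S ih (hb _)

end Separable

/-- Bounds below `|V|` are enough, since the bound `|V| - 1` always works. This lets the algorithm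
use `n` as infinity. -/
theorem isPathwidth_of_forall_separable [Fintype V] [Nonempty V] {G : SimpleGraph V} {a : ℕ}
    (h : ∀ w < Fintype.card V, a ≤ w ↔ Separable G w Finset.univ) : IsPathwidth G a := by
  have hpos : 0 < Fintype.card V := Fintype.card_pos
  have hlb : ∀ (m : ℕ) (D : PathDecomposition G m), (a : ℤ) ≤ D.width := by
    intro m D
    obtain ⟨x, hx⟩ := Int.eq_ofNat_of_zero_le D.width_nonneg
    rw [hx]
    by_cases hxn : x < Fintype.card V
    · exact_mod_cast (h x hxn).2 (.of_pathDecomposition D hx.le)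
    · have := (h (Fintype.card V - 1) (by omega)).2 (.of_card_le (by omega) _)
      omega
  have ha : a < Fintype.card V := by
    have := (h (Fintype.card V - 1) (by omega)).2 (.of_card_le (by omega) _)
    omega
  obtain ⟨m, D, hD⟩ := ((h a ha).1 le_rfl).exists_pathDecomposition
  exact ⟨⟨m, D, le_antisymm hD (hlb m D)⟩, by rintro _ ⟨m, D, rfl⟩; exact hlb m D⟩

end Pathwidth

/-! ### Sweeps over a vertex cover -/

section VertexCover

variable {V : Type} [Fintype V] [DecidableEq V]

open Classical in
/-- In a state of a sweep over the vertex cover `C`, the vertices in `A` have been introduced and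
those in `B` have been forgotten. The active vertices are those of `A \ B` and the vertices
outside `C` with a forgotten neighbour and a neighbour that has not been introduced. -/
noncomputable def active (G : SimpleGraph V) (C A B : Finset V) : Finset V :=
  Finset.univ.filter fun v => (v ∈ A ∧ v ∉ B) ∨
    (v ∉ C ∧ (∃ u, G.Adj v u ∧ u ∈ B) ∧ ∃ u, G.Adj v u ∧ u ∉ A)

theorem mem_active {G : SimpleGraph V} {C A B : Finset V} {v : V} :
    v ∈ active G C A B ↔ (v ∈ A ∧ v ∉ B) ∨
      (v ∉ C ∧ (∃ u, G.Adj v u ∧ u ∈ B) ∧ ∃ u, G.Adj v u ∧ u ∉ A) := by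
  simp [active]

/-- A state that obeys the width bound `w`. -/
def Admissible (G : SimpleGraph V) (C : Finset V) (w : ℕ) (A B : Finset V) : Prop :=
  (∀ b ∈ B, ∀ u ∈ C, G.Adj b u → u ∈ A) ∧ (active G C A B).card ≤ w

/-- The states of sweeps of width `w`. -/
inductive Sweep (G : SimpleGraph V) (C : Finset V) (w : ℕ) : Finset V → Finset V → Prop
  | start : Sweep G C w ∅ ∅
  | introduce (x : V) (A B : Finset V) (h : Sweep G C w A B) (hx : x ∈ C) (hxA : x ∉ A)
      (hok : Admissible G C w (insert x A) B) : Sweep G C w (insert x A) B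
  | forget (b : V) (A B : Finset V) (h : Sweep G C w A B) (hb : b ∈ A) (hbB : b ∉ B)
      (hok : Admissible G C w A (insert b B)) : Sweep G C w A (insert b B)
  | replace (x b : V) (A B : Finset V) (h : Sweep G C w A B) (hx : x ∈ C) (hxA : x ∉ A)
      (hb : b ∈ insert x A) (hbB : b ∉ B)
      (hfree : ¬ ∃ v, v ∉ C ∧ G.Adj v x ∧ G.Adj v b ∧ (∀ u, G.Adj v u → u ∈ insert x A) ∧
        ∀ u, G.Adj v u → u ∈ insert b B → u = b)
      (hok : Admissible G C w (insert x A) (insert b B)) : Sweep G C w (insert x A) (insert b B)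

open Classical in
/-- The vertices that have been seen in a state of a sweep. -/
noncomputable def seen (G : SimpleGraph V) (C A B : Finset V) : Finset V :=
  Finset.univ.filter fun v => v ∈ A ∨
    (v ∉ C ∧ ((∀ u, G.Adj v u → u ∈ A) ∨ ∃ u, G.Adj v u ∧ u ∈ B))

theorem mem_seen {G : SimpleGraph V} {C A B : Finset V} {v : V} :
    v ∈ seen G C A B ↔ v ∈ A ∨
      (v ∉ C ∧ ((∀ u, G.Adj v u → u ∈ A) ∨ ∃ u, G.Adj v u ∧ u ∈ B)) := by
  simp [seen]

variable {G : SimpleGraph V} {C : Finset V} {w : ℕ}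

/-- What is missing from `S` are vertices outside `C` whose neighbours all lie in `A ⊆ S`; these can
be added for free. -/
theorem Separable.of_subset_seen {S A B : Finset V} (hS : Separable G w S) (hAS : A ⊆ S)
    (hsub : S ⊆ seen G C A B) (hB : ∀ v, v ∉ C → (∃ u, G.Adj v u ∧ u ∈ B) → v ∈ S) :
    Separable G w (seen G C A B) := by
  have h := hS.union_of_forall_adj (seen G C A B \ S) (by
    intro v hv u hu
    rw [Finset.mem_sdiff, mem_seen] at hv
    rcases hv with ⟨hv | ⟨hvC, hv | hv⟩, hvS⟩
    · exact absurd (hAS hv) hvS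
    · exact hAS (hv u hu)
    · exact absurd (hB v hvC hv) hvS)
  rwa [Finset.union_sdiff_of_subset hsub] at h

/-- This charges the boundary to the state. The set `D` absorbs vertices outside `C` that are placed
before any of their neighbours is forgotten, as happens in the middle of a forget step. -/
theorem boundary_subset_active {S A B : Finset V} (hAS : A ⊆ S) (hAC : ∀ v ∈ S, v ∈ C → v ∈ A)
    (hB : ∀ b ∈ B, ∀ u, G.Adj b u → u ∈ S) (D : Finset V)
    (hD : ∀ v ∈ S, v ∉ C → (∀ u, G.Adj v u → u ∈ S) ∨ (∃ u, G.Adj v u ∧ u ∈ B) ∨ v ∈ D) :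
    boundary G S ⊆ active G C A B ∪ D := by
  intro v hv
  rw [mem_boundary] at hv
  obtain ⟨hvS, u, hu, huS⟩ := hv
  rw [Finset.mem_union, mem_active]
  by_cases hvC : v ∈ C
  · exact .inl (.inl ⟨hAC v hvS hvC, fun hb => huS (hB v hb u hu)⟩)
  · rcases hD v hvS hvC with h | h | h
    · exact absurd (h u hu) huS
    · exact .inl (.inr ⟨hvC, h, u, hu, fun h => huS (hAS h)⟩)
    · exact .inr h

/-- After `x` itself, only vertices outside `C` for which `x` was the last missing neighbour become
seen, and these are free. -/
theorem Separable.seen_introduce {x : V} {A B : Finset V} (hAC : A ⊆ C)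
    (hok' : Admissible G C w A B) (hsep : Separable G w (seen G C A B)) (hx : x ∈ C)
    (hok : Admissible G C w (insert x A) B) : Separable G w (seen G C (insert x A) B) := by
  have hb : boundary G (insert x (seen G C A B)) ⊆ active G C (insert x A) B ∪ ∅ := by
    refine boundary_subset_active ?_ ?_ ?_ ∅ ?_
    · intro v hv
      rw [Finset.mem_insert, mem_seen]
      rw [Finset.mem_insert] at hv
      tauto
    · intro v hv hvC
      rw [Finset.mem_insert, mem_seen] at hv
      rw [Finset.mem_insert]
      tauto
    · intro b hb u hu
      rw [Finset.mem_insert, mem_seen]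
      by_cases huC : u ∈ C
      · exact .inr (.inl (hok'.1 b hb u huC hu))
      · exact .inr (.inr ⟨huC, .inr ⟨b, hu.symm, hb⟩⟩)
    · intro v hv hvC
      rw [Finset.mem_insert, mem_seen] at hv
      rcases hv with rfl | hv | ⟨_, hv | hv⟩
      · exact absurd hx hvC
      · exact absurd (hAC hv) hvC
      · refine .inl fun u hu => ?_
        rw [Finset.mem_insert, mem_seen]
        exact .inr (.inl (hv u hu))
      · exact .inr (.inl hv)
  rw [Finset.union_empty] at hb
  refine (Separable.add x _ hsep ((Finset.card_le_card hb).trans hok.2)).of_subset_seen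
    ?_ ?_ ?_
  · intro v hv
    rw [Finset.mem_insert, mem_seen]
    rw [Finset.mem_insert] at hv
    tauto
  · intro v hv
    rw [Finset.mem_insert, mem_seen] at hv
    rw [mem_seen, Finset.mem_insert]
    rcases hv with rfl | hv | ⟨hvC, hv | hv⟩
    · exact .inl (.inl rfl)
    · exact .inl (.inr hv)
    · exact .inr ⟨hvC, .inl fun u hu => Finset.mem_insert_of_mem (hv u hu)⟩
    · exact .inr ⟨hvC, .inr hv⟩
  · intro v hvC hv
    rw [Finset.mem_insert, mem_seen]
    exact .inr (.inr ⟨hvC, .inr hv⟩)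

/-- To close `b`, its unseen neighbours `D` outside `C` are added one by one. They all count as
active after the step, while `b` stops counting, so only the last addition can make use of the place
of `b`. -/
theorem Separable.seen_forget {b : V} {A B : Finset V} (hAC : A ⊆ C)
    (hok' : Admissible G C w A B) (hsep : Separable G w (seen G C A B)) (hb : b ∈ A) (hbB : b ∉ B)
    (hok : Admissible G C w A (insert b B)) : Separable G w (seen G C A (insert b B)) := by
  classical
  set S := seen G C A B with hS
  set D := Finset.univ.filter fun v => v ∉ C ∧ G.Adj v b ∧ v ∉ S with hDdef
  have hmemD : ∀ v, v ∈ D ↔ v ∉ C ∧ G.Adj v b ∧ v ∉ S := by simp [hDdef]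
  have hdisj : Disjoint ((active G C A B).erase b) D := by
    rw [Finset.disjoint_left]
    intro v hv hvD
    rw [Finset.mem_erase, mem_active] at hv
    rw [hmemD, hS, mem_seen] at hvD
    rcases hv.2 with h | ⟨h, h', -⟩
    · exact hvD.2.2 (.inl h.1)
    · exact hvD.2.2 (.inr ⟨h, .inr h'⟩)
  have hsubA : (active G C A B).erase b ∪ D ⊆ active G C A (insert b B) := by
    intro v hv
    rw [Finset.mem_union, Finset.mem_erase, mem_active, hmemD, hS, mem_seen] at hv
    rw [mem_active]
    simp only [Finset.mem_insert]
    rcases hv with ⟨hvb, ⟨h1, h2⟩ | ⟨h1, ⟨u, hu, hu'⟩, h3⟩⟩ | ⟨h1, h2, h3⟩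
    · exact .inl ⟨h1, by tauto⟩
    · exact .inr ⟨h1, ⟨u, hu, .inr hu'⟩, h3⟩
    · refine .inr ⟨h1, ⟨b, h2, .inl rfl⟩, ?_⟩
      by_contra hc
      push Not at hc
      exact h3 (.inr ⟨h1, .inl hc⟩)
  -- The active vertices other than `b` and those of `D` are disjoint and all active after the step.
  have hcard : (active G C A B).card + D.card ≤ w + 1 := by
    have h1 := (Finset.card_le_card hsubA).trans hok.2
    have hbm : b ∈ active G C A B := mem_active.2 (.inl ⟨hb, hbB⟩)
    rw [Finset.card_union_of_disjoint hdisj, Finset.card_erase_of_mem hbm] at h1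
    have := Finset.card_pos.2 ⟨b, hbm⟩
    omega
  have hbd : ∀ Z ⊆ D, Z ≠ ∅ → (boundary G (S ∪ Z)).card ≤ w := by
    intro Z hZ hZne
    have hmemZ : ∀ v ∈ S ∪ Z, v ∉ C →
        (∀ u, G.Adj v u → u ∈ S ∪ Z) ∨ (∃ u, G.Adj v u ∧ u ∈ B) ∨ v ∈ Z := by
      intro v hv hvC
      rw [Finset.mem_union, hS, mem_seen] at hv
      rcases hv with (hv | ⟨_, hv | hv⟩) | hv
      · exact absurd (hAC hv) hvC
      · exact .inl fun u hu => Finset.mem_union_left _ (mem_seen.2 (.inl (hv u hu)))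
      · exact .inr (.inl hv)
      · exact .inr (.inr hv)
    have hA1 : A ⊆ S ∪ Z := fun v hv => Finset.mem_union_left _ (mem_seen.2 (.inl hv))
    have hA2 : ∀ v ∈ S ∪ Z, v ∈ C → v ∈ A := by
      intro v hv hvC
      rw [Finset.mem_union, hS, mem_seen] at hv
      rcases hv with (hv | ⟨h, _⟩) | hv
      · exact hv
      · exact absurd hvC h
      · exact absurd hvC ((hmemD v).1 (hZ hv)).1
    have hA3 : ∀ b ∈ B, ∀ u, G.Adj b u → u ∈ S ∪ Z := by
      intro b hb u hu
      refine Finset.mem_union_left _ (mem_seen.2 ?_)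
      by_cases huC : u ∈ C
      · exact .inl (hok'.1 b hb u huC hu)
      · exact .inr ⟨huC, .inr ⟨b, hu.symm, hb⟩⟩
    -- With all of `D` added, `b` is closed and the bound of the new state applies. Before that, at
    -- least one vertex of `D` is missing, which makes up for `b`.
    by_cases hZD : Z = D
    · subst hZD
      refine (Finset.card_le_card ?_).trans hok.2
      rw [← Finset.union_empty (active G C A (insert b B))]
      refine boundary_subset_active hA1 hA2 ?_ ∅ ?_
      · intro b' hb' u hu
        rcases Finset.mem_insert.1 hb' with rfl | hb'
        · by_cases huC : u ∈ C
          · exact hA1 (hok.1 b' (Finset.mem_insert_self _ _) u huC hu)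
          · rw [Finset.mem_union, hmemD]
            by_cases huS : u ∈ S
            · exact .inl huS
            · exact .inr ⟨huC, hu.symm, huS⟩
        · exact hA3 b' hb' u hu
      · intro v hv hvC
        rcases hmemZ v hv hvC with h | ⟨u, hu, hu'⟩ | h
        · exact .inl h
        · exact .inr (.inl ⟨u, hu, Finset.mem_insert_of_mem hu'⟩)
        · exact .inr (.inl ⟨b, ((hmemD v).1 h).2.1, Finset.mem_insert_self _ _⟩)
    · have h1 := Finset.card_lt_card (Finset.ssubset_iff_subset_ne.2 ⟨hZ, hZD⟩)
      have h2 := (Finset.card_le_card (boundary_subset_active hA1 hA2 hA3 Z hmemZ)).trans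
        (Finset.card_union_le _ _)
      omega
  have hsepZ : ∀ Z ⊆ D, Separable G w (S ∪ Z) := by
    intro Z
    induction Z using Finset.induction_on with
    | empty => intro _; simpa using hsep
    | insert z Z _ ih =>
      intro hZ
      have h1 := ih ((Finset.subset_insert _ _).trans hZ)
      have h2 := hbd _ hZ (Finset.insert_ne_empty _ _)
      rw [Finset.union_insert] at h2 ⊢
      exact .add z _ h1 h2
  convert hsepZ D le_rfl using 1
  ext v
  rw [Finset.mem_union, hmemD, hS, mem_seen, mem_seen]
  constructor
  · rintro (h | ⟨h, h' | ⟨u, hu, hu'⟩⟩)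
    · exact .inl (.inl h)
    · exact .inl (.inr ⟨h, .inl h'⟩)
    · rcases Finset.mem_insert.1 hu' with rfl | hu'
      · tauto
      · exact .inl (.inr ⟨h, .inr ⟨u, hu, hu'⟩⟩)
  · rintro ((h | ⟨h, h' | ⟨u, hu, hu'⟩⟩) | ⟨h, h', _⟩)
    · exact .inl h
    · exact .inr ⟨h, .inl h'⟩
    · exact .inr ⟨h, .inr ⟨u, hu, Finset.mem_insert_of_mem hu'⟩⟩
    · exact .inr ⟨h, .inr ⟨b, h', Finset.mem_insert_self _ _⟩⟩

/-- If the intermediate state fits, the step splits into an introduction and a forgetting. Otherwise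
the new state has no room for a further active vertex. Together with `hfree` this forces every
outside neighbour of `b` to be seen already, so that adding `x` alone closes `b`. -/
theorem Separable.seen_replace {x b : V} {A B : Finset V} (hAC : A ⊆ C)
    (hok' : Admissible G C w A B) (hsep : Separable G w (seen G C A B)) (hx : x ∈ C)
    (hb : b ∈ insert x A) (hbB : b ∉ B)
    (hfree : ¬ ∃ v, v ∉ C ∧ G.Adj v x ∧ G.Adj v b ∧ (∀ u, G.Adj v u → u ∈ insert x A) ∧
      ∀ u, G.Adj v u → u ∈ insert b B → u = b)
    (hok : Admissible G C w (insert x A) (insert b B)) :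
    Separable G w (seen G C (insert x A) (insert b B)) := by
  have hmid : ∀ b ∈ B, ∀ u ∈ C, G.Adj b u → u ∈ insert x A := fun b hb u hu ha =>
    Finset.mem_insert_of_mem (hok'.1 b hb u hu ha)
  by_cases hcard : (active G C (insert x A) B).card ≤ w
  · exact (hsep.seen_introduce hAC hok' hx ⟨hmid, hcard⟩).seen_forget
      (Finset.insert_subset hx hAC) ⟨hmid, hcard⟩ hb hbB hok
  -- Otherwise `v` would become active in exchange for `b`, and the new state would be as large as
  -- the intermediate one, which exceeds `w`.
  have hnone : ∀ v, v ∉ C → G.Adj v b → (∀ u, G.Adj v u → u ∉ B) →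
      ∀ u, G.Adj v u → u ∈ insert x A := by
    intro v hvC hvb hvB
    by_contra hc
    push Not at hc
    have hsub : insert v ((active G C (insert x A) B).erase b) ⊆
        active G C (insert x A) (insert b B) := by
      intro y hy
      rw [mem_active]
      rcases Finset.mem_insert.1 hy with rfl | hy
      · exact .inr ⟨hvC, ⟨b, hvb, Finset.mem_insert_self _ _⟩, hc⟩
      · rw [Finset.mem_erase, mem_active] at hy
        rcases hy with ⟨hyb, ⟨h1, h2⟩ | ⟨h1, ⟨u, hu, hu'⟩, h3⟩⟩
        · exact .inl ⟨h1, by simp [hyb, h2]⟩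
        · exact .inr ⟨h1, ⟨u, hu, Finset.mem_insert_of_mem hu'⟩, h3⟩
    have hv : v ∉ (active G C (insert x A) B).erase b := by
      rw [Finset.mem_erase, mem_active]
      rintro ⟨-, ⟨h, -⟩ | ⟨-, ⟨u, hu, hu'⟩, -⟩⟩
      · exact hvC ((Finset.insert_subset hx hAC) h)
      · exact hvB u hu hu'
    have h1 := (Finset.card_le_card hsub).trans hok.2
    have hbm : b ∈ active G C (insert x A) B := mem_active.2 (.inl ⟨hb, hbB⟩)
    rw [Finset.card_insert_of_notMem hv, Finset.card_erase_of_mem hbm] at h1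
    omega
  have hseenb : ∀ v, v ∉ C → G.Adj v b → v ∈ seen G C A B := by
    intro v hvC hvb
    rw [mem_seen]
    by_cases hvB : ∃ u, G.Adj v u ∧ u ∈ B
    · exact .inr ⟨hvC, .inr hvB⟩
    · push Not at hvB
      have h1 := hnone v hvC hvb hvB
      refine .inr ⟨hvC, .inl fun u hu => ?_⟩
      rcases Finset.mem_insert.1 (h1 u hu) with rfl | h
      -- The case where `x` is a neighbour of `v`: this is exactly the configuration that `hfree`
      -- excludes.
      · refine absurd ⟨v, hvC, hu, hvb, h1, fun y hy hy' => ?_⟩ hfree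
        rcases Finset.mem_insert.1 hy' with h | h
        · exact h
        · exact absurd h (hvB y hy)
      · exact h
  have hA1 : insert x A ⊆ insert x (seen G C A B) :=
    Finset.insert_subset_insert _ fun v hv => mem_seen.2 (.inl hv)
  have hbd : boundary G (insert x (seen G C A B)) ⊆
      active G C (insert x A) (insert b B) ∪ ∅ := by
    refine boundary_subset_active hA1 ?_ ?_ ∅ ?_
    · intro v hv hvC
      rw [Finset.mem_insert, mem_seen] at hv
      rw [Finset.mem_insert]
      tauto
    · intro b' hb' u hu
      by_cases huC : u ∈ C
      · exact hA1 (hok.1 b' hb' u huC hu)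
      · refine Finset.mem_insert_of_mem ?_
        rcases Finset.mem_insert.1 hb' with rfl | hb'
        · exact hseenb u huC hu.symm
        · exact mem_seen.2 (.inr ⟨huC, .inr ⟨b', hu.symm, hb'⟩⟩)
    · intro v hv hvC
      rw [Finset.mem_insert, mem_seen] at hv
      rcases hv with rfl | hv | ⟨_, hv | ⟨u, hu, hu'⟩⟩
      · exact absurd hx hvC
      · exact absurd (hAC hv) hvC
      · exact .inl fun u hu => Finset.mem_insert_of_mem (mem_seen.2 (.inl (hv u hu)))
      · exact .inr (.inl ⟨u, hu, Finset.mem_insert_of_mem hu'⟩)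
  rw [Finset.union_empty] at hbd
  refine (Separable.add x _ hsep ((Finset.card_le_card hbd).trans hok.2)).of_subset_seen hA1 ?_ ?_
  · intro v hv
    rw [Finset.mem_insert, mem_seen] at hv
    rw [mem_seen, Finset.mem_insert]
    rcases hv with rfl | hv | ⟨hvC, hv | ⟨u, hu, hu'⟩⟩
    · exact .inl (.inl rfl)
    · exact .inl (.inr hv)
    · exact .inr ⟨hvC, .inl fun u hu => Finset.mem_insert_of_mem (hv u hu)⟩
    · exact .inr ⟨hvC, .inr ⟨u, hu, Finset.mem_insert_of_mem hu'⟩⟩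
  · rintro v hvC ⟨u, hu, hu'⟩
    refine Finset.mem_insert_of_mem ?_
    rcases Finset.mem_insert.1 hu' with rfl | hu'
    · exact hseenb v hvC hu
    · exact mem_seen.2 (.inr ⟨hvC, .inr ⟨u, hu, hu'⟩⟩)

/-! ### Sweeps and separations are equivalent -/

namespace Sweep

theorem sound {A B : Finset V} (h : Sweep G C w A B) :
    A ⊆ C ∧ Admissible G C w A B ∧ Separable G w (seen G C A B) := by
  induction h with
  | start =>
    refine ⟨by simp, ⟨by simp, ?_⟩, ?_⟩
    · have : active G C ∅ ∅ = ∅ := by ext v; simp [mem_active]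
      simp [this]
    · exact Separable.empty.of_subset_seen (by simp) (by simp) (by simp)
  | introduce x A B h hx hxA hok ih =>
    obtain ⟨hAC, hok', hsep⟩ := ih
    exact ⟨Finset.insert_subset hx hAC, hok, hsep.seen_introduce hAC hok' hx hok⟩
  | forget b A B h hb hbB hok ih =>
    obtain ⟨hAC, hok', hsep⟩ := ih
    exact ⟨hAC, hok, hsep.seen_forget hAC hok' hb hbB hok⟩
  | replace x b A B h hx hxA hb hbB hfree hok ih =>
    obtain ⟨hAC, hok', hsep⟩ := ih
    exact ⟨Finset.insert_subset hx hAC, hok, hsep.seen_replace hAC hok' hx hb hbB hfree hok⟩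

theorem forget_all {A B B' : Finset V} (h : Sweep G C w A B) (hBB' : B ⊆ B') (hB'A : B' ⊆ A)
    (hok : ∀ B₂, B ⊂ B₂ → B₂ ⊆ B' → Admissible G C w A B₂) : Sweep G C w A B' := by
  have key : ∀ Z ⊆ B' \ B, Sweep G C w A (B ∪ Z) := by
    intro Z
    induction Z using Finset.induction_on with
    | empty => intro _; simpa using h
    | insert z Z hz ih =>
      intro hZ
      have h1 := ih ((Finset.subset_insert _ _).trans hZ)
      have hzB := Finset.mem_sdiff.1 (hZ (Finset.mem_insert_self _ _))
      rw [Finset.union_insert]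
      refine .forget z A _ h1 (hB'A hzB.1) (by simp [hzB.2, hz]) (hok _ ?_ ?_)
      · refine Finset.ssubset_iff_subset_ne.2 ⟨fun v hv => by simp [hv], fun e => hzB.2 ?_⟩
        rw [e]; simp
      · intro v hv
        rw [Finset.mem_insert, Finset.mem_union] at hv
        rcases hv with rfl | hv | hv
        · exact hzB.1
        · exact hBB' hv
        · exact (Finset.mem_sdiff.1 (hZ (Finset.mem_insert_of_mem hv))).1
  have := key (B' \ B) le_rfl
  rwa [Finset.union_sdiff_of_subset hBB'] at this

open Classical in
/-- The vertices of `C ∩ S` that have no neighbour outside `S`. -/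
noncomputable def closedIn (G : SimpleGraph V) (C S : Finset V) : Finset V :=
  (C ∩ S).filter fun b => ∀ u, G.Adj b u → u ∈ S

theorem mem_closedIn {S : Finset V} {b : V} :
    b ∈ closedIn G C S ↔ b ∈ C ∩ S ∧ ∀ u, G.Adj b u → u ∈ S := by
  simp [closedIn]

/-- Adding `x` to `S` introduces `x` if it lies in `C`, and forgets the vertices of `C` closed by
it. All intermediate active sets lie in `boundary S` together with `x`, at most `w + 1` vertices;
once some `b` has been forgotten, its place is saved. So the only state that may fail is the one
between the introduction of `x` and the first forgetting, and `replace` bypasses it. -/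
theorem of_separable (hC : ∀ u v, G.Adj u v → u ∈ C ∨ v ∈ C) {S : Finset V}
    (h : Separable G w S) : Sweep G C w (C ∩ S) (closedIn G C S) := by
  induction h with
  | empty =>
    have h1 : closedIn G C ∅ = ∅ := by ext v; simp [mem_closedIn]
    rw [h1, Finset.inter_empty]
    exact .start
  | add x S hS hle ih =>
    by_cases hxS : x ∈ S
    · rwa [Finset.insert_eq_of_mem hxS]
    set S' := insert x S with hS'
    set A := C ∩ S with hA
    set A' := C ∩ S' with hA'
    set B := closedIn G C S with hB
    set B' := closedIn G C S' with hB'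
    have hmA : ∀ v, v ∈ A ↔ v ∈ C ∧ v ∈ S := fun v => Finset.mem_inter
    have hmS' : ∀ v, v ∈ S' ↔ v = x ∨ v ∈ S := fun v => Finset.mem_insert
    have hmA' : ∀ v, v ∈ A' ↔ v ∈ C ∧ (v = x ∨ v ∈ S) := fun v => by
      rw [hA', Finset.mem_inter, hmS']
    have hmB : ∀ v, v ∈ B ↔ v ∈ A ∧ ∀ u, G.Adj v u → u ∈ S := fun v => mem_closedIn
    have hmB' : ∀ v, v ∈ B' ↔ v ∈ A' ∧ ∀ u, G.Adj v u → u ∈ S' := fun v => mem_closedIn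
    have hBB' : B ⊆ B' := by
      intro v hv
      rw [hmB, hmA] at hv
      rw [hmB', hmA']
      exact ⟨⟨hv.1.1, .inr hv.1.2⟩, fun u hu => (hmS' u).2 (.inr (hv.2 u hu))⟩
    have hB'A' : B' ⊆ A' := fun v hv => ((hmB' v).1 hv).1
    have hxbd : x ∉ boundary G S := fun h => hxS (mem_boundary.1 h).1
    have hvalid : ∀ B₂ ⊆ B', ∀ b ∈ B₂, ∀ u ∈ C, G.Adj b u → u ∈ A' := by
      intro B₂ hB₂ b hb u huC hu
      rw [hmA', ← hmS']
      exact ⟨huC, ((hmB' b).1 (hB₂ hb)).2 u hu⟩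
    have hbig : ∀ B₂, B ⊆ B₂ → B₂ ⊆ B' → active G C A' B₂ ⊆ insert x (boundary G S) := by
      intro B₂ hBB₂ hB₂ v hv
      rw [Finset.mem_insert, mem_boundary]
      by_cases hvx : v = x
      · exact .inl hvx
      refine .inr ?_
      rw [mem_active] at hv
      rcases hv with ⟨h1, h2⟩ | ⟨h1, ⟨b, hb, hb'⟩, u, hu, hu'⟩
      · rw [hmA'] at h1
        have hvS : v ∈ S := h1.2.resolve_left hvx
        refine ⟨hvS, ?_⟩
        by_contra hc
        push Not at hc
        exact h2 (hBB₂ ((hmB v).2 ⟨(hmA v).2 ⟨h1.1, hvS⟩, hc⟩))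
      · refine ⟨?_, u, hu, fun huS => hu' ((hmA' u).2 ⟨(hC v u hu).resolve_left h1, .inr huS⟩)⟩
        exact ((hmS' v).1 (((hmB' b).1 (hB₂ hb')).2 v hb.symm)).resolve_left hvx
    -- The newly forgotten `b` was in the boundary of `S`, or is `x`, and is no longer active.
    have hok : ∀ B₂, B ⊂ B₂ → B₂ ⊆ B' → Admissible G C w A' B₂ := by
      intro B₂ hBB₂ hB₂
      refine ⟨hvalid B₂ hB₂, ?_⟩
      obtain ⟨b, hb, hbB⟩ := Finset.exists_of_ssubset hBB₂
      have hbB' := (hmB' b).1 (hB₂ hb)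
      have hbm : b ∈ insert x (boundary G S) := by
        rw [Finset.mem_insert, mem_boundary]
        by_cases hbx : b = x
        · exact .inl hbx
        have hbS := ((hmA' b).1 hbB'.1).2.resolve_left hbx
        refine .inr ⟨hbS, ?_⟩
        by_contra hc
        push Not at hc
        exact hbB ((hmB b).2 ⟨(hmA b).2 ⟨((hmA' b).1 hbB'.1).1, hbS⟩, hc⟩)
      have hsub : active G C A' B₂ ⊆ (insert x (boundary G S)).erase b := by
        intro v hv
        refine Finset.mem_erase.2 ⟨?_, hbig B₂ hBB₂.1 hB₂ hv⟩
        rintro rfl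
        rw [mem_active] at hv
        rcases hv with ⟨-, h2⟩ | ⟨h1, -⟩
        · exact h2 hb
        · exact h1 ((hmA' v).1 hbB'.1).1
      have h1 := Finset.card_le_card hsub
      rw [Finset.card_erase_of_mem hbm, Finset.card_insert_of_notMem hxbd] at h1
      have := hS.card_boundary_le
      omega
    by_cases hxC : x ∈ C
    · have hAA' : A' = insert x A := by
        ext v
        rw [hmA', Finset.mem_insert, hmA]
        constructor
        · rintro ⟨h1, h2 | h2⟩
          · exact .inl h2
          · exact .inr ⟨h1, h2⟩
        · rintro (rfl | h)
          · exact ⟨hxC, .inl rfl⟩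
          · exact ⟨h.1, .inr h.2⟩
      have hxA : x ∉ A := fun h => hxS ((hmA x).1 h).2
      by_cases hBeq : B' = B
      · rw [hBeq, hAA']
        rw [← hAA']
        have hokb : Admissible G C w A' B := by
          refine ⟨hvalid B hBB', (Finset.card_le_card fun v hv => ?_).trans hle⟩
          rw [mem_boundary]
          rw [mem_active] at hv
          rcases hv with ⟨h1, h2⟩ | ⟨h1, ⟨b, hb, hb'⟩, u, hu, hu'⟩
          · refine ⟨(hmS' v).2 ((hmA' v).1 h1).2, ?_⟩
            by_contra hc
            push Not at hc
            exact h2 (hBeq ▸ (hmB' v).2 ⟨h1, hc⟩)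
          · refine ⟨((hmB' b).1 (hBB' hb')).2 v hb.symm, u, hu, fun huS => hu' ?_⟩
            exact (hmA' u).2 ⟨(hC v u hu).resolve_left h1, (hmS' u).1 huS⟩
        rw [hAA'] at hokb ⊢
        exact .introduce x A B ih hxC hxA hokb
      · by_cases hcard : (active G C A' B).card ≤ w
        · have hokb : Admissible G C w A' B := ⟨hvalid B hBB', hcard⟩
          have h1 : Sweep G C w A' B := by
            rw [hAA'] at hokb ⊢
            exact .introduce x A B ih hxC hxA hokb
          exact h1.forget_all hBB' hB'A' hok
        · obtain ⟨b, hb, hbB⟩ := Finset.exists_of_ssubset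
            (Finset.ssubset_iff_subset_ne.2 ⟨hBB', Ne.symm hBeq⟩)
          have hins : insert b B ⊆ B' := Finset.insert_subset hb hBB'
          have hss : B ⊂ insert b B := Finset.ssubset_insert hbB
          have h1 : Sweep G C w A' (insert b B) := by
            have hokb := hok _ hss hins
            have hbA' := hB'A' hb
            rw [hAA'] at hokb hbA' ⊢
            refine .replace x b A B ih hxC hxA hbA' hbB ?_ hokb
            -- An excluded `v` lies in the boundary of `S`, because of `x`, but is not active before
            -- `b` is forgotten. So the intermediate state would have fitted after all.
            rintro ⟨v, hvC, hvx, hvb, hvA, hvB⟩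
            refine hcard ?_
            have hvx' : v ≠ x := fun e => hvC (e ▸ hxC)
            have hvbd : v ∈ boundary G S := mem_boundary.2
              ⟨((hmS' v).1 (((hmB' b).1 hb).2 v hvb.symm)).resolve_left hvx', x, hvx, hxS⟩
            have hsub : active G C A' B ⊆ (insert x (boundary G S)).erase v := by
              intro y hy
              refine Finset.mem_erase.2 ⟨?_, hbig B le_rfl hBB' hy⟩
              rintro rfl
              rw [mem_active] at hy
              rcases hy with ⟨h, -⟩ | ⟨-, ⟨u, hu, hu'⟩, -⟩
              · exact hvC ((hmA' y).1 h).1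
              · exact hbB (hvB u hu (Finset.mem_insert_of_mem hu') ▸ hu')
            have h1 := Finset.card_le_card hsub
            rw [Finset.card_erase_of_mem (Finset.mem_insert_of_mem hvbd),
              Finset.card_insert_of_notMem hxbd] at h1
            have := hS.card_boundary_le
            omega
          exact h1.forget_all hins hB'A' fun B₂ h2 h3 => hok B₂ (hss.trans h2) h3
    · have hAA' : A' = A := by
        ext v
        rw [hmA', hmA]
        constructor
        · rintro ⟨h1, rfl | h2⟩
          · exact absurd h1 hxC
          · exact ⟨h1, h2⟩
        · exact fun h => ⟨h.1, .inr h.2⟩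
      rw [hAA'] at hok hB'A' ⊢
      exact ih.forget_all hBB' hB'A' hok

/-- In the final state everything is seen, since a vertex outside the cover has all its neighbours
in `C`. -/
theorem iff_separable (hC : ∀ u v, G.Adj u v → u ∈ C ∨ v ∈ C) :
    Sweep G C w C C ↔ Separable G w Finset.univ := by
  constructor
  · intro h
    convert h.sound.2.2
    ext v
    simp only [Finset.mem_univ, mem_seen, true_iff]
    by_cases hv : v ∈ C
    · exact .inl hv
    · exact .inr ⟨hv, .inl fun u hu => (hC v u hu).resolve_left hv⟩
  · intro h
    have h1 := of_separable hC h
    have h2 : closedIn G C Finset.univ = C := by ext v; simp [mem_closedIn]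
    rwa [h2, Finset.inter_univ] at h1

end Sweep

end VertexCover

namespace RAM

/-! ### A structured language on top of the random access machine -/

/-- The program variables. -/
inductive Var where
  | res | guess | rest | pow | fail | nbr | vtx | st | cost | opt | unseen | gone | new | old
  | bad | left
  deriving DecidableEq

/-- The register of a variable. -/
def Var.idx : Var → ℕ
  | res => 0 | guess => 1 | rest => 2 | pow => 3 | fail => 4 | nbr => 5 | vtx => 6 | st => 7
  | cost => 8 | opt => 9 | unseen => 10 | gone => 11 | new => 12 | old => 13 | bad => 14
  | left => 15

/-- Registers from `32` on are scratch space, where expressions are evaluated without touching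
variables. -/
theorem Var.idx_lt (x : Var) : x.idx < 32 := by cases x <;> decide

theorem Var.idx_injective : Function.Injective Var.idx := by
  intro x y
  cases x <;> cases y <;> simp [Var.idx]

/-- The values of the variables, and the memory. -/
structure Store where
  vars : Var → ℕ
  mem : ℕ → ℕ

/-- Set variable `x` to `a`. -/
def Store.set (σ : Store) (x : Var) (a : ℕ) : Store :=
  { σ with vars := Function.update σ.vars x a }

/-- Set memory cell `i` to `a`. -/
def Store.write (σ : Store) (i a : ℕ) : Store :=
  { σ with mem := Function.update σ.mem i a }

@[simp] theorem Store.set_mem (σ : Store) (x : Var) (a : ℕ) : (σ.set x a).mem = σ.mem := rfl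

@[simp] theorem Store.write_vars (σ : Store) (i a : ℕ) : (σ.write i a).vars = σ.vars := rfl

@[simp] theorem Store.write_mem (σ : Store) (i a : ℕ) :
    (σ.write i a).mem = Function.update σ.mem i a := rfl

@[simp] theorem Store.set_vars_self (σ : Store) (x : Var) (a : ℕ) : (σ.set x a).vars x = a := by
  simp [Store.set]

@[simp] theorem Store.set_vars_of_ne (σ : Store) {x y : Var} (a : ℕ) (h : y ≠ x) :
    (σ.set x a).vars y = σ.vars y := by
  simp [Store.set, h]

/-- Expressions. -/
inductive Expr where
  | var (x : Var)
  | const (c : ℕ)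
  | load (e : Expr)
  | arith (o : ArithOp) (e₁ e₂ : Expr)

/-- The value of an expression. -/
def Expr.eval (σ : Store) : Expr → ℕ
  | var x => σ.vars x
  | const c => c
  | load e => σ.mem (e.eval σ)
  | arith o e₁ e₂ => o.eval (e₁.eval σ) (e₂.eval σ)

/-- The results of an operation that may be larger than its operands are at most `B`. -/
def ArithOp.Fits (B : ℕ) : ArithOp → ℕ → ℕ → Prop
  | add, a, b => a + b ≤ B
  | mul, a, b => a * b ≤ B
  | sub, _, _ => True
  | div, _, _ => True

/-- No value that occurs in the evaluation of the expression exceeds `B`. -/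
def Expr.Fits (B : ℕ) (σ : Store) : Expr → Prop
  | var _ => True
  | const c => c ≤ B
  | load e => e.Fits B σ
  | arith o e₁ e₂ => e₁.Fits B σ ∧ e₂.Fits B σ ∧ o.Fits B (e₁.eval σ) (e₂.eval σ)

/-- The program that evaluates an expression into register `d`. -/
def Expr.compile : Expr → ℕ → Program
  | var x, d => .seq (.const d 0) (.arith .add d x.idx d)
  | const c, d => .const d c
  | load e, d => .seq (e.compile d) (.load d d)
  | arith o e₁ e₂, d => .seq (e₁.compile d) (.seq (e₂.compile (d + 1)) (.arith o d d (d + 1)))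

/-- The number of instructions in the evaluation of an expression. -/
def Expr.time : Expr → ℕ
  | var _ => 2
  | const _ => 1
  | load e => e.time + 1
  | arith _ e₁ e₂ => e₁.time + (e₂.time + 1)

/-- The largest cost of an instruction when all values are at most `B`. -/
def unitCost (B : ℕ) : ℕ := 1 + 2 * Nat.size B

theorem size_add_size_le {B a b : ℕ} (ha : a ≤ B) (hb : b ≤ B) :
    1 + Nat.size a + Nat.size b ≤ unitCost B := by
  have := Nat.size_le_size ha
  have := Nat.size_le_size hb
  simp only [unitCost]; omega

theorem one_add_size_le {B a : ℕ} (ha : a ≤ B) : 1 + Nat.size a ≤ unitCost B :=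
  (Nat.le_add_right _ _).trans (size_add_size_le ha ha)

/-- The machine state `s` represents the store `σ`, and its values are at most `B`. -/
structure Represents (B : ℕ) (σ : Store) (s : State) : Prop where
  reg : ∀ x : Var, s.reg x.idx = σ.vars x
  mem : s.mem = σ.mem
  reg_le : ∀ r, s.reg r ≤ B
  mem_le : ∀ a, s.mem a ≤ B

theorem Represents.setReg_scratch {B : ℕ} {σ : Store} {s : State} (h : Represents B σ s)
    {d a : ℕ} (hd : 32 ≤ d) (ha : a ≤ B) : Represents B σ (s.setReg d a) := by
  refine ⟨fun x => ?_, h.mem, fun r => ?_, h.mem_le⟩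
  · have hne : x.idx ≠ d := by have := x.idx_lt; omega
    simp [State.setReg, hne, h.reg]
  · simp only [State.setReg, Function.update_apply]
    split_ifs
    · exact ha
    · exact h.reg_le r

theorem Represents.setReg_var {B : ℕ} {σ : Store} {s : State} (h : Represents B σ s)
    (x : Var) {a : ℕ} (ha : a ≤ B) : Represents B (σ.set x a) (s.setReg x.idx a) := by
  refine ⟨fun y => ?_, h.mem, fun r => ?_, h.mem_le⟩
  · simp [State.setReg, Store.set, Function.update_apply, Var.idx_injective.eq_iff, h.reg]
  · simp only [State.setReg, Function.update_apply]
    split_ifs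
    · exact ha
    · exact h.reg_le r

theorem Represents.setMem {B : ℕ} {σ : Store} {s : State} (h : Represents B σ s)
    (i : ℕ) {a : ℕ} (ha : a ≤ B) : Represents B (σ.write i a) (s.setMem i a) := by
  refine ⟨h.reg, by simp [State.setMem, Store.write, h.mem], h.reg_le, fun r => ?_⟩
  simp only [State.setMem, Function.update_apply]
  split_ifs
  · exact ha
  · exact h.mem_le r

/-- Evaluation into register `d` leaves the lower registers alone, so the first operand survives in
`d` while the second one is computed in `d + 1`. As all values stay below `B`, instructions can be
counted instead of adding up logarithmic costs. -/
theorem Expr.exec_compile {B : ℕ} {σ : Store} (e : Expr) : ∀ {d : ℕ} {s : State}, 32 ≤ d →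
    Represents B σ s → e.Fits B σ →
    ∃ s' t, Exec (e.compile d) s s' t ∧ t ≤ e.time * unitCost B ∧ Represents B σ s' ∧
      s'.reg d = e.eval σ ∧ ∀ r < d, s'.reg r = s.reg r := by
  induction e with
  | var x =>
    intro d s hd hs _
    have h1 := hs.setReg_scratch hd (Nat.zero_le B)
    have hne : x.idx ≠ d := by have := x.idx_lt; omega
    refine ⟨_, _, .seq _ _ _ _ _ _ _ (.const s d 0) (.arith _ .add d x.idx d), ?_, ?_, ?_, ?_⟩
    · have h2 := size_add_size_le (h1.reg_le x.idx) (h1.reg_le d)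
      have h3 := one_add_size_le (Nat.zero_le B)
      simp only [Expr.time]
      omega
    · refine h1.setReg_scratch hd ?_
      simpa [ArithOp.eval, State.setReg, hne] using hs.reg_le _
    · simp [ArithOp.eval, State.setReg, Expr.eval, hne, hs.reg]
    · intro r hr
      simp [State.setReg, hr.ne]
  | const c =>
    intro d s hd hs hf
    refine ⟨_, _, .const s d c, ?_, hs.setReg_scratch hd hf, ?_, ?_⟩
    · have := one_add_size_le hf
      simp only [Expr.time]; omega
    · simp [State.setReg, Expr.eval]
    · intro r hr
      simp [State.setReg, hr.ne]
  | load e ih =>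
    intro d s hd hs hf
    obtain ⟨s', t, he, ht, hs', hv, hr⟩ := ih hd hs hf
    refine ⟨_, _, .seq _ _ _ _ _ _ _ he (.load s' d d), ?_,
      hs'.setReg_scratch hd (hs'.mem_le _), ?_, ?_⟩
    · have := size_add_size_le (hs'.reg_le d) (hs'.mem_le (s'.reg d))
      simp only [Expr.time, Nat.add_mul]; omega
    · simp [State.setReg, Expr.eval, hv, hs'.mem]
    · intro r hrd
      simp [State.setReg, hrd.ne, hr r hrd]
  | arith o e₁ e₂ ih₁ ih₂ =>
    intro d s hd hs hf
    obtain ⟨s₁, t₁, he₁, ht₁, hs₁, hv₁, hr₁⟩ := ih₁ hd hs hf.1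
    obtain ⟨s₂, t₂, he₂, ht₂, hs₂, hv₂, hr₂⟩ := ih₂ (d := d + 1) (by omega) hs₁ hf.2.1
    have hd₂ : s₂.reg d = e₁.eval σ := by rw [hr₂ d (by omega), hv₁]
    refine ⟨_, _, .seq _ _ _ _ _ _ _ he₁ (.seq _ _ _ _ _ _ _ he₂ (.arith s₂ o d d (d + 1))),
      ?_, hs₂.setReg_scratch hd ?_, ?_, ?_⟩
    · have := size_add_size_le (hs₂.reg_le d) (hs₂.reg_le (d + 1))
      simp only [Expr.time, Nat.add_mul]; omega
    · have hle := hs₂.reg_le d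
      have hfit := hf.2.2
      rw [hv₂, hd₂]
      rw [hd₂] at hle
      cases o with
      | add => exact hfit
      | mul => exact hfit
      | sub => exact (Nat.sub_le _ _).trans hle
      | div => exact (Nat.div_le_self _ _).trans hle
    · simp [State.setReg, Expr.eval, hv₂, hd₂]
    · intro r hrd
      simp [State.setReg, hrd.ne, hr₂ r (by omega), hr₁ r hrd]

/-- Started in a state that represents `σ`, the program `P` halts after at most `T` instructions,
none of which sees a value above `B`, in a state that represents a store with property `Q`, and
memory cell `0` keeps its value. -/
def Runs (B T : ℕ) (P : Program) (Q : Store → Prop) (σ : Store) : Prop :=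
  ∀ s, Represents B σ s → ∃ s' σ' t, Exec P s s' t ∧ t ≤ T * unitCost B ∧ Represents B σ' s' ∧
    σ'.mem 0 = σ.mem 0 ∧ Q σ'

theorem Runs.mono {B T T' : ℕ} {P : Program} {Q Q' : Store → Prop} {σ : Store}
    (h : Runs B T P Q σ) (hT : T ≤ T') (hQ : ∀ σ', σ'.mem 0 = σ.mem 0 → Q σ' → Q' σ') :
    Runs B T' P Q' σ := by
  intro s hs
  obtain ⟨s', σ', t, he, ht, hs', h0, hq⟩ := h s hs
  exact ⟨s', σ', t, he, ht.trans (Nat.mul_le_mul_right _ hT), hs', h0, hQ σ' h0 hq⟩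

theorem Runs.seq {B T T' : ℕ} {P P' : Program} {Q Q' : Store → Prop} {σ : Store}
    (h : Runs B T P Q σ) (h' : ∀ σ', σ'.mem 0 = σ.mem 0 → Q σ' → Runs B T' P' Q' σ') :
    Runs B (T + T') (P.seq P') Q' σ := by
  intro s hs
  obtain ⟨s₁, σ₁, t₁, he₁, ht₁, hs₁, h₁, hq₁⟩ := h s hs
  obtain ⟨s₂, σ₂, t₂, he₂, ht₂, hs₂, h₂, hq₂⟩ := h' σ₁ h₁ hq₁ s₁ hs₁
  exact ⟨s₂, σ₂, _, .seq _ _ _ _ _ _ _ he₁ he₂, by rw [Nat.add_mul]; omega, hs₂, h₂.trans h₁, hq₂⟩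

/-- Statements; `forN x S` runs `S` for `x = 0, …, n - 1`, where `n` is the content of memory
cell `0`. -/
inductive Stmt where
  | skip
  | assign (x : Var) (e : Expr)
  | store (a e : Expr)
  | seq (S₁ S₂ : Stmt)
  | ite (e : Expr) (S₁ S₂ : Stmt)
  | forN (x : Var) (S : Stmt)

/-- The program for an assignment. -/
def compileAssign (x : Var) (e : Expr) : Program :=
  .seq (e.compile 32) (.seq (.const 33 0) (.arith .add x.idx 32 33))

/-- The expression `n - x`, where `n` is the content of memory cell `0`. -/
def Expr.remaining (x : Var) : Expr := .arith .sub (.load (.const 0)) (.var x)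

/-- The expression `x + 1`. -/
def Expr.succ (x : Var) : Expr := .arith .add (.var x) (.const 1)

/-- The program of a statement. -/
def Stmt.compile : Stmt → Program
  | skip => .skip
  | assign x e => compileAssign x e
  | store a e => .seq (a.compile 32) (.seq (e.compile 33) (.store 32 33))
  | seq S₁ S₂ => .seq S₁.compile S₂.compile
  | ite e S₁ S₂ => .seq (e.compile 32) (.branch 32 S₁.compile S₂.compile)
  | forN x S => .seq (compileAssign x (.const 0)) (.seq ((Expr.remaining x).compile 32)
      (.loop 32 (.seq S.compile (.seq (compileAssign x (Expr.succ x))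
        ((Expr.remaining x).compile 32)))))

/-- A bound for the number of instructions that a statement takes. -/
def Stmt.time (n : ℕ) : Stmt → ℕ
  | skip => 1
  | assign _ e => e.time + 2
  | store a e => a.time + (e.time + 1)
  | seq S₁ S₂ => S₁.time n + S₂.time n
  | ite e S₁ S₂ => e.time + 1 + (S₁.time n + S₂.time n)
  | forN _ S => 10 + n * (S.time n + 20)

/-- The only loops of the language run `n` times, so each level of nesting contributes a factor `n`.
The two exponential loops of the algorithm are kept outside the language. -/
theorem Stmt.exists_time_le (S : Stmt) : ∃ c d : ℕ, ∀ n, 1 ≤ n → S.time n ≤ c * n ^ d := by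
  have hmono : ∀ {a b d e n : ℕ}, 1 ≤ n → a * n ^ d + b * n ^ e ≤ (a + b) * n ^ (d + e) := by
    intro a b d e n hn
    have h1 : n ^ d ≤ n ^ (d + e) := Nat.pow_le_pow_right hn (by omega)
    have h2 : n ^ e ≤ n ^ (d + e) := Nat.pow_le_pow_right hn (by omega)
    rw [Nat.add_mul]
    exact Nat.add_le_add (Nat.mul_le_mul_left _ h1) (Nat.mul_le_mul_left _ h2)
  induction S with
  | skip => exact ⟨1, 0, fun n _ => by simp [Stmt.time]⟩
  | assign _ e => exact ⟨e.time + 2, 0, fun n _ => by simp [Stmt.time]⟩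
  | store a e => exact ⟨a.time + (e.time + 1), 0, fun n _ => by simp [Stmt.time]⟩
  | seq S₁ S₂ ih₁ ih₂ =>
    obtain ⟨c₁, d₁, h₁⟩ := ih₁
    obtain ⟨c₂, d₂, h₂⟩ := ih₂
    exact ⟨c₁ + c₂, d₁ + d₂, fun n hn => (Nat.add_le_add (h₁ n hn) (h₂ n hn)).trans (hmono hn)⟩
  | ite e S₁ S₂ ih₁ ih₂ =>
    obtain ⟨c₁, d₁, h₁⟩ := ih₁
    obtain ⟨c₂, d₂, h₂⟩ := ih₂
    refine ⟨e.time + 1 + (c₁ + c₂), 0 + (d₁ + d₂), fun n hn => ?_⟩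
    refine le_trans ?_ (hmono hn)
    have := (Nat.add_le_add (h₁ n hn) (h₂ n hn)).trans (hmono hn)
    simp only [Stmt.time, pow_zero, mul_one]
    omega
  | forN x S ih =>
    obtain ⟨c, d, h⟩ := ih
    refine ⟨10 + (c + 20), 0 + (1 + (d + 0)), fun n hn => ?_⟩
    refine le_trans ?_ (hmono hn)
    have h1 := (Nat.add_le_add_right (h n hn) (20 * n ^ 0)).trans (hmono hn)
    have h2 := Nat.mul_le_mul_left n h1
    have h3 : n * ((c + 20) * n ^ (d + 0)) = (c + 20) * n ^ (1 + (d + 0)) := by ring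
    simp only [Stmt.time, pow_zero, mul_one] at h2 ⊢
    omega

/-- Started in the store `σ`, the statement `S` ends in a store with property `Q`, and all values
are at most `B` on the way. -/
def Stmt.WP (B : ℕ) (S : Stmt) (Q : Store → Prop) (σ : Store) : Prop :=
  Runs B (S.time (σ.mem 0)) S.compile Q σ

theorem runs_compileAssign {B : ℕ} {x : Var} {e : Expr} {Q : Store → Prop} {σ : Store}
    (hf : e.Fits B σ) (hQ : Q (σ.set x (e.eval σ))) :
    Runs B (e.time + 2) (compileAssign x e) Q σ := by
  intro s hs
  obtain ⟨s₁, t₁, he₁, ht₁, hs₁, hv₁, hr₁⟩ := e.exec_compile (d := 32) le_rfl hs hf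
  have hs₂ := hs₁.setReg_scratch (d := 33) (by omega) (Nat.zero_le B)
  have hval : ArithOp.add.eval ((s₁.setReg 33 0).reg 32) ((s₁.setReg 33 0).reg 33) = e.eval σ := by
    simp [ArithOp.eval, State.setReg, hv₁]
  refine ⟨_, _, _, .seq _ _ _ _ _ _ _ he₁ (.seq _ _ _ _ _ _ _ (.const s₁ 33 0)
    (.arith _ .add x.idx 32 33)), ?_, hs₂.setReg_var x ?_, rfl, ?_⟩
  · have := size_add_size_le (hs₂.reg_le 32) (hs₂.reg_le 33)
    have := one_add_size_le (Nat.zero_le B)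
    simp only [Nat.add_mul]; omega
  · rw [hval, ← hv₁]
    exact hs₁.reg_le _
  · rwa [hval]

/-! ### Proof rules for statements -/

namespace Stmt

variable {B : ℕ} {Q : Store → Prop} {σ : Store}

theorem wp_skip (h : Q σ) : skip.WP B Q σ := by
  intro s hs
  exact ⟨s, σ, 1, .skip s, by simp [Stmt.time, unitCost], hs, rfl, h⟩

theorem wp_assign {x : Var} {e : Expr} (hf : e.Fits B σ) (hQ : Q (σ.set x (e.eval σ))) :
    (assign x e).WP B Q σ :=
  runs_compileAssign hf hQ

/-- Writing to cell `0` is forbidden: it holds `n`, on which loops and time bounds depend. -/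
theorem wp_store {a e : Expr} (ha : a.Fits B σ) (he : e.Fits B σ) (h0 : a.eval σ ≠ 0)
    (hQ : Q (σ.write (a.eval σ) (e.eval σ))) : (store a e).WP B Q σ := by
  intro s hs
  obtain ⟨s₁, t₁, he₁, ht₁, hs₁, hv₁, hr₁⟩ := a.exec_compile (d := 32) le_rfl hs ha
  obtain ⟨s₂, t₂, he₂, ht₂, hs₂, hv₂, hr₂⟩ := e.exec_compile (d := 33) (by omega) hs₁ he
  have h32 : s₂.reg 32 = a.eval σ := by rw [hr₂ 32 (by omega), hv₁]
  refine ⟨_, _, _, .seq _ _ _ _ _ _ _ he₁ (.seq _ _ _ _ _ _ _ he₂ (.store s₂ 32 33)), ?_,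
    hs₂.setMem _ (hs₂.reg_le _), ?_, ?_⟩
  · have := size_add_size_le (hs₂.reg_le 32) (hs₂.reg_le 33)
    simp only [Stmt.time, Nat.add_mul]; omega
  · rw [h32]
    simp [h0.symm]
  · rwa [h32, hv₂]

theorem wp_seq {S₁ S₂ : Stmt} (h : S₁.WP B (fun σ' => S₂.WP B Q σ') σ) :
    (S₁.seq S₂).WP B Q σ :=
  Runs.seq h fun σ' h0 hσ' => by
    rw [← h0]
    exact hσ'

theorem wp_ite {e : Expr} {S₁ S₂ : Stmt} (hf : e.Fits B σ) (h₁ : e.eval σ ≠ 0 → S₁.WP B Q σ)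
    (h₂ : e.eval σ = 0 → S₂.WP B Q σ) : (ite e S₁ S₂).WP B Q σ := by
  intro s hs
  obtain ⟨s₁, t₁, he₁, ht₁, hs₁, hv₁, hr₁⟩ := e.exec_compile (d := 32) le_rfl hs hf
  have hb := one_add_size_le (hs₁.reg_le 32)
  by_cases h : e.eval σ = 0
  · obtain ⟨s₂, σ₂, t₂, he₂, ht₂, hs₂, h0, hq⟩ := h₂ h s₁ hs₁
    refine ⟨s₂, σ₂, _, .seq _ _ _ _ _ _ _ he₁ (.branch_false _ _ _ _ _ _ (hv₁.trans h) he₂),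
      ?_, hs₂, h0, hq⟩
    simp only [Stmt.time, Nat.add_mul]; omega
  · obtain ⟨s₂, σ₂, t₂, he₂, ht₂, hs₂, h0, hq⟩ := h₁ h s₁ hs₁
    refine ⟨s₂, σ₂, _, .seq _ _ _ _ _ _ _ he₁
      (.branch_true _ _ _ _ _ _ (fun e => h (hv₁.symm.trans e)) he₂), ?_, hs₂, h0, hq⟩
    simp only [Stmt.time, Nat.add_mul]; omega

theorem wp_forN {x : Var} {S : Stmt} (Inv : ℕ → Store → Prop) (h0 : Inv 0 (σ.set x 0))
    (hS : ∀ j < σ.mem 0, ∀ σ', σ'.mem 0 = σ.mem 0 → σ'.vars x = j → Inv j σ' →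
      S.WP B (fun σ'' => σ''.vars x = j ∧ Inv (j + 1) (σ''.set x (j + 1))) σ')
    (hQ : ∀ σ', σ'.mem 0 = σ.mem 0 → Inv (σ.mem 0) σ' → Q σ') : (forN x S).WP B Q σ := by
  have hrem : ∀ σ', (Expr.remaining x).Fits B σ' := fun σ' => by
    simp [Expr.remaining, Expr.Fits, ArithOp.Fits]
  have hrem' : ∀ σ' : Store, (Expr.remaining x).eval σ' = σ'.mem 0 - σ'.vars x := fun σ' => by
    simp [Expr.remaining, Expr.eval, ArithOp.eval]
  have htime : (Expr.remaining x).time = 5 := rfl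
  -- Induction on the number `i` of remaining rounds, which is the content of the loop register
  -- `32`. The body may overwrite this register, so it is computed afresh from `x` after each round.
  have key : ∀ i j : ℕ, i + j = σ.mem 0 → ∀ σ' s, σ'.mem 0 = σ.mem 0 → σ'.vars x = j →
      Inv j σ' → Represents B σ' s → s.reg 32 = i → ∃ s' σ'' t,
      Exec (.loop 32 (.seq S.compile (.seq (compileAssign x (Expr.succ x))
        ((Expr.remaining x).compile 32)))) s s' t ∧
      t ≤ (1 + i * (S.time (σ.mem 0) + 20)) * unitCost B ∧ Represents B σ'' s' ∧
      σ''.mem 0 = σ.mem 0 ∧ Inv (σ.mem 0) σ'' := by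
    intro i
    induction i with
    | zero =>
      intro j hj σ' s hm hx hinv hs hreg
      refine ⟨s, σ', 1, .loop_done _ _ _ hreg, by simp [unitCost], hs, hm, ?_⟩
      rwa [← hj, Nat.zero_add]
    | succ i ih =>
      intro j hj σ' s hm hx hinv hs hreg
      obtain ⟨s₁, σ₁, t₁, he₁, ht₁, hs₁, hm₁, hx₁, hi₁⟩ :=
        hS j (by omega) σ' hm hx hinv s hs
      have hB : σ.mem 0 ≤ B := by
        have := hs.mem_le 0
        rwa [hs.mem, hm] at this
      obtain ⟨s₂, σ₂, t₂, he₂, ht₂, hs₂, hm₂, rfl⟩ := runs_compileAssign (B := B) (x := x)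
        (e := Expr.succ x) (Q := fun τ => τ = σ₁.set x (j + 1)) (σ := σ₁)
        (by simp [Expr.succ, Expr.Fits, Expr.eval, ArithOp.Fits, hx₁]; omega)
        (by simp [Expr.succ, Expr.eval, ArithOp.eval, hx₁]) s₁ hs₁
      obtain ⟨s₃, t₃, he₃, ht₃, hs₃, hv₃, -⟩ :=
        (Expr.remaining x).exec_compile (d := 32) le_rfl hs₂ (hrem _)
      obtain ⟨s₄, σ₄, t₄, he₄, ht₄, hs₄, hm₄, hi₄⟩ := ih (j + 1) (by omega) _ s₃
        (hm₂.trans (hm₁.trans hm)) (by simp) hi₁ hs₃ (by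
          rw [hv₃, hrem', hm₂, hm₁, hm]; simp; omega)
      refine ⟨s₄, σ₄, _, .loop_step _ _ _ _ _ _ _ (by omega)
        (.seq _ _ _ _ _ _ _ he₁ (.seq _ _ _ _ _ _ _ he₂ he₃)) he₄, ?_, hs₄, hm₄, hi₄⟩
      have hb := one_add_size_le (hs.reg_le 32)
      rw [hm] at ht₁
      rw [htime] at ht₃
      simp only [Expr.succ, Expr.time] at ht₂
      have : (1 + (i + 1) * (S.time (σ.mem 0) + 20)) * unitCost B =
        (1 + i * (S.time (σ.mem 0) + 20)) * unitCost B + S.time (σ.mem 0) * unitCost B +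
          20 * unitCost B := by ring
      omega
  intro s hs
  obtain ⟨s₁, σ₁, t₁, he₁, ht₁, hs₁, hm₁, rfl⟩ := runs_compileAssign (B := B) (x := x)
    (e := .const 0) (Q := fun τ => τ = σ.set x 0) (σ := σ) (Nat.zero_le B) rfl s hs
  obtain ⟨s₂, t₂, he₂, ht₂, hs₂, hv₂, -⟩ :=
    (Expr.remaining x).exec_compile (d := 32) le_rfl hs₁ (hrem _)
  obtain ⟨s₃, σ₃, t₃, he₃, ht₃, hs₃, hm₃, hi₃⟩ := key (σ.mem 0) 0 (by omega) _ s₂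
    hm₁ (by simp) h0 hs₂ (by rw [hv₂, hrem']; simp)
  refine ⟨s₃, σ₃, _, .seq _ _ _ _ _ _ _ he₁ (.seq _ _ _ _ _ _ _ he₂ he₃), ?_, hs₃, hm₃,
    hQ _ hm₃ hi₃⟩
  rw [htime] at ht₂
  simp only [Expr.time] at ht₁
  simp only [Stmt.time, Nat.add_mul] at ht₃ ⊢
  omega

end Stmt

/-- The invariant counts rounds and must itself show that fewer than `K` of them precede any further
round. This replaces a decreasing measure. -/
theorem runs_loop {B n : ℕ} {x : Var} {S : Stmt} (Inv : ℕ → Store → Prop) (K : ℕ)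
    (hS : ∀ j σ, σ.mem 0 = n → Inv j σ → σ.vars x ≠ 0 → j < K ∧ S.WP B (Inv (j + 1)) σ)
    {σ : Store} (hn : σ.mem 0 = n) (h0 : Inv 0 σ) :
    Runs B (1 + K * (S.time n + 1)) (.loop x.idx S.compile)
      (fun σ' => σ'.vars x = 0 ∧ ∃ j, Inv j σ') σ := by
  have key : ∀ i j, i + j = K → ∀ σ, σ.mem 0 = n → Inv j σ →
      Runs B (1 + i * (S.time n + 1)) (.loop x.idx S.compile)
        (fun σ' => σ'.vars x = 0 ∧ ∃ j, Inv j σ') σ := by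
    intro i
    induction i with
    | zero =>
      intro j hj σ hn hi s hs
      have hx : σ.vars x = 0 := by
        by_contra hx
        have := (hS j σ hn hi hx).1
        omega
      exact ⟨s, σ, 1, .loop_done _ _ _ ((hs.reg x).trans hx), by simp [unitCost], hs, rfl, hx,
        j, hi⟩
    | succ i ih =>
      intro j hj σ hn hi s hs
      by_cases hx : σ.vars x = 0
      · refine ⟨s, σ, 1, .loop_done _ _ _ ((hs.reg x).trans hx), ?_, hs, rfl, hx, j, hi⟩
        simp only [unitCost, Nat.add_mul]; omega
      · obtain ⟨s₁, σ₁, t₁, he₁, ht₁, hs₁, hm₁, hi₁⟩ := (hS j σ hn hi hx).2 s hs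
        obtain ⟨s₂, σ₂, t₂, he₂, ht₂, hs₂, hm₂, hq₂⟩ :=
          ih (j + 1) (by omega) σ₁ (hm₁.trans hn) hi₁ s₁ hs₁
        refine ⟨s₂, σ₂, _, .loop_step _ _ _ _ _ _ _ (fun e => hx ((hs.reg x).symm.trans e))
          he₁ he₂, ?_, hs₂, hm₂.trans hm₁, hq₂⟩
        have hb := one_add_size_le (hs.reg_le x.idx)
        rw [hn] at ht₁
        have : (1 + (i + 1) * (S.time n + 1)) * unitCost B =
          (1 + i * (S.time n + 1)) * unitCost B + S.time n * unitCost B + unitCost B := by ring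
        omega
  exact key K 0 (by omega) σ hn h0

end RAM

namespace RAM

/-! ### Expressions and memory layout of the algorithm -/

instance : Add Expr := ⟨Expr.arith .add⟩
instance : Sub Expr := ⟨Expr.arith .sub⟩
instance : Mul Expr := ⟨Expr.arith .mul⟩
instance : Div Expr := ⟨Expr.arith .div⟩

namespace Expr

variable {B : ℕ} {σ : Store}

@[simp] theorem eval_var (x : Var) : (var x).eval σ = σ.vars x := rfl
@[simp] theorem eval_const (c : ℕ) : (const c).eval σ = c := rfl
theorem eval_load (e : Expr) : (load e).eval σ = σ.mem (e.eval σ) := rfl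
@[simp] theorem eval_add (e₁ e₂ : Expr) : (e₁ + e₂).eval σ = e₁.eval σ + e₂.eval σ := rfl
@[simp] theorem eval_sub (e₁ e₂ : Expr) : (e₁ - e₂).eval σ = e₁.eval σ - e₂.eval σ := rfl
@[simp] theorem eval_mul (e₁ e₂ : Expr) : (e₁ * e₂).eval σ = e₁.eval σ * e₂.eval σ := rfl
@[simp] theorem eval_div (e₁ e₂ : Expr) : (e₁ / e₂).eval σ = e₁.eval σ / e₂.eval σ := rfl

@[simp] theorem fits_var (x : Var) : (var x).Fits B σ := trivial
@[simp] theorem fits_const (c : ℕ) : (const c).Fits B σ ↔ c ≤ B := Iff.rfl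
theorem fits_load (e : Expr) : (load e).Fits B σ ↔ e.Fits B σ := Iff.rfl
@[simp] theorem fits_add (e₁ e₂ : Expr) : (e₁ + e₂).Fits B σ ↔
    e₁.Fits B σ ∧ e₂.Fits B σ ∧ e₁.eval σ + e₂.eval σ ≤ B := Iff.rfl
@[simp] theorem fits_sub (e₁ e₂ : Expr) : (e₁ - e₂).Fits B σ ↔ e₁.Fits B σ ∧ e₂.Fits B σ :=
  ⟨fun h => ⟨h.1, h.2.1⟩, fun h => ⟨h.1, h.2, trivial⟩⟩
@[simp] theorem fits_mul (e₁ e₂ : Expr) : (e₁ * e₂).Fits B σ ↔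
    e₁.Fits B σ ∧ e₂.Fits B σ ∧ e₁.eval σ * e₂.eval σ ≤ B := Iff.rfl
@[simp] theorem fits_div (e₁ e₂ : Expr) : (e₁ / e₂).Fits B σ ↔ e₁.Fits B σ ∧ e₂.Fits B σ :=
  ⟨fun h => ⟨h.1, h.2.1⟩, fun h => ⟨h.1, h.2, trivial⟩⟩

/-- The content of memory cell `0`. -/
def size : Expr := load (const 0)

/-- The remainder modulo `3`. -/
def mod3 (e : Expr) : Expr := e - e / const 3 * const 3

/-- The entry of the adjacency matrix at row `x` and column `y`. -/
def adj (x y : Var) : Expr := load (const 1 + (size * var x + var y))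

/-- The address of the weight of the vertex `x`. -/
def wtAddr (x : Var) : Expr := size * size + const 1 + var x

/-- The weight of the vertex `x`. -/
def wt (x : Var) : Expr := load (wtAddr x)

/-- The address of the table entry for the state `e`. -/
def bestAddr (e : Expr) : Expr := size * size + size + const 1 + e

/-- The table entry for the state `e`. -/
def best (e : Expr) : Expr := load (bestAddr e)

/-- The digit of the current state at the vertex `x`. -/
def dig (x : Var) : Expr := mod3 (var .st / wt x)

@[simp] theorem eval_mod3 (e : Expr) : (mod3 e).eval σ = e.eval σ % 3 := by
  simp only [mod3, eval_sub, eval_mul, eval_div, eval_const]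
  omega

theorem fits_mod3 {e : Expr} (h : e.Fits B σ) (hB : e.eval σ ≤ B) (h3 : 3 ≤ B) :
    (mod3 e).Fits B σ := by
  simp only [mod3, fits_sub, fits_mul, fits_div, fits_const, eval_div, eval_const]
  exact ⟨h, ⟨h, h3⟩, h3, by omega⟩

end Expr

/-- The memory with the size `n`, the adjacency matrix `a`, the weights `w` and the table `b`. -/
def layout (n : ℕ) (a w b : ℕ → ℕ) (i : ℕ) : ℕ :=
  if i = 0 then n else if i ≤ n * n then a (i - 1)
  else if i ≤ n * n + n then w (i - (n * n + 1)) else b (i - (n * n + n + 1))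

section layout

variable {n : ℕ} {a w b : ℕ → ℕ}

@[simp] theorem layout_zero : layout n a w b 0 = n := by simp [layout]

theorem mul_add_lt {n v u : ℕ} (hv : v < n) (hu : u < n) : n * v + u < n * n := by
  have : n * (v + 1) ≤ n * n := Nat.mul_le_mul_left n hv
  rw [Nat.mul_add] at this
  omega

theorem layout_adj {v u : ℕ} (hv : v < n) (hu : u < n) :
    layout n a w b (1 + (n * v + u)) = a (n * v + u) := by
  have := mul_add_lt hv hu
  rw [layout, if_neg (by omega), if_pos (by omega), Nat.add_sub_cancel_left]

theorem layout_wt {v : ℕ} (hv : v < n) : layout n a w b (n * n + 1 + v) = w v := by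
  rw [layout, if_neg (by omega), if_neg (by omega), if_pos (by omega), Nat.add_sub_cancel_left]

theorem layout_best {s : ℕ} : layout n a w b (n * n + n + 1 + s) = b s := by
  rw [layout, if_neg (by omega), if_neg (by omega), if_neg (by omega), Nat.add_sub_cancel_left]

theorem update_layout_wt {v c : ℕ} (hv : v < n) :
    Function.update (layout n a w b) (n * n + 1 + v) c =
      layout n a (Function.update w v c) b := by
  funext i
  simp only [Function.update_apply, layout]
  split_ifs <;> first | rfl | omega

theorem update_layout_best {s c : ℕ} :
    Function.update (layout n a w b) (n * n + n + 1 + s) c =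
      layout n a w (Function.update b s c) := by
  funext i
  simp only [Function.update_apply, layout]
  split_ifs <;> first | rfl | omega

end layout

/-- The digit of the state `s` at the vertex `v`. -/
def digit (w : ℕ → ℕ) (s v : ℕ) : ℕ := s / w v % 3

/-- The stores in which expressions of the algorithm can be evaluated. -/
structure Ready (B n : ℕ) (a w b : ℕ → ℕ) (σ : Store) : Prop where
  mem : σ.mem = layout n a w b
  three_le : 3 ≤ B
  size_le : n * n + n + 1 ≤ B
  st_le : n * n + n + 1 + σ.vars .st ≤ B

namespace Ready

variable {B n : ℕ} {a w b : ℕ → ℕ} {σ : Store}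

theorem eval_size (h : Ready B n a w b σ) : Expr.size.eval σ = n := by
  simp [Expr.size, Expr.eval_load, h.mem]

theorem fits_size : Expr.size.Fits B σ := Nat.zero_le B

theorem eval_adj (h : Ready B n a w b σ) {x y : Var} (hx : σ.vars x < n) (hy : σ.vars y < n) :
    (Expr.adj x y).eval σ = a (n * σ.vars x + σ.vars y) := by
  simp only [Expr.adj, Expr.eval_load, Expr.eval_add, Expr.eval_mul, Expr.eval_const,
    Expr.eval_var, h.eval_size, h.mem]
  exact layout_adj hx hy

theorem fits_adj (h : Ready B n a w b σ) {x y : Var} (hx : σ.vars x < n) (hy : σ.vars y < n) :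
    (Expr.adj x y).Fits B σ := by
  have := mul_add_lt hx hy
  have := h.size_le
  simp only [Expr.adj, Expr.fits_load, Expr.fits_add, Expr.fits_mul, Expr.fits_const,
    Expr.eval_add, Expr.eval_mul, Expr.eval_const, Expr.eval_var, h.eval_size, fits_size,
    Expr.fits_var, true_and]
  omega

theorem eval_wtAddr (h : Ready B n a w b σ) {x : Var} :
    (Expr.wtAddr x).eval σ = n * n + 1 + σ.vars x := by
  simp [Expr.wtAddr, h.eval_size]

theorem fits_wtAddr (h : Ready B n a w b σ) {x : Var} (hx : σ.vars x < n) :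
    (Expr.wtAddr x).Fits B σ := by
  have := h.size_le
  simp only [Expr.wtAddr, Expr.fits_add, Expr.fits_mul, Expr.fits_const,
    Expr.eval_add, Expr.eval_mul, Expr.eval_const, Expr.eval_var, h.eval_size, fits_size,
    Expr.fits_var, true_and]
  omega

theorem eval_wt (h : Ready B n a w b σ) {x : Var} (hx : σ.vars x < n) :
    (Expr.wt x).eval σ = w (σ.vars x) := by
  rw [Expr.wt, Expr.eval_load, h.eval_wtAddr, h.mem, layout_wt hx]

theorem fits_wt (h : Ready B n a w b σ) {x : Var} (hx : σ.vars x < n) : (Expr.wt x).Fits B σ :=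
  h.fits_wtAddr hx

theorem eval_bestAddr (h : Ready B n a w b σ) {e : Expr} :
    (Expr.bestAddr e).eval σ = n * n + n + 1 + e.eval σ := by
  simp [Expr.bestAddr, h.eval_size]

theorem fits_bestAddr (h : Ready B n a w b σ) {e : Expr} (hf : e.Fits B σ)
    (he : e.eval σ ≤ σ.vars .st) : (Expr.bestAddr e).Fits B σ := by
  have := h.size_le
  have := h.st_le
  simp only [Expr.bestAddr, Expr.fits_add, Expr.fits_mul, Expr.fits_const,
    Expr.eval_add, Expr.eval_mul, Expr.eval_const, h.eval_size, fits_size, true_and, hf]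
  omega

theorem eval_best (h : Ready B n a w b σ) {e : Expr} : (Expr.best e).eval σ = b (e.eval σ) := by
  rw [Expr.best, Expr.eval_load, h.eval_bestAddr, h.mem, layout_best]

theorem fits_best (h : Ready B n a w b σ) {e : Expr} (hf : e.Fits B σ)
    (he : e.eval σ ≤ σ.vars .st) : (Expr.best e).Fits B σ :=
  h.fits_bestAddr hf he

theorem eval_dig (h : Ready B n a w b σ) {x : Var} (hx : σ.vars x < n) :
    (Expr.dig x).eval σ = digit w (σ.vars .st) (σ.vars x) := by
  rw [Expr.dig, Expr.eval_mod3, Expr.eval_div, Expr.eval_var, h.eval_wt hx, digit]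

theorem fits_dig (h : Ready B n a w b σ) {x : Var} (hx : σ.vars x < n) :
    (Expr.dig x).Fits B σ := by
  have := h.st_le
  refine Expr.fits_mod3 (by simp [h.fits_wt hx]) ?_ h.three_le
  rw [Expr.eval_div, Expr.eval_var]
  exact (Nat.div_le_self _ _).trans (by omega)

theorem of_eq (h : Ready B n a w b σ) {σ' : Store} (hm : σ'.mem = σ.mem)
    (ht : σ'.vars .st = σ.vars .st) : Ready B n a w b σ' :=
  ⟨hm.trans h.mem, h.three_le, h.size_le, ht ▸ h.st_le⟩

end Ready

/-- The stores `σ` and `σ'` have the same memory, and they agree in all variables outside `l`. -/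
def AgreeOff (l : List Var) (σ σ' : Store) : Prop :=
  σ'.mem = σ.mem ∧ ∀ x ∉ l, σ'.vars x = σ.vars x

namespace AgreeOff

variable {l l' : List Var} {σ σ' σ'' : Store}

theorem refl (l : List Var) (σ : Store) : AgreeOff l σ σ := ⟨rfl, fun _ _ => rfl⟩

theorem set (h : AgreeOff l σ σ') (x : Var) (a : ℕ) (hx : x ∈ l := by decide) :
    AgreeOff l σ (σ'.set x a) :=
  ⟨h.1, fun y hy => by
    have hne : y ≠ x := fun e => hy (e ▸ hx)
    rw [Store.set_vars_of_ne _ _ hne, h.2 y hy]⟩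

theorem trans (h : AgreeOff l σ σ') (h' : AgreeOff l' σ' σ'') (hl : ∀ x ∈ l', x ∈ l := by decide) :
    AgreeOff l σ σ'' :=
  ⟨h'.1.trans h.1, fun x hx => (h'.2 x fun e => hx (hl x e)).trans (h.2 x hx)⟩

theorem eq (h : AgreeOff l σ σ') (x : Var) (hx : x ∉ l := by decide) : σ'.vars x = σ.vars x :=
  h.2 x hx

theorem ready {B n : ℕ} {a w b : ℕ → ℕ} (h : AgreeOff l σ σ') (hr : Ready B n a w b σ)
    (hx : Var.st ∉ l := by decide) : Ready B n a w b σ' :=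
  hr.of_eq h.1 (h.eq .st hx)

end AgreeOff

/-! ### Neighbours of a vertex -/

/-- The number of neighbours of `v` that belong to the cover and have not been introduced. -/
def unseenCount (n : ℕ) (a w : ℕ → ℕ) (s v j : ℕ) : ℕ :=
  ∑ u ∈ Finset.range j, if a (n * v + u) ≠ 0 ∧ w u ≠ 0 ∧ digit w s u = 0 then 1 else 0

/-- The number of neighbours of `v` that have been forgotten. -/
def goneCount (n : ℕ) (a w : ℕ → ℕ) (s v j : ℕ) : ℕ :=
  ∑ u ∈ Finset.range j, if a (n * v + u) ≠ 0 ∧ digit w s u = 2 then 1 else 0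

theorem unseenCount_succ (n : ℕ) (a w : ℕ → ℕ) (s v j : ℕ) :
    unseenCount n a w s v (j + 1) = unseenCount n a w s v j +
      if a (n * v + j) ≠ 0 ∧ w j ≠ 0 ∧ digit w s j = 0 then 1 else 0 :=
  Finset.sum_range_succ _ _

theorem goneCount_succ (n : ℕ) (a w : ℕ → ℕ) (s v j : ℕ) :
    goneCount n a w s v (j + 1) = goneCount n a w s v j +
      if a (n * v + j) ≠ 0 ∧ digit w s j = 2 then 1 else 0 :=
  Finset.sum_range_succ _ _

theorem unseenCount_le (n : ℕ) (a w : ℕ → ℕ) (s v j : ℕ) : unseenCount n a w s v j ≤ j :=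
  (Finset.sum_le_card_nsmul _ _ 1 fun u _ => by split_ifs <;> simp).trans (by simp)

theorem goneCount_le (n : ℕ) (a w : ℕ → ℕ) (s v j : ℕ) : goneCount n a w s v j ≤ j :=
  (Finset.sum_le_card_nsmul _ _ 1 fun u _ => by split_ifs <;> simp).trans (by simp)

theorem digit_le_two (w : ℕ → ℕ) (s v : ℕ) : digit w s v ≤ 2 := by
  have := Nat.mod_lt (s / w v) (by omega : 0 < 3)
  simp only [digit]; omega

/-- Division by zero gives zero, so vertices outside the cover look as if they were never
introduced. This is why `unseenCount` tests the weight and `goneCount` need not. -/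
theorem digit_of_wt_eq_zero {w : ℕ → ℕ} {s v : ℕ} (h : w v = 0) : digit w s v = 0 := by
  simp [digit, h]

namespace Stmt

/-- Add one to a variable. -/
def incr (x : Var) : Stmt := assign x (.var x + .const 1)

theorem wp_incr {B : ℕ} {σ : Store} {Q : Store → Prop} {x : Var} (hB : σ.vars x + 1 ≤ B)
    (hQ : Q (σ.set x (σ.vars x + 1))) : (incr x).WP B Q σ :=
  wp_assign (by simp only [Expr.fits_add, Expr.fits_var, Expr.fits_const, Expr.eval_var,
    Expr.eval_const, true_and]; omega) (by simpa using hQ)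

/-- Count the neighbours of the vertex `vtx` that have not been introduced, and those that have
been forgotten. -/
def scan : Stmt :=
  .seq (.assign .unseen (.const 0)) <| .seq (.assign .gone (.const 0)) <| .forN .nbr <|
    .ite (.adj .vtx .nbr)
      (.ite (.wt .nbr)
        (.ite (.dig .nbr) (.ite (.dig .nbr - .const 1) (incr .gone) .skip) (incr .unseen))
        .skip)
      .skip

theorem wp_scan {B n : ℕ} {a w b : ℕ → ℕ} {σ : Store} {Q : Store → Prop}
    (hr : Ready B n a w b σ) (hv : σ.vars .vtx < n)
    (hQ : ∀ σ', AgreeOff [.nbr, .unseen, .gone] σ σ' →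
      σ'.vars .unseen = unseenCount n a w (σ.vars .st) (σ.vars .vtx) n →
      σ'.vars .gone = goneCount n a w (σ.vars .st) (σ.vars .vtx) n → Q σ') :
    scan.WP B Q σ := by
  have h3 := hr.three_le
  have hsz := hr.size_le
  refine wp_seq (wp_assign (Nat.zero_le B) (wp_seq (wp_assign (Nat.zero_le B) ?_)))
  have h0 : ((σ.set .unseen 0).set .gone 0).mem 0 = n := by simp [hr.mem]
  refine wp_forN (fun j σ' => AgreeOff [.nbr, .unseen, .gone] σ σ' ∧
    σ'.vars .unseen = unseenCount n a w (σ.vars .st) (σ.vars .vtx) j ∧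
    σ'.vars .gone = goneCount n a w (σ.vars .st) (σ.vars .vtx) j) ?_ ?_ ?_
  · exact ⟨(((AgreeOff.refl _ σ).set _ _).set _ _).set _ _, by simp [unseenCount],
      by simp [goneCount]⟩
  · rintro j hj σ' - hnbr ⟨hag, hu, hg⟩
    simp only [Expr.eval_const] at hj
    rw [h0] at hj
    have hr' := hag.ready hr
    have hst := hag.eq .st
    have hvtx := hag.eq .vtx
    have hvtx' : σ'.vars .vtx < n := hvtx ▸ hv
    have hnbr' : σ'.vars .nbr < n := hnbr ▸ hj
    have eadj := hr'.eval_adj hvtx' hnbr'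
    have ewt := hr'.eval_wt hnbr'
    have edig := hr'.eval_dig hnbr'
    rw [hvtx, hnbr] at eadj
    rw [hnbr] at ewt
    rw [hnbr, hst] at edig
    have hu' := unseenCount_le n a w (σ.vars .st) (σ.vars .vtx) j
    have hg' := goneCount_le n a w (σ.vars .st) (σ.vars .vtx) j
    have hd2 := digit_le_two w (σ.vars .st) j
    have hag' := hag.set .nbr (j + 1)
    refine wp_ite (hr'.fits_adj hvtx' hnbr') (fun h1 => ?_) (fun h1 => ?_) <;> rw [eadj] at h1
    · refine wp_ite (hr'.fits_wt hnbr') (fun h2 => ?_) (fun h2 => ?_) <;> rw [ewt] at h2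
      · refine wp_ite (hr'.fits_dig hnbr') (fun h3 => ?_) (fun h3 => ?_) <;> rw [edig] at h3
        -- For a nonzero digit, the difference with `1` is nonzero exactly for the digit `2`.
        · refine wp_ite ?_ (fun h4 => ?_) (fun h4 => ?_)
          · simp only [Expr.fits_sub, Expr.fits_const, hr'.fits_dig hnbr', true_and]; omega
          · simp only [Expr.eval_sub, Expr.eval_const, edig] at h4
            refine wp_incr (by omega) ⟨by simpa using hnbr, (hag.set _ _).set _ _, ?_, ?_⟩
            · simp [unseenCount_succ, hu, h3]
            · simp [goneCount_succ, hg, h1, (by omega : digit w (σ.vars .st) j = 2)]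
          · simp only [Expr.eval_sub, Expr.eval_const, edig] at h4
            refine wp_skip ⟨hnbr, hag', ?_, ?_⟩
            · simp [unseenCount_succ, hu, h3]
            · simp [goneCount_succ, hg, (by omega : digit w (σ.vars .st) j = 1)]
        · refine wp_incr (by omega) ⟨by simpa using hnbr, (hag.set _ _).set _ _, ?_, ?_⟩
          · simp [unseenCount_succ, hu, h1, h2, h3]
          · simp [goneCount_succ, hg, h3]
      · refine wp_skip ⟨hnbr, hag', ?_, ?_⟩
        · simp [unseenCount_succ, hu, h2]
        · simp [goneCount_succ, hg, digit_of_wt_eq_zero h2]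
    · refine wp_skip ⟨hnbr, hag', ?_, ?_⟩
      · simp [unseenCount_succ, hu, h1]
      · simp [goneCount_succ, hg, h1]
  · intro σ' hm h
    simp only [Expr.eval_const] at h
    rw [h0] at h
    exact hQ σ' h.1 h.2.1 h.2.2

end Stmt

end RAM

namespace RAM

/-! ### The cost of a state -/

/-- The contribution of the vertex `v` to the cost of the state `s`. -/
def vertexCost (n : ℕ) (a w : ℕ → ℕ) (s v : ℕ) : ℕ :=
  if w v ≠ 0 then
    if digit w s v = 0 then 0
    else if digit w s v = 1 then 1
    else if unseenCount n a w s v n ≠ 0 then n else 0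
  else if unseenCount n a w s v n ≠ 0 ∧ goneCount n a w s v n ≠ 0 then 1 else 0

/-- The contribution of the vertices below `j` to the cost of the state `s`. -/
def stateCost (n : ℕ) (a w : ℕ → ℕ) (s j : ℕ) : ℕ :=
  ∑ v ∈ Finset.range j, vertexCost n a w s v

theorem stateCost_succ (n : ℕ) (a w : ℕ → ℕ) (s j : ℕ) :
    stateCost n a w s (j + 1) = stateCost n a w s j + vertexCost n a w s j :=
  Finset.sum_range_succ _ _

/-- This keeps the sum below `n * n`, so that it fits into the value bound. -/
theorem stateCost_le {n : ℕ} (hn : 1 ≤ n) (a w : ℕ → ℕ) (s j : ℕ) :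
    stateCost n a w s j ≤ j * n :=
  (Finset.sum_le_card_nsmul _ _ n fun v _ => by
    simp only [vertexCost]; split_ifs <;> omega).trans (by simp)

namespace Stmt

/-- Compute the cost of the current state. -/
def computeCost : Stmt :=
  .seq (.assign .cost (.const 0)) <| .forN .vtx <| .seq scan <|
    .ite (.wt .vtx)
      (.ite (.dig .vtx)
        (.ite (.dig .vtx - .const 1)
          (.ite (.var .unseen) (.assign .cost (.var .cost + .size)) .skip)
          (incr .cost))
        .skip)
      (.ite (.var .unseen) (.ite (.var .gone) (incr .cost) .skip) .skip)

theorem wp_computeCost {B n : ℕ} {a w b : ℕ → ℕ} {σ : Store} {Q : Store → Prop}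
    (hr : Ready B n a w b σ)
    (hQ : ∀ σ', AgreeOff [.vtx, .nbr, .unseen, .gone, .cost] σ σ' →
      σ'.vars .cost = stateCost n a w (σ.vars .st) n → Q σ') :
    computeCost.WP B Q σ := by
  have hsz := hr.size_le
  have h3 := hr.three_le
  refine wp_seq (wp_assign (Nat.zero_le B) ?_)
  have h0 : (σ.set .cost 0).mem 0 = n := by simp [hr.mem]
  refine wp_forN (fun j σ' => AgreeOff [.vtx, .nbr, .unseen, .gone, .cost] σ σ' ∧
    σ'.vars .cost = stateCost n a w (σ.vars .st) j) ?_ ?_ ?_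
  · exact ⟨((AgreeOff.refl _ σ).set _ _).set _ _, by simp [stateCost]⟩
  · rintro j hj σ' - hvtx ⟨hag, hc⟩
    simp only [Expr.eval_const] at hj
    rw [h0] at hj
    have hr' := hag.ready hr
    have hst := hag.eq .st
    refine wp_seq (wp_scan hr' (hvtx ▸ hj) fun σ₁ hag₁ hu hg => ?_)
    have hag' : AgreeOff [.vtx, .nbr, .unseen, .gone, .cost] σ σ₁ := hag.trans hag₁
    have hr₁ := hag'.ready hr
    have hvtx₁ : σ₁.vars .vtx = j := (hag₁.eq .vtx).trans hvtx
    have hvtx' : σ₁.vars .vtx < n := hvtx₁ ▸ hj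
    have hst₁ := hag'.eq .st
    have hcost₁ : σ₁.vars .cost = stateCost n a w (σ.vars .st) j := (hag₁.eq .cost).trans hc
    have ewt := hr₁.eval_wt hvtx'
    have edig := hr₁.eval_dig hvtx'
    rw [hvtx₁] at ewt
    rw [hvtx₁, hst₁] at edig
    rw [hvtx, hst] at hu hg
    have hcle := stateCost_le (by omega : 1 ≤ n) a w (σ.vars .st) j
    have hcle' : j * n + n ≤ n * n := by
      rw [← Nat.succ_mul]; exact Nat.mul_le_mul_right n hj
    have hd2 := digit_le_two w (σ.vars .st) j
    have hag₂ := hag'.set .vtx (j + 1)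
    refine wp_ite (hr₁.fits_wt hvtx') (fun h1 => ?_) (fun h1 => ?_) <;> rw [ewt] at h1
    · refine wp_ite (hr₁.fits_dig hvtx') (fun h2 => ?_) (fun h2 => ?_) <;> rw [edig] at h2
      · refine wp_ite ?_ (fun h4 => ?_) (fun h4 => ?_)
        · simp only [Expr.fits_sub, Expr.fits_const, hr₁.fits_dig hvtx', true_and]; omega
        · simp only [Expr.eval_sub, Expr.eval_const, edig] at h4
          have h5 : digit w (σ.vars .st) j = 2 := by omega
          refine wp_ite (Expr.fits_var _) (fun h6 => ?_) (fun h6 => ?_) <;>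
            rw [Expr.eval_var, hu] at h6
          · refine wp_assign ?_ ⟨by simpa using hvtx₁, (hag'.set _ _).set _ _, ?_⟩
            · simp only [Expr.fits_add, Expr.fits_var, Ready.fits_size, Expr.eval_var,
                hr₁.eval_size, true_and]
              omega
            · simp [stateCost_succ, vertexCost, hcost₁, hr₁.eval_size, h1, h5, h6]
          · refine wp_skip ⟨hvtx₁, hag₂, ?_⟩
            simp [stateCost_succ, vertexCost, hcost₁, h1, h5, h6]
        · simp only [Expr.eval_sub, Expr.eval_const, edig] at h4
          have h5 : digit w (σ.vars .st) j = 1 := by omega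
          refine wp_incr (by omega) ⟨by simpa using hvtx₁, (hag'.set _ _).set _ _, ?_⟩
          simp [stateCost_succ, vertexCost, hcost₁, h1, h5]
      · refine wp_skip ⟨hvtx₁, hag₂, ?_⟩
        simp [stateCost_succ, vertexCost, hcost₁, h1, h2]
    · refine wp_ite (Expr.fits_var _) (fun h6 => ?_) (fun h6 => ?_) <;>
        rw [Expr.eval_var, hu] at h6
      · refine wp_ite (Expr.fits_var _) (fun h7 => ?_) (fun h7 => ?_) <;>
          rw [Expr.eval_var, hg] at h7
        · refine wp_incr (by omega) ⟨by simpa using hvtx₁, (hag'.set _ _).set _ _, ?_⟩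
          simp [stateCost_succ, vertexCost, hcost₁, h1, h6, h7]
        · refine wp_skip ⟨hvtx₁, hag₂, ?_⟩
          simp [stateCost_succ, vertexCost, hcost₁, h1, h7]
      · refine wp_skip ⟨hvtx₁, hag₂, ?_⟩
        simp [stateCost_succ, vertexCost, hcost₁, h1, h6]
  · intro σ' hm h
    simp only [Expr.eval_const] at h
    rw [h0] at h
    exact hQ σ' h.1 h.2

end Stmt

/-! ### The best predecessor of a state -/

/-- No vertex outside the cover, all of whose neighbours have been introduced, is adjacent to `x`
and has `y` as its only forgotten neighbour. -/
def NoCommon (n : ℕ) (a w : ℕ → ℕ) (s x y j : ℕ) : Prop :=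
  ∀ v < j, a (n * v + x) ≠ 0 → a (n * v + y) ≠ 0 → w v = 0 → unseenCount n a w s v n = 0 →
    2 ≤ goneCount n a w s v n

/-- The state `s` arises by introducing `x` and forgetting `y` at once, and the table entry for
its predecessor is at most `W`. -/
def PairStep (n : ℕ) (a w b : ℕ → ℕ) (s W x y : ℕ) : Prop :=
  digit w s y = 2 ∧ (digit w s x = 1 ∨ x = y) ∧ NoCommon n a w s x y n ∧ b (s - w x - w y) ≤ W

/-- The state `s` arises by introducing or forgetting `x`, or by introducing `x` and forgetting
some `y < j` at once, and the table entry for its predecessor is at most `W`. -/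
def Step (n : ℕ) (a w b : ℕ → ℕ) (s W x j : ℕ) : Prop :=
  1 ≤ digit w s x ∧ (b (s - w x) ≤ W ∨ ∃ y < j, PairStep n a w b s W x y)

/-- The table entry `b s` is correct, given the previous entries. -/
def CorrectEntry (n : ℕ) (a w b : ℕ → ℕ) (s : ℕ) : Prop :=
  ∀ W < n, b s ≤ W ↔ stateCost n a w s n ≤ W ∧ (s = 0 ∨ ∃ x < n, Step n a w b s W x n)

namespace Stmt

/-- Decide whether the vertices `new` and `old` have a common neighbour that rules out a
simultaneous step. -/
def checkCommon : Stmt :=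
  .seq (.assign .bad (.const 0)) <| .forN .vtx <|
    .ite (.adj .vtx .new)
      (.ite (.adj .vtx .old)
        (.ite (.wt .vtx) .skip
          (.seq scan (.ite (.var .unseen) .skip
            (.ite (.var .gone - .const 1) .skip (.assign .bad (.const 1))))))
        .skip)
      .skip

theorem wp_checkCommon {B n : ℕ} {a w b : ℕ → ℕ} {σ : Store} {Q : Store → Prop}
    (hr : Ready B n a w b σ) (hx : σ.vars .new < n) (hy : σ.vars .old < n)
    (hQ : ∀ σ', AgreeOff [.vtx, .nbr, .unseen, .gone, .bad] σ σ' →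
      (σ'.vars .bad = 0 ↔ NoCommon n a w (σ.vars .st) (σ.vars .new) (σ.vars .old) n) → Q σ') :
    checkCommon.WP B Q σ := by
  have h3 := hr.three_le
  refine wp_seq (wp_assign (Nat.zero_le B) ?_)
  have h0 : (σ.set .bad 0).mem 0 = n := by simp [hr.mem]
  refine wp_forN (fun j σ' => AgreeOff [.vtx, .nbr, .unseen, .gone, .bad] σ σ' ∧
    (σ'.vars .bad = 0 ↔ NoCommon n a w (σ.vars .st) (σ.vars .new) (σ.vars .old) j)) ?_ ?_ ?_
  · exact ⟨((AgreeOff.refl _ σ).set _ _).set _ _, by simp [NoCommon]⟩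
  · rintro j hj σ' - hvtx ⟨hag, hc⟩
    simp only [Expr.eval_const] at hj
    rw [h0] at hj
    have hr' := hag.ready hr
    have hst := hag.eq .st
    have hnew := hag.eq .new
    have hold := hag.eq .old
    have hvtx' : σ'.vars .vtx < n := hvtx ▸ hj
    have hnew' : σ'.vars .new < n := hnew ▸ hx
    have hold' : σ'.vars .old < n := hold ▸ hy
    have eadj := hr'.eval_adj hvtx' hnew'
    have eadj' := hr'.eval_adj hvtx' hold'
    have ewt := hr'.eval_wt hvtx'
    rw [hvtx, hnew] at eadj
    rw [hvtx, hold] at eadj'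
    rw [hvtx] at ewt
    have hsucc : NoCommon n a w (σ.vars .st) (σ.vars .new) (σ.vars .old) (j + 1) ↔
        NoCommon n a w (σ.vars .st) (σ.vars .new) (σ.vars .old) j ∧
        (a (n * j + σ.vars .new) ≠ 0 → a (n * j + σ.vars .old) ≠ 0 → w j = 0 →
          unseenCount n a w (σ.vars .st) j n = 0 → 2 ≤ goneCount n a w (σ.vars .st) j n) := by
      simp only [NoCommon, Nat.forall_lt_succ_right]
    have hkeep : ∀ σ₁, AgreeOff [.vtx, .nbr, .unseen, .gone, .bad] σ σ₁ → σ₁.vars .vtx = j →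
        σ₁.vars .bad = σ'.vars .bad →
        (a (n * j + σ.vars .new) ≠ 0 → a (n * j + σ.vars .old) ≠ 0 → w j = 0 →
          unseenCount n a w (σ.vars .st) j n = 0 → 2 ≤ goneCount n a w (σ.vars .st) j n) →
        skip.WP B (fun σ'' => σ''.vars .vtx = j ∧
          (AgreeOff [.vtx, .nbr, .unseen, .gone, .bad] σ (σ''.set .vtx (j + 1)) ∧
          ((σ''.set .vtx (j + 1)).vars .bad = 0 ↔
            NoCommon n a w (σ.vars .st) (σ.vars .new) (σ.vars .old) (j + 1)))) σ₁ := by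
      intro σ₁ h1 h2 h3 h4
      refine wp_skip ⟨h2, h1.set _ _, ?_⟩
      rw [hsucc, ← hc, and_iff_left h4, ← h3]
      simp
    refine wp_ite (hr'.fits_adj hvtx' hnew') (fun h1 => ?_) (fun h1 => ?_) <;> rw [eadj] at h1
    · refine wp_ite (hr'.fits_adj hvtx' hold') (fun h2 => ?_) (fun h2 => ?_) <;> rw [eadj'] at h2
      · refine wp_ite (hr'.fits_wt hvtx') (fun h3 => ?_) (fun h3 => ?_) <;> rw [ewt] at h3
        · exact hkeep _ hag hvtx rfl fun _ _ h => absurd h h3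
        · refine wp_seq (wp_scan hr' hvtx' fun σ₁ hag₁ hu hg => ?_)
          have hag' : AgreeOff [.vtx, .nbr, .unseen, .gone, .bad] σ σ₁ := hag.trans hag₁
          have hvtx₁ : σ₁.vars .vtx = j := (hag₁.eq .vtx).trans hvtx
          have hbad₁ := hag₁.eq .bad
          rw [hvtx, hst] at hu hg
          refine wp_ite (Expr.fits_var _) (fun h4 => ?_) (fun h4 => ?_) <;>
            rw [Expr.eval_var, hu] at h4
          · exact hkeep _ hag' hvtx₁ hbad₁ fun _ _ _ h => absurd h h4
          · refine wp_ite (by simp; omega) (fun h5 => ?_) (fun h5 => ?_) <;>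
              simp only [Expr.eval_sub, Expr.eval_var, Expr.eval_const, hg] at h5
            · exact hkeep _ hag' hvtx₁ hbad₁ fun _ _ _ _ => by omega
            · refine wp_assign (by simp; omega) ⟨by simpa using hvtx₁,
                (hag'.set _ _).set _ _, ?_⟩
              rw [hsucc]
              simp [h1, h2, h3, h4]
              omega
      · exact hkeep _ hag hvtx rfl fun _ h => absurd h2 h
    · exact hkeep _ hag hvtx rfl fun h => absurd h1 h
  · intro σ' hm h
    simp only [Expr.eval_const] at h
    rw [h0] at h
    exact hQ σ' h.1 h.2

/-- Lower the variable `opt` to the value of `e`, if this is smaller. -/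
def relax (e : Expr) : Stmt := .ite (.var .opt - e) (.assign .opt e) .skip

theorem wp_relax {B : ℕ} {e : Expr} {σ : Store} {Q : Store → Prop} (hf : e.Fits B σ)
    (hQ : ∀ σ', AgreeOff [.opt] σ σ' →
      (∀ W, σ'.vars .opt ≤ W ↔ σ.vars .opt ≤ W ∨ e.eval σ ≤ W) → Q σ') :
    (relax e).WP B Q σ := by
  refine wp_ite (by simp [hf]) (fun h => ?_) (fun h => ?_) <;>
    simp only [Expr.eval_sub, Expr.eval_var] at h
  · refine wp_assign hf (hQ _ ((AgreeOff.refl _ _).set _ _) fun W => ?_)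
    simp only [Store.set_vars_self]
    omega
  · exact wp_skip (hQ _ (AgreeOff.refl _ _) fun W => by omega)

/-- Take the predecessor of a simultaneous step for `new` and `old` into account. -/
def relaxPair : Stmt :=
  .seq checkCommon (.ite (.var .bad) .skip (relax (.best (.var .st - .wt .new - .wt .old))))

theorem wp_relaxPair {B n : ℕ} {a w b : ℕ → ℕ} {σ : Store} {Q : Store → Prop}
    (hr : Ready B n a w b σ) (hx : σ.vars .new < n) (hy : σ.vars .old < n)
    (hQ : ∀ σ', AgreeOff [.vtx, .nbr, .unseen, .gone, .bad, .opt] σ σ' →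
      (∀ W, σ'.vars .opt ≤ W ↔ σ.vars .opt ≤ W ∨
        (NoCommon n a w (σ.vars .st) (σ.vars .new) (σ.vars .old) n ∧
          b (σ.vars .st - w (σ.vars .new) - w (σ.vars .old)) ≤ W)) → Q σ') :
    relaxPair.WP B Q σ := by
  refine wp_seq (wp_checkCommon hr hx hy fun σ₁ hag hbad => ?_)
  have hag' : AgreeOff [.vtx, .nbr, .unseen, .gone, .bad, .opt] σ σ₁ :=
    (AgreeOff.refl _ _).trans hag
  have hr₁ := hag.ready hr
  have hopt := hag.eq .opt
  have hst := hag.eq .st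
  have hnew := hag.eq .new
  have hold := hag.eq .old
  refine wp_ite (Expr.fits_var _) (fun h => ?_) (fun h => ?_) <;> rw [Expr.eval_var] at h
  · refine wp_skip (hQ _ hag' fun W => ?_)
    rw [hopt]
    exact ⟨.inl, fun h' => h'.resolve_right fun h'' => h (hbad.2 h''.1)⟩
  · have hnew' : σ₁.vars .new < n := hnew ▸ hx
    have hold' : σ₁.vars .old < n := hold ▸ hy
    have heval : (Expr.var .st - Expr.wt .new - Expr.wt .old).eval σ₁ =
        σ.vars .st - w (σ.vars .new) - w (σ.vars .old) := by
      simp only [Expr.eval_sub, Expr.eval_var, hr₁.eval_wt hnew', hr₁.eval_wt hold', hst, hnew,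
        hold]
    refine wp_relax (hr₁.fits_best ?_ ?_) fun σ₂ hag₂ hopt₂ => hQ _ (hag'.trans hag₂) fun W => ?_
    · simp [hr₁.fits_wt hnew', hr₁.fits_wt hold']
    · rw [heval, hst]; omega
    · rw [hopt₂, hopt, hr₁.eval_best, heval, ← hbad, and_iff_right h]

/-- Take all steps that introduce or forget `new` into account. -/
def relaxVertex : Stmt :=
  .ite (.dig .new)
    (.seq (relax (.best (.var .st - .wt .new))) <| .forN .old <|
      .ite (.dig .old - .const 1)
        (.ite (.dig .new - .const 1)
          (.ite (.var .new - .var .old) .skip (.ite (.var .old - .var .new) .skip relaxPair))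
          relaxPair)
        .skip)
    .skip

theorem wp_relaxVertex {B n : ℕ} {a w b : ℕ → ℕ} {σ : Store} {Q : Store → Prop}
    (hr : Ready B n a w b σ) (hx : σ.vars .new < n)
    (hQ : ∀ σ', AgreeOff [.old, .vtx, .nbr, .unseen, .gone, .bad, .opt] σ σ' →
      (∀ W, σ'.vars .opt ≤ W ↔ σ.vars .opt ≤ W ∨
        Step n a w b (σ.vars .st) W (σ.vars .new) n) → Q σ') :
    relaxVertex.WP B Q σ := by
  have h3 := hr.three_le
  have edig := hr.eval_dig hx
  have hd2 := digit_le_two w (σ.vars .st) (σ.vars .new)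
  refine wp_ite (hr.fits_dig hx) (fun h => ?_) (fun h => ?_) <;> rw [edig] at h
  swap
  · refine wp_skip (hQ _ (AgreeOff.refl _ _) fun W => ⟨.inl, fun h' => ?_⟩)
    exact h'.resolve_right fun h'' => by have := h''.1; omega
  have heval : (Expr.var .st - Expr.wt .new).eval σ = σ.vars .st - w (σ.vars .new) := by
    simp only [Expr.eval_sub, Expr.eval_var, hr.eval_wt hx]
  refine wp_seq (wp_relax (hr.fits_best (by simp [hr.fits_wt hx]) (by rw [heval]; omega))
    fun σ₀ hag₀ hopt₀ => ?_)
  rw [hr.eval_best, heval] at hopt₀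
  have h0 : σ₀.mem 0 = n := by simp [hag₀.1, hr.mem]
  refine wp_forN (fun j σ' => AgreeOff [.old, .vtx, .nbr, .unseen, .gone, .bad, .opt] σ σ' ∧
    ∀ W, σ'.vars .opt ≤ W ↔ σ.vars .opt ≤ W ∨
      Step n a w b (σ.vars .st) W (σ.vars .new) j) ?_ ?_ ?_
  · refine ⟨((AgreeOff.refl _ σ).trans hag₀).set _ _, fun W => ?_⟩
    rw [Store.set_vars_of_ne _ _ (by decide), hopt₀]
    simp [Step, Nat.one_le_iff_ne_zero, h]
  · rintro j hj σ' - hold ⟨hag, hopt⟩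
    rw [h0] at hj
    have hr' := hag.ready hr
    have hst := hag.eq .st
    have hnew := hag.eq .new
    have hnew' : σ'.vars .new < n := hnew ▸ hx
    have hold' : σ'.vars .old < n := hold ▸ hj
    have edig₁ := hr'.eval_dig hnew'
    have edig₂ := hr'.eval_dig hold'
    rw [hst, hnew] at edig₁
    rw [hst, hold] at edig₂
    have hd2' := digit_le_two w (σ.vars .st) j
    have hsucc : ∀ W, Step n a w b (σ.vars .st) W (σ.vars .new) (j + 1) ↔
        Step n a w b (σ.vars .st) W (σ.vars .new) j ∨
          PairStep n a w b (σ.vars .st) W (σ.vars .new) j := by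
      intro W
      simp only [Step, Nat.exists_lt_succ_right]
      have : 1 ≤ digit w (σ.vars .st) (σ.vars .new) := by omega
      rw [and_iff_right this, and_iff_right this, or_assoc]
    have hkeep : (¬ (digit w (σ.vars .st) j = 2 ∧
          (digit w (σ.vars .st) (σ.vars .new) = 1 ∨ σ.vars .new = j))) →
        skip.WP B (fun σ'' => σ''.vars .old = j ∧
          AgreeOff [.old, .vtx, .nbr, .unseen, .gone, .bad, .opt] σ (σ''.set .old (j + 1)) ∧
          ∀ W, (σ''.set .old (j + 1)).vars .opt ≤ W ↔ σ.vars .opt ≤ W ∨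
            Step n a w b (σ.vars .st) W (σ.vars .new) (j + 1)) σ' := by
      intro hno
      refine wp_skip ⟨hold, hag.set _ _, fun W => ?_⟩
      rw [Store.set_vars_of_ne _ _ (by decide), hopt, hsucc,
        or_iff_left (fun h : PairStep n a w b _ W _ j => hno ⟨h.1, h.2.1⟩)]
    have hpair : digit w (σ.vars .st) j = 2 →
        (digit w (σ.vars .st) (σ.vars .new) = 1 ∨ σ.vars .new = j) →
        relaxPair.WP B (fun σ'' => σ''.vars .old = j ∧
          AgreeOff [.old, .vtx, .nbr, .unseen, .gone, .bad, .opt] σ (σ''.set .old (j + 1)) ∧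
          ∀ W, (σ''.set .old (j + 1)).vars .opt ≤ W ↔ σ.vars .opt ≤ W ∨
            Step n a w b (σ.vars .st) W (σ.vars .new) (j + 1)) σ' := by
      intro h1 h2
      refine wp_relaxPair hr' hnew' hold' fun σ₁ hag₁ hopt₁ => ?_
      refine ⟨(hag₁.eq .old).trans hold, (hag.trans hag₁).set _ _, fun W => ?_⟩
      rw [Store.set_vars_of_ne _ _ (by decide), hopt₁, hopt, hsucc, hst, hnew, hold, or_assoc,
        PairStep, and_iff_right h1, and_iff_right h2]
    refine wp_ite ?_ (fun h4 => ?_) (fun h4 => ?_)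
    · simp only [Expr.fits_sub, Expr.fits_const, hr'.fits_dig hold', true_and]; omega
    · simp only [Expr.eval_sub, Expr.eval_const, edig₂] at h4
      have h4' : digit w (σ.vars .st) j = 2 := by omega
      refine wp_ite ?_ (fun h5 => ?_) (fun h5 => ?_)
      · simp only [Expr.fits_sub, Expr.fits_const, hr'.fits_dig hnew', true_and]; omega
      · simp only [Expr.eval_sub, Expr.eval_const, edig₁] at h5
        -- Equality of `new` and `old` is tested by two truncated differences, both of which have to
        -- vanish.
        refine wp_ite (by simp) (fun h6 => ?_) (fun h6 => ?_) <;>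
          simp only [Expr.eval_sub, Expr.eval_var, hnew, hold] at h6
        · exact hkeep fun h => by omega
        · refine wp_ite (by simp) (fun h7 => ?_) (fun h7 => ?_) <;>
            simp only [Expr.eval_sub, Expr.eval_var, hnew, hold] at h7
          · exact hkeep fun h => by omega
          · exact hpair h4' (by omega)
      · simp only [Expr.eval_sub, Expr.eval_const, edig₁] at h5
        exact hpair h4' (by omega)
    · simp only [Expr.eval_sub, Expr.eval_const, edig₂] at h4
      exact hkeep fun h => by omega
  · intro σ' hm h
    rw [h0] at h
    exact hQ σ' h.1 h.2

/-- Compute the best table entry of a predecessor of the current state. -/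
def computeOpt : Stmt :=
  .seq (.ite (.var .st) (.assign .opt .size) (.assign .opt (.const 0))) (.forN .new relaxVertex)

theorem wp_computeOpt {B n : ℕ} {a w b : ℕ → ℕ} {σ : Store} {Q : Store → Prop}
    (hr : Ready B n a w b σ)
    (hQ : ∀ σ', AgreeOff [.new, .old, .vtx, .nbr, .unseen, .gone, .bad, .opt] σ σ' →
      (∀ W < n, σ'.vars .opt ≤ W ↔ σ.vars .st = 0 ∨
        ∃ x < n, Step n a w b (σ.vars .st) W x n) → Q σ') :
    computeOpt.WP B Q σ := by
  refine wp_seq ?_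
  -- The variable `opt` starts at `0` in the empty state and at `n` otherwise; `n` acts as infinity,
  -- because only bounds below `n` matter.
  suffices hmain : ∀ σ₀, AgreeOff [.opt] σ σ₀ →
      (∀ W < n, σ₀.vars .opt ≤ W ↔ σ.vars .st = 0) →
      (forN .new relaxVertex).WP B Q σ₀ by
    refine wp_ite (Expr.fits_var _) (fun h => ?_) (fun h => ?_) <;> rw [Expr.eval_var] at h
    · refine wp_assign Ready.fits_size (hmain _ ((AgreeOff.refl _ _).set _ _) fun W hW => ?_)
      simp only [Store.set_vars_self, hr.eval_size]
      omega
    · refine wp_assign (Nat.zero_le B) (hmain _ ((AgreeOff.refl _ _).set _ _) fun W hW => ?_)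
      simp [h]
  intro σ₀ hag₀ hopt₀
  have h0 : σ₀.mem 0 = n := by simp [hag₀.1, hr.mem]
  refine wp_forN (fun j σ' => AgreeOff [.new, .old, .vtx, .nbr, .unseen, .gone, .bad, .opt] σ σ' ∧
    ∀ W < n, σ'.vars .opt ≤ W ↔ σ.vars .st = 0 ∨
      ∃ x < j, Step n a w b (σ.vars .st) W x n) ?_ ?_ ?_
  · refine ⟨((AgreeOff.refl _ σ).trans hag₀).set _ _, fun W hW => ?_⟩
    rw [Store.set_vars_of_ne _ _ (by decide), hopt₀ W hW]
    simp
  · rintro j hj σ' - hnew ⟨hag, hopt⟩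
    rw [h0] at hj
    refine wp_relaxVertex (hag.ready hr) (hnew ▸ hj) fun σ₁ hag₁ hopt₁ => ?_
    refine ⟨(hag₁.eq .new).trans hnew, (hag.trans hag₁).set _ _, fun W hW => ?_⟩
    rw [Store.set_vars_of_ne _ _ (by decide), hopt₁, hopt W hW, hnew, hag.eq .st,
      Nat.exists_lt_succ_right, or_assoc]
  · intro σ' hm h
    rw [h0] at h
    exact hQ σ' h.1 h.2

/-- Compute the table entry of the current state and move on to the next state. -/
def fillEntry : Stmt :=
  .seq computeCost <| .seq computeOpt <|
    .seq (.ite (.var .cost - .var .opt) (.store (.bestAddr (.var .st)) (.var .cost))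
      (.store (.bestAddr (.var .st)) (.var .opt))) <|
    .seq (incr .st) (.assign .left (.var .left - .const 1))

/-- The value written is the maximum of the cost and the best predecessor, so it is at most `W` iff
both are. -/
theorem wp_fillEntry {B n : ℕ} {a w b : ℕ → ℕ} {σ : Store} {Q : Store → Prop}
    (hr : Ready B n a w b σ)
    (hQ : ∀ σ' c, σ'.mem = layout n a w (Function.update b (σ.vars .st) c) →
      σ'.vars .st = σ.vars .st + 1 → σ'.vars .left = σ.vars .left - 1 →
      σ'.vars .pow = σ.vars .pow →
      (∀ W < n, c ≤ W ↔ stateCost n a w (σ.vars .st) n ≤ W ∧ (σ.vars .st = 0 ∨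
        ∃ x < n, Step n a w b (σ.vars .st) W x n)) → Q σ') :
    fillEntry.WP B Q σ := by
  have h3 := hr.three_le
  have hle := hr.st_le
  refine wp_seq (wp_computeCost hr fun σ₁ hag₁ hcost => ?_)
  refine wp_seq (wp_computeOpt (hag₁.ready hr) fun σ₂ hag₂ hopt => ?_)
  have hst : σ₂.vars .st = σ.vars .st := (hag₂.eq .st).trans (hag₁.eq .st)
  have hr₂ := hag₂.ready (hag₁.ready hr)
  have hcost₂ : σ₂.vars .cost = _ := (hag₂.eq .cost).trans hcost
  rw [hag₁.eq .st] at hopt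
  have hwrite : ∀ c, (∀ W < n, c ≤ W ↔ stateCost n a w (σ.vars .st) n ≤ W ∧
      (σ.vars .st = 0 ∨ ∃ x < n, Step n a w b (σ.vars .st) W x n)) →
      ((incr .st).seq (.assign .left (.var .left - .const 1))).WP B Q
        (σ₂.write ((Expr.bestAddr (.var .st)).eval σ₂) c) := by
    intro c hc
    refine wp_seq (wp_incr (by simp only [Store.write_vars]; omega) ?_)
    refine wp_assign (by simp; omega) ?_
    refine hQ _ c ?_ (by simp [hst]) ?_ ?_ hc
    · simp only [Store.set_mem, Store.write_mem, hr₂.eval_bestAddr, Expr.eval_var, hr₂.mem, hst,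
        update_layout_best]
    · simp [hag₂.eq .left, hag₁.eq .left]
    · simp [hag₂.eq .pow, hag₁.eq .pow]
  have hfa : (Expr.bestAddr (.var .st)).Fits B σ₂ := hr₂.fits_bestAddr (Expr.fits_var _) le_rfl
  have hne : (Expr.bestAddr (.var .st)).eval σ₂ ≠ 0 := by rw [hr₂.eval_bestAddr]; omega
  refine wp_seq (wp_ite (by simp) (fun h => ?_) (fun h => ?_)) <;>
    simp only [Expr.eval_sub, Expr.eval_var] at h
  · refine wp_store hfa (Expr.fits_var _) hne (hwrite _ fun W hW => ?_)
    rw [← hopt W hW, Expr.eval_var, ← hcost₂]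
    omega
  · refine wp_store hfa (Expr.fits_var _) hne (hwrite _ fun W hW => ?_)
    rw [← hopt W hW, Expr.eval_var, ← hcost₂]
    omega

end Stmt

end RAM

namespace RAM

/-! ### The search for a vertex cover -/

/-- The state of the search for a vertex cover: the weights of the vertices that have been
chosen, the remaining ternary digits of the guess, the next weight, and whether the guess has
failed. -/
structure Search where
  wt : ℕ → ℕ
  rest : ℕ
  pow : ℕ
  fail : ℕ

/-- Treat the pair `(v, u)`: if it is an uncovered edge, then the next digit tells which end is
chosen. -/
def Search.step (n : ℕ) (a : ℕ → ℕ) (c : Search) (e : ℕ × ℕ) : Search :=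
  if a (n * e.1 + e.2) ≠ 0 ∧ c.wt e.1 = 0 ∧ c.wt e.2 = 0 then
    if c.rest % 3 = 0 then { c with fail := 1 }
    else ⟨Function.update c.wt (if c.rest % 3 = 1 then e.1 else e.2) c.pow, c.rest / 3, c.pow * 3,
      c.fail⟩
  else c

/-- The search, on a list of pairs of vertices. -/
def Search.run (n : ℕ) (a : ℕ → ℕ) (c : Search) (l : List (ℕ × ℕ)) : Search :=
  l.foldl (Search.step n a) c

/-- The pairs with first entry `v` and second entry below `j`. -/
def rowPairs (v j : ℕ) : List (ℕ × ℕ) := (List.range j).map fun u => (v, u)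

/-- The pairs with first entry below `j` and second entry below `n`. -/
def allPairs (n j : ℕ) : List (ℕ × ℕ) := (List.range j).flatMap fun v => rowPairs v n

theorem rowPairs_succ (v j : ℕ) : rowPairs v (j + 1) = rowPairs v j ++ [(v, j)] := by
  simp [rowPairs, List.range_succ]

theorem allPairs_succ (n j : ℕ) : allPairs n (j + 1) = allPairs n j ++ rowPairs j n := by
  simp [allPairs, List.range_succ]

theorem mem_allPairs {n : ℕ} {e : ℕ × ℕ} : e ∈ allPairs n n ↔ e.1 < n ∧ e.2 < n := by
  obtain ⟨v, u⟩ := e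
  simp [allPairs, rowPairs]

namespace Search

variable {n : ℕ} {a : ℕ → ℕ}

theorem run_append (c : Search) (l l' : List (ℕ × ℕ)) :
    c.run n a (l ++ l') = (c.run n a l).run n a l' :=
  List.foldl_append

theorem run_cons (c : Search) (e : ℕ × ℕ) (l : List (ℕ × ℕ)) :
    c.run n a (e :: l) = (c.step n a e).run n a l := rfl

theorem step_induction {P : Search → Prop} {c : Search} {e : ℕ × ℕ} (h : P c)
    (hfail : P { c with fail := 1 })
    (hpick : ∀ x, x = e.1 ∨ x = e.2 → c.wt x = 0 → c.rest % 3 ≠ 0 →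
      P ⟨Function.update c.wt x c.pow, c.rest / 3, c.pow * 3, c.fail⟩) : P (c.step n a e) := by
  rw [Search.step]
  by_cases hu : a (n * e.1 + e.2) ≠ 0 ∧ c.wt e.1 = 0 ∧ c.wt e.2 = 0
  · rw [if_pos hu]
    by_cases hr : c.rest % 3 = 0
    · rwa [if_pos hr]
    · rw [if_neg hr]
      split_ifs
      · exact hpick _ (.inl rfl) hu.2.1 hr
      · exact hpick _ (.inr rfl) hu.2.2 hr
  · rwa [if_neg hu]

/-- The search has chosen vertices below `n`, and has given them different powers of `3`. -/
structure Valid (n y : ℕ) (c : Search) : Prop where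
  exists_pow : ∃ q, c.pow = 3 ^ q
  pow_mul_rest_le : c.pow * c.rest ≤ y
  sum_eq : 1 + 2 * ∑ v ∈ Finset.range n, c.wt v = c.pow
  wt_eq : ∀ v, c.wt v ≠ 0 → v < n ∧ c.wt v < c.pow ∧ ∃ i, c.wt v = 3 ^ i
  inj : ∀ v u, c.wt v ≠ 0 → c.wt v = c.wt u → v = u

/-- A choice uses the next power of `3` as weight and removes one digit from the guess; the sum
condition is `1 + 2 * (1 + 3 + … + 3 ^ (q - 1)) = 3 ^ q`. -/
theorem Valid.step {y : ℕ} {c : Search} (h : c.Valid n y) {e : ℕ × ℕ} (h₁ : e.1 < n)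
    (h₂ : e.2 < n) : (c.step n a e).Valid n y := by
  refine step_induction h ⟨h.1, h.2, h.3, h.4, h.5⟩ ?_
  · intro x hx hx0 hr
    have hxn : x < n := by rcases hx with rfl | rfl <;> assumption
    obtain ⟨q, hq⟩ := h.exists_pow
    have hpos : 0 < c.pow := hq ▸ pow_pos (by omega) q
    refine ⟨⟨q + 1, by simp [hq, pow_succ]⟩, ?_, ?_, ?_, ?_⟩
    · simp only
      rw [mul_assoc]
      exact (Nat.mul_le_mul_left _ (Nat.mul_div_le _ _)).trans h.pow_mul_rest_le
    · simp only
      rw [Finset.sum_update_of_mem (Finset.mem_range.2 hxn)]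
      have h1 := h.sum_eq
      rw [← Finset.add_sum_erase _ _ (Finset.mem_range.2 hxn), hx0,
        ← Finset.sdiff_singleton_eq_erase] at h1
      omega
    · intro v hv
      simp only [Function.update_apply] at hv ⊢
      split_ifs at hv ⊢ with hvx
      · exact ⟨hvx ▸ hxn, by omega, q, hq⟩
      · obtain ⟨h1, h2, h3⟩ := h.wt_eq v hv
        exact ⟨h1, by omega, h3⟩
    · intro v u hv hvu
      simp only [Function.update_apply] at hv hvu
      split_ifs at hv hvu with hvx hux hux
      · rw [hvx, hux]
      · have := h.wt_eq u (by omega)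
        omega
      · have := h.wt_eq v hv
        omega
      · exact h.inj v u hv hvu

theorem Valid.run {y : ℕ} {l : List (ℕ × ℕ)} : ∀ {c : Search}, c.Valid n y →
    (∀ e ∈ l, e.1 < n ∧ e.2 < n) → (c.run n a l).Valid n y := by
  induction l with
  | nil => intro c h _; exact h
  | cons e l ih =>
    intro c h hl
    have he := hl e (by simp)
    exact ih (h.step he.1 he.2) fun e' he' => hl e' (by simp [he'])

/-- A vertex is chosen only if the rest of the guess is nonzero. Then `pow ≤ pow * rest < 3 ^ K`, so
being a power of `3`, `pow` can still be tripled. -/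
theorem pow_le_step {K : ℕ} {c : Search} (h : ∃ q, c.pow = 3 ^ q)
    (hy : c.pow * c.rest < 3 ^ K) (hp : c.pow ≤ 3 ^ K) (e : ℕ × ℕ) :
    (c.step n a e).pow ≤ 3 ^ K := by
  refine step_induction (P := fun c => c.pow ≤ 3 ^ K) hp hp ?_
  · intro x hx hx0 hr
    obtain ⟨q, hq⟩ := h
    have h1 : c.pow * 1 ≤ c.pow * c.rest := Nat.mul_le_mul_left _ (by omega)
    have h2 : 3 ^ q < 3 ^ K := by omega
    have h3 := (Nat.pow_lt_pow_iff_right (by omega : 1 < 3)).1 h2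
    simp only
    rw [hq, ← pow_succ]
    exact Nat.pow_le_pow_right (by omega) h3

theorem Valid.pow_le_run {y K : ℕ} (hy : y < 3 ^ K) {l : List (ℕ × ℕ)} : ∀ {c : Search},
    c.Valid n y → c.pow ≤ 3 ^ K → (∀ e ∈ l, e.1 < n ∧ e.2 < n) →
    (c.run n a l).pow ≤ 3 ^ K := by
  induction l with
  | nil => intro c _ hp _; exact hp
  | cons e l ih =>
    intro c h hp hl
    have he := hl e (by simp)
    exact ih (h.step he.1 he.2)
      (pow_le_step h.exists_pow (h.pow_mul_rest_le.trans_lt hy) hp e)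
      fun e' he' => hl e' (by simp [he'])

theorem wt_step_ne_zero {c : Search} (hp : c.pow ≠ 0) {v : ℕ} (hv : c.wt v ≠ 0) (e : ℕ × ℕ) :
    (c.step n a e).wt v ≠ 0 := by
  refine step_induction (P := fun c => c.wt v ≠ 0) hv hv fun x _ _ _ => ?_
  simp only [Function.update_apply]
  split_ifs <;> assumption

theorem pow_step_ne_zero {c : Search} (hp : c.pow ≠ 0) (e : ℕ × ℕ) : (c.step n a e).pow ≠ 0 :=
  step_induction (P := fun c => c.pow ≠ 0) hp hp fun x _ _ _ => by simpa using hp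

theorem fail_step_ne_zero {c : Search} (h : c.fail ≠ 0) (e : ℕ × ℕ) :
    (c.step n a e).fail ≠ 0 :=
  step_induction (P := fun c => c.fail ≠ 0) h (by simp) fun x _ _ _ => h

theorem fail_run_ne_zero {l : List (ℕ × ℕ)} : ∀ {c : Search}, c.fail ≠ 0 →
    (c.run n a l).fail ≠ 0 := by
  induction l with
  | nil => exact fun h => h
  | cons e l ih => exact fun h => ih (fail_step_ne_zero h e)

theorem wt_run_ne_zero {l : List (ℕ × ℕ)} {v : ℕ} : ∀ {c : Search}, c.pow ≠ 0 → c.wt v ≠ 0 →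
    (c.run n a l).wt v ≠ 0 := by
  induction l with
  | nil => exact fun _ h => h
  | cons e l ih => exact fun hp h => ih (pow_step_ne_zero hp e) (wt_step_ne_zero hp h e)

/-- Failure and positive weights persist, so a pair is settled for good when it is treated. -/
theorem covered_of_fail_eq_zero {l : List (ℕ × ℕ)} : ∀ {c : Search}, c.pow ≠ 0 →
    (c.run n a l).fail = 0 → ∀ e ∈ l, a (n * e.1 + e.2) ≠ 0 →
    (c.run n a l).wt e.1 ≠ 0 ∨ (c.run n a l).wt e.2 ≠ 0 := by
  induction l with
  | nil => simp
  | cons e l ih =>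
    intro c hp hf e' he' ha
    rw [run_cons] at hf ⊢
    rcases List.mem_cons.1 he' with rfl | he'
    · have hs : (c.step n a e').wt e'.1 ≠ 0 ∨ (c.step n a e').wt e'.2 ≠ 0 := by
        by_contra hc
        push Not at hc
        have hor : ¬ (c.wt e'.1 ≠ 0) ∧ ¬ (c.wt e'.2 ≠ 0) :=
          ⟨fun h => wt_step_ne_zero hp h e' hc.1, fun h => wt_step_ne_zero hp h e' hc.2⟩
        refine absurd hf (fail_run_ne_zero ?_)
        rw [Search.step, if_pos ⟨ha, not_not.1 hor.1, not_not.1 hor.2⟩] at hc ⊢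
        split_ifs at hc ⊢ with h1 h2
        · simp
        · simp [hp] at hc
        · simp [hp] at hc
      exact hs.imp (wt_run_ne_zero (pow_step_ne_zero hp _))
        (wt_run_ne_zero (pow_step_ne_zero hp _))
    · exact ih (pow_step_ne_zero hp e) hf e' he' ha

/-- An uncovered edge has an end in `C`, still without weight. Choosing this end uses one digit and
lowers the number of unchosen vertices of `C`, so that this number bounds the length of the guess.
-/
theorem exists_guess (C : Finset ℕ) {l : List (ℕ × ℕ)} : ∀ (w : ℕ → ℕ) (p : ℕ),
    (∀ e ∈ l, a (n * e.1 + e.2) ≠ 0 → e.1 ∈ C ∨ e.2 ∈ C) → p ≠ 0 →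
    ∃ z < 3 ^ (C.filter fun v => w v = 0).card,
      (Search.run n a ⟨w, z, p, 0⟩ l).fail = 0 := by
  induction l with
  | nil => exact fun w p _ _ => ⟨0, by positivity, rfl⟩
  | cons e l ih =>
    intro w p hl hp
    have hl' : ∀ e ∈ l, a (n * e.1 + e.2) ≠ 0 → e.1 ∈ C ∨ e.2 ∈ C :=
      fun e' he' => hl e' (by simp [he'])
    by_cases hu : a (n * e.1 + e.2) ≠ 0 ∧ w e.1 = 0 ∧ w e.2 = 0
    · have key : ∀ x d, x ∈ C → w x = 0 → d < 3 → d ≠ 0 → (if d = 1 then e.1 else e.2) = x →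
          ∃ z < 3 ^ (C.filter fun v => w v = 0).card,
            (Search.run n a ⟨w, z, p, 0⟩ (e :: l)).fail = 0 := by
        intro x d hxC hx0 hd3 hd0 hdx
        obtain ⟨z, hz, hf⟩ := ih (Function.update w x p) (p * 3) hl' (by omega)
        have hcard : (C.filter fun v => Function.update w x p v = 0).card + 1 ≤
            (C.filter fun v => w v = 0).card := by
          refine Finset.card_lt_card (Finset.ssubset_iff_of_subset ?_ |>.2 ⟨x, ?_, ?_⟩)
          · intro v hv
            simp only [Finset.mem_filter, Function.update_apply] at hv ⊢
            split_ifs at hv with hvx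
            · exact absurd hv.2 hp
            · exact hv
          · simp [hxC, hx0]
          · simp [hp]
        have hpow := Nat.pow_le_pow_right (by omega : 0 < 3) hcard
        rw [pow_succ] at hpow
        -- The digit for the present edge becomes the lowest one, in front of the guess `z` for the
        -- later pairs.
        refine ⟨d + 3 * z, by omega, ?_⟩
        rw [run_cons, Search.step, if_pos hu]
        simp only
        rw [if_neg (by omega), (by omega : (d + 3 * z) % 3 = d), hdx,
          (by omega : (d + 3 * z) / 3 = z)]
        exact hf
      rcases hl e (by simp) hu.1 with h | h
      · exact key e.1 1 h hu.2.1 (by omega) (by omega) rfl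
      · exact key e.2 2 h hu.2.2 (by omega) (by omega) rfl
    · obtain ⟨z, hz, hf⟩ := ih w p hl' hp
      refine ⟨z, hz, ?_⟩
      rw [run_cons, Search.step, if_neg hu]
      exact hf

/-- The initial state of the search. -/
def init (y : ℕ) : Search := ⟨fun _ => 0, y, 1, 0⟩

theorem valid_init (n y : ℕ) : (init y).Valid n y :=
  ⟨⟨0, rfl⟩, by simp [init], by simp [init], fun v hv => absurd rfl hv,
    fun v u hv => absurd rfl hv⟩

end Search

namespace Stmt

/-- Treat the pair of vertices `vtx` and `nbr` in the search for a vertex cover. -/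
def searchStep : Stmt :=
  .ite (.adj .vtx .nbr)
    (.ite (.wt .vtx) .skip
      (.ite (.wt .nbr) .skip
        (.ite (.mod3 (.var .rest))
          (.seq (.ite (.mod3 (.var .rest) - .const 1) (.store (.wtAddr .nbr) (.var .pow))
              (.store (.wtAddr .vtx) (.var .pow)))
            (.seq (.assign .pow (.var .pow * .const 3))
              (.assign .rest (.var .rest / .const 3))))
          (.assign .fail (.const 1)))))
    .skip

/-- The store `σ` holds the state `c` of the search. -/
structure Holds (B n : ℕ) (a b : ℕ → ℕ) (y : ℕ) (c : Search) (σ : Store) : Prop where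
  ready : Ready B n a c.wt b σ
  rest : σ.vars .rest = c.rest
  pow : σ.vars .pow = c.pow
  fail : σ.vars .fail = c.fail
  guess : σ.vars .guess = y

theorem Holds.set {B n : ℕ} {a b : ℕ → ℕ} {y : ℕ} {c : Search} {σ : Store}
    (h : Holds B n a b y c σ) (x : Var) (i : ℕ)
    (hx : x ∉ [Var.rest, .pow, .fail, .guess, .st] := by decide) :
    Holds B n a b y c (σ.set x i) := by
  have hne : ∀ z ∈ [Var.rest, .pow, .fail, .guess, .st], (σ.set x i).vars z = σ.vars z :=
    fun z hz => Store.set_vars_of_ne _ _ fun e => hx (e ▸ hz)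
  exact ⟨h.ready.of_eq rfl (hne _ (by decide)), (hne _ (by decide)).trans h.rest,
    (hne _ (by decide)).trans h.pow, (hne _ (by decide)).trans h.fail,
    (hne _ (by decide)).trans h.guess⟩

theorem wp_searchStep {B n y : ℕ} {a b : ℕ → ℕ} {c : Search} {σ : Store} {Q : Store → Prop}
    (h : Holds B n a b y c σ) (hv : σ.vars .vtx < n) (hu : σ.vars .nbr < n)
    (hpow : c.pow * 3 ≤ B) (hrest : c.rest ≤ B)
    (hQ : ∀ σ', Holds B n a b y (c.step n a (σ.vars .vtx, σ.vars .nbr)) σ' →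
      σ'.vars .vtx = σ.vars .vtx → σ'.vars .nbr = σ.vars .nbr → Q σ') :
    searchStep.WP B Q σ := by
  have hr := h.ready
  have h3 := hr.three_le
  have hst := hr.st_le
  have ewv := hr.eval_wt hv
  have ewu := hr.eval_wt hu
  have emod : (Expr.mod3 (.var .rest)).eval σ = c.rest % 3 := by
    rw [Expr.eval_mod3, Expr.eval_var, h.rest]
  have fmod : (Expr.mod3 (.var .rest)).Fits B σ :=
    Expr.fits_mod3 (Expr.fits_var _) (by rw [Expr.eval_var, h.rest]; exact hrest) h3
  have hskip : ¬ (a (n * σ.vars .vtx + σ.vars .nbr) ≠ 0 ∧ c.wt (σ.vars .vtx) = 0 ∧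
      c.wt (σ.vars .nbr) = 0) → skip.WP B Q σ := fun hno =>
    wp_skip (hQ σ (by rw [Search.step, if_neg hno]; exact h) rfl rfl)
  refine wp_ite (hr.fits_adj hv hu) (fun h1 => ?_) (fun h1 => ?_) <;>
    rw [hr.eval_adj hv hu] at h1
  swap
  · exact hskip fun h' => h'.1 h1
  refine wp_ite (hr.fits_wt hv) (fun h2 => ?_) (fun h2 => ?_) <;> rw [ewv] at h2
  · exact hskip fun h' => h2 h'.2.1
  refine wp_ite (hr.fits_wt hu) (fun h4 => ?_) (fun h4 => ?_) <;> rw [ewu] at h4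
  · exact hskip fun h' => h4 h'.2.2
  have hstep : c.step n a (σ.vars .vtx, σ.vars .nbr) = _ := if_pos ⟨h1, h2, h4⟩
  rw [hstep] at hQ
  refine wp_ite fmod (fun h5 => ?_) (fun h5 => ?_) <;> rw [emod] at h5
  swap
  · rw [if_pos h5] at hQ
    refine wp_assign (by simp; omega) (hQ _ ⟨?_, ?_, ?_, ?_, ?_⟩ ?_ ?_)
    · exact hr.of_eq rfl (by simp)
    · simp [h.rest]
    · simp [h.pow]
    · simp
    · simp [h.guess]
    · simp
    · simp
  rw [if_neg h5] at hQ
  have hfin : ∀ x, x < n → x = (if c.rest % 3 = 1 then σ.vars .vtx else σ.vars .nbr) →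
      ((Stmt.assign .pow (.var .pow * .const 3)).seq
        (.assign .rest (.var .rest / .const 3))).WP B Q (σ.write (n * n + 1 + x) c.pow) := by
    intro x hxn hx
    refine wp_seq (wp_assign (by simp [h.pow]; omega) (wp_assign (by simp; omega)
      (hQ _ ⟨⟨?_, h3, hr.size_le, by simpa using hr.st_le⟩, ?_, ?_, ?_, ?_⟩ ?_ ?_)))
    · simp only [Store.set_mem, Store.write_mem, hr.mem, ← hx, update_layout_wt hxn]
    · simp [h.rest]
    · simp [h.pow]
    · simp [h.fail]
    · simp [h.guess]
    · simp
    · simp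
  refine wp_seq (wp_ite (by simp [fmod]; omega) (fun h6 => ?_) (fun h6 => ?_)) <;>
    simp only [Expr.eval_sub, Expr.eval_const, emod] at h6
  · refine wp_store (hr.fits_wtAddr hu) (Expr.fits_var _) (by rw [hr.eval_wtAddr]; omega) ?_
    rw [hr.eval_wtAddr, Expr.eval_var, h.pow]
    exact hfin _ hu (by rw [if_neg (by omega)])
  · refine wp_store (hr.fits_wtAddr hv) (Expr.fits_var _) (by rw [hr.eval_wtAddr]; omega) ?_
    rw [hr.eval_wtAddr, Expr.eval_var, h.pow]
    exact hfin _ hv (by rw [if_pos (by omega)])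

/-- Try the current guess for a vertex cover. -/
def tryGuess : Stmt :=
  .seq (.assign .rest (.var .guess)) <| .seq (.assign .pow (.const 1)) <|
    .seq (.assign .fail (.const 0)) <|
    .seq (.forN .vtx (.store (.wtAddr .vtx) (.const 0))) <|
    .seq (.forN .vtx (.forN .nbr searchStep)) (incr .guess)

theorem wp_tryGuess {B n y K : ℕ} {a w b : ℕ → ℕ} {σ : Store} {Q : Store → Prop}
    (hr : Ready B n a w b σ) (hw : ∀ v, n ≤ v → w v = 0) (hy : σ.vars .guess = y)
    (hyK : y < 3 ^ K) (hB : 3 ^ K * 3 ≤ B)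
    (hQ : ∀ σ', Holds B n a b (y + 1) ((Search.init y).run n a (allPairs n n)) σ' → Q σ') :
    tryGuess.WP B Q σ := by
  have h3 := hr.three_le
  have hsz := hr.size_le
  have h0 : σ.mem 0 = n := by simp [hr.mem]
  refine wp_seq (wp_assign (Expr.fits_var _) (wp_seq (wp_assign (by simp; omega)
    (wp_seq (wp_assign (Nat.zero_le B) (wp_seq ?_))))))
  refine wp_forN (fun j σ' => Holds B n a b y
    ⟨fun v => if v < j then 0 else w v, y, 1, 0⟩ σ') ?_ ?_ ?_
  · refine Holds.set ⟨hr.of_eq ?_ ?_, ?_, ?_, ?_, ?_⟩ _ _ <;> simp [hy]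
  · rintro j hj σ' - hvtx h
    simp only [Store.set_mem] at hj
    rw [h0] at hj
    have hr' := h.ready
    have hv : σ'.vars .vtx < n := hvtx ▸ hj
    refine wp_store (hr'.fits_wtAddr hv) (Nat.zero_le B) (by rw [hr'.eval_wtAddr]; omega)
      ⟨by simpa using hvtx, ?_⟩
    have hw' : Function.update (fun v => if v < j then 0 else w v) j 0 =
        fun v => if v < j + 1 then 0 else w v := by
      funext v
      simp only [Function.update_apply]
      split_ifs <;> first | rfl | omega
    refine Holds.set ⟨⟨?_, h3, hsz, by simpa using hr'.st_le⟩, ?_, ?_, ?_, ?_⟩ _ _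
    · simp only [Store.write_mem, hr'.mem, hr'.eval_wtAddr, update_layout_wt hv, Expr.eval_const]
      rw [hvtx, hw']
    · simp [h.rest]
    · simp [h.pow]
    · simp [h.fail]
    · simp [h.guess]
  rintro σ₁ hm₁ h₁
  simp only [Store.set_mem, h0] at hm₁ h₁
  -- The program clears only the weights below `n`; by `hw` the others vanish anyway.
  have hinit : (⟨fun v => if v < n then 0 else w v, y, 1, 0⟩ : Search) = Search.init y := by
    simp only [Search.init, Search.mk.injEq, and_true]
    funext v
    split_ifs with hv
    · rfl
    · exact hw v (by omega)
  rw [hinit] at h₁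
  have hpairs : ∀ i, i < n → ∀ j, j ≤ n → ∀ e ∈ allPairs n i ++ rowPairs i j,
      e.1 < n ∧ e.2 < n := by
    intro i hi j hj e he
    obtain ⟨v, u⟩ := e
    simp only [allPairs, rowPairs, List.mem_append, List.mem_flatMap, List.mem_range,
      List.mem_map, Prod.mk.injEq] at he
    rcases he with ⟨x, hx, z, hz, rfl, rfl⟩ | ⟨z, hz, rfl, rfl⟩ <;> exact ⟨by omega, by omega⟩
  refine wp_seq (wp_forN (fun j σ' => Holds B n a b y
    ((Search.init y).run n a (allPairs n j)) σ') (h₁.set _ _) ?_ ?_)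
  · rintro i hi σ' hm' hvtx h
    rw [hm₁] at hi hm'
    refine wp_forN (fun j σ'' => σ''.vars .vtx = i ∧ Holds B n a b y
      ((Search.init y).run n a (allPairs n i ++ rowPairs i j)) σ'') ?_ ?_ ?_
    · refine ⟨by simpa using hvtx, ?_⟩
      have : rowPairs i 0 = [] := rfl
      rw [this, List.append_nil]
      exact h.set _ _
    · rintro j hj σ'' - hnbr ⟨hvtx', h'⟩
      rw [hm'] at hj
      have hvalid : ((Search.init y).run n a (allPairs n i ++ rowPairs i j)).Valid n y :=
        (Search.valid_init n y).run (hpairs i hi j hj.le)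
      have hple := (Search.valid_init n y).pow_le_run (a := a) hyK
        (Nat.one_le_pow _ _ (by omega)) (hpairs i hi j hj.le)
      have hrest : ((Search.init y).run n a (allPairs n i ++ rowPairs i j)).rest ≤ y := by
        obtain ⟨q, hq⟩ := hvalid.exists_pow
        have h1 : 0 < ((Search.init y).run n a (allPairs n i ++ rowPairs i j)).pow :=
          hq ▸ pow_pos (by omega) q
        exact (Nat.le_mul_of_pos_left _ h1).trans hvalid.pow_mul_rest_le
      refine wp_searchStep h' (by omega) (by omega) (by omega) (by omega) fun σ₃ h₃ hv₃ hu₃ => ?_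
      refine ⟨hu₃.trans hnbr, by simpa using hv₃.trans hvtx', ?_⟩
      rw [hvtx', hnbr] at h₃
      rw [rowPairs_succ, ← List.append_assoc, Search.run_append]
      exact h₃.set _ _
    · rintro σ'' hm'' ⟨hvtx', h'⟩
      rw [hm', ← allPairs_succ] at h'
      exact ⟨hvtx', h'.set _ _⟩
  · rintro σ₂ hm₂ h₂
    rw [hm₁] at h₂
    refine wp_incr (by rw [h₂.guess]; omega) (hQ _ ⟨h₂.ready.of_eq rfl (by simp), ?_, ?_, ?_, ?_⟩)
    · simp [h₂.rest]
    · simp [h₂.pow]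
    · simp [h₂.fail]
    · simp [h₂.guess]

end Stmt

end RAM

namespace RAM

/-! ### States of a sweep as ternary numbers -/

/-- Since the digit at position `i` is at most `1`, there is no carry. -/
theorem add_pow_three_div_mod {s i : ℕ} (h : s / 3 ^ i % 3 ≤ 1) (j : ℕ) :
    (s + 3 ^ i) / 3 ^ j % 3 = s / 3 ^ j % 3 + if i = j then 1 else 0 := by
  have hpos : ∀ k, 0 < 3 ^ k := fun k => pow_pos (by omega) k
  have hdiv : (s + 3 ^ i) / 3 ^ i = s / 3 ^ i + 1 := Nat.add_div_right _ (hpos i)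
  rcases lt_trichotomy i j with hij | rfl | hij
  · rw [if_neg hij.ne, Nat.add_zero]
    congr 1
    obtain ⟨r, rfl⟩ : ∃ r, j = i + 1 + r := ⟨j - i - 1, by omega⟩
    rw [pow_add, pow_add, pow_one, ← Nat.div_div_eq_div_mul, ← Nat.div_div_eq_div_mul,
      ← Nat.div_div_eq_div_mul, ← Nat.div_div_eq_div_mul, hdiv]
    congr 1
    omega
  · rw [if_pos rfl, hdiv]
    omega
  · rw [if_neg hij.ne', Nat.add_zero]
    obtain ⟨r, rfl⟩ : ∃ r, i = j + 1 + r := ⟨i - j - 1, by omega⟩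
    have : 3 ^ (j + 1 + r) = 3 ^ j * (3 * 3 ^ r) := by ring
    rw [this, Nat.add_mul_div_left _ _ (hpos j)]
    omega

/-- The array `a` is the adjacency matrix of `G`, and the weights `w` are the powers `1, 3, 9, …`
up to `p / 3`, on a vertex cover of `G`. -/
structure Encodes {n : ℕ} (G : SimpleGraph (Fin n)) (a w : ℕ → ℕ) (p : ℕ) : Prop where
  adj : ∀ v u : Fin n, a (n * v + u) ≠ 0 ↔ G.Adj v u
  exists_pow : ∃ q, p = 3 ^ q
  sum_eq : 1 + 2 * ∑ v ∈ Finset.range n, w v = p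
  wt_eq : ∀ v, w v ≠ 0 → v < n ∧ w v < p ∧ ∃ i, w v = 3 ^ i
  inj : ∀ v u, w v ≠ 0 → w v = w u → v = u
  cover : ∀ v u : Fin n, G.Adj v u → w v ≠ 0 ∨ w u ≠ 0

/-- The vertex cover. -/
def coverSet (n : ℕ) (w : ℕ → ℕ) : Finset (Fin n) := Finset.univ.filter fun v => w v ≠ 0

/-- The vertices that have been introduced in the state `s`. -/
def introduced (n : ℕ) (w : ℕ → ℕ) (s : ℕ) : Finset (Fin n) :=
  Finset.univ.filter fun v => 1 ≤ digit w s v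

/-- The vertices that have been forgotten in the state `s`. -/
def forgotten (n : ℕ) (w : ℕ → ℕ) (s : ℕ) : Finset (Fin n) :=
  Finset.univ.filter fun v => digit w s v = 2

@[simp] theorem mem_coverSet {n : ℕ} {w : ℕ → ℕ} {v : Fin n} : v ∈ coverSet n w ↔ w v ≠ 0 := by
  simp [coverSet]

@[simp] theorem mem_introduced {n : ℕ} {w : ℕ → ℕ} {s : ℕ} {v : Fin n} :
    v ∈ introduced n w s ↔ 1 ≤ digit w s v := by
  simp [introduced]

@[simp] theorem mem_forgotten {n : ℕ} {w : ℕ → ℕ} {s : ℕ} {v : Fin n} :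
    v ∈ forgotten n w s ↔ digit w s v = 2 := by
  simp [forgotten]

namespace Encodes

variable {n : ℕ} {G : SimpleGraph (Fin n)} {a w b : ℕ → ℕ} {p : ℕ}

/-- Different vertices of the cover have different powers of `3` as weights, so adding `w x` moves
`x` to its next status and changes nothing else. -/
theorem digit_add (h : Encodes G a w p) {s x : ℕ} (hx : w x ≠ 0) (hd : digit w s x ≤ 1) (v : ℕ) :
    digit w (s + w x) v = digit w s v + if v = x then 1 else 0 := by
  by_cases hv : w v = 0
  · have hne : v ≠ x := fun e => hx (e ▸ hv)
    simp [digit_of_wt_eq_zero hv, hne]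
  obtain ⟨-, -, i, hi⟩ := h.wt_eq x hx
  obtain ⟨-, -, j, hj⟩ := h.wt_eq v hv
  simp only [digit] at hd ⊢
  rw [hi] at hd ⊢
  rw [hj, add_pow_three_div_mod hd]
  congr 1
  have : i = j ↔ v = x := by
    constructor
    · rintro rfl
      exact h.inj v x hv (hj.trans hi.symm)
    · rintro rfl
      exact Nat.pow_right_injective (by omega : 2 ≤ 3) (hi.symm.trans hj)
  simp only [this]

theorem wt_ne_zero_of_digit {s x : ℕ} (hd : 1 ≤ digit w s x) : w x ≠ 0 := fun e => by
  rw [digit_of_wt_eq_zero e] at hd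
  omega

theorem wt_le_of_digit {s x : ℕ} (hd : 1 ≤ digit w s x) : w x ≤ s := by
  by_contra hc
  rw [digit, Nat.div_eq_of_lt (by omega)] at hd
  simp at hd

theorem digit_sub (h : Encodes G a w p) {s x : ℕ} (hd : 1 ≤ digit w s x) (v : ℕ) :
    digit w s v = digit w (s - w x) v + if v = x then 1 else 0 := by
  have hx := wt_ne_zero_of_digit hd
  have hle := wt_le_of_digit hd
  have hd' : digit w (s - w x) x ≤ 1 := by
    have h1 : (s - w x) / w x = s / w x - 1 := by
      have := Nat.sub_mul_div s (w x) 1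
      rwa [mul_one] at this
    have h2 := digit_le_two w s x
    simp only [digit] at hd h2 ⊢
    rw [h1]
    omega
  conv_lhs => rw [← Nat.sub_add_cancel hle]
  exact h.digit_add hx hd' v

theorem card_filter_fin (P : ℕ → Prop) [DecidablePred P] :
    ∑ u ∈ Finset.range n, (if P u then 1 else 0) =
      (Finset.univ.filter fun u : Fin n => P u).card := by
  rw [Finset.sum_range, Finset.card_filter]

theorem unseenCount_eq (n : ℕ) (a w : ℕ → ℕ) (s v : ℕ) : unseenCount n a w s v n =
    (Finset.univ.filter fun u : Fin n =>
      a (n * v + u) ≠ 0 ∧ w u ≠ 0 ∧ digit w s u = 0).card :=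
  card_filter_fin (fun u => a (n * v + u) ≠ 0 ∧ w u ≠ 0 ∧ digit w s u = 0)

theorem goneCount_eq (n : ℕ) (a w : ℕ → ℕ) (s v : ℕ) : goneCount n a w s v n =
    (Finset.univ.filter fun u : Fin n => a (n * v + u) ≠ 0 ∧ digit w s u = 2).card :=
  card_filter_fin (fun u => a (n * v + u) ≠ 0 ∧ digit w s u = 2)

theorem unseenCount_eq_zero (h : Encodes G a w p) (s : ℕ) (v : Fin n) :
    unseenCount n a w s v n = 0 ↔
      ∀ u, G.Adj v u → u ∈ coverSet n w → u ∈ introduced n w s := by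
  simp only [unseenCount_eq, Finset.card_eq_zero, Finset.filter_eq_empty_iff, Finset.mem_univ,
    true_implies, h.adj, mem_coverSet, mem_introduced, not_and, Nat.one_le_iff_ne_zero]

theorem goneCount_ne_zero (h : Encodes G a w p) (s : ℕ) (v : Fin n) :
    goneCount n a w s v n ≠ 0 ↔ ∃ u, G.Adj v u ∧ u ∈ forgotten n w s := by
  simp only [goneCount_eq, ← Nat.pos_iff_ne_zero, Finset.card_pos, Finset.Nonempty,
    Finset.mem_filter, Finset.mem_univ, true_and, h.adj, mem_forgotten]

theorem goneCount_lt_two (h : Encodes G a w p) {s : ℕ} {v y : Fin n} (hvy : G.Adj v y)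
    (hy : y ∈ forgotten n w s) :
    ¬ 2 ≤ goneCount n a w s v n ↔ ∀ u, G.Adj v u → u ∈ forgotten n w s → u = y := by
  rw [goneCount_eq, not_le, Nat.lt_succ_iff, Finset.card_le_one]
  simp only [Finset.mem_filter, Finset.mem_univ, true_and, h.adj, ← mem_forgotten]
  constructor
  · exact fun h1 u hu hu' => h1 u ⟨hu, hu'⟩ y ⟨hvy, hy⟩
  · exact fun h1 u hu z hz => (h1 u hu.1 hu.2).trans (h1 z hz.1 hz.2).symm

theorem adj_mem_cover (h : Encodes G a w p) (u v : Fin n) (ha : G.Adj u v) :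
    u ∈ coverSet n w ∨ v ∈ coverSet n w := by
  simpa using h.cover u v ha

/-- As `y` is forgotten and adjacent to `v`, being the only forgotten neighbour of `v` means that
the count is below `2`. For `v` outside the cover all neighbours lie in the cover, so the
restriction to the cover in `unseenCount` loses nothing. -/
theorem noCommon_iff (h : Encodes G a w p) {s : ℕ} {x y : Fin n}
    (hy : y ∈ forgotten n w s) : NoCommon n a w s x y n ↔
      ¬ ∃ v, v ∉ coverSet n w ∧ G.Adj v x ∧ G.Adj v y ∧
        (∀ u, G.Adj v u → u ∈ introduced n w s) ∧
        ∀ u, G.Adj v u → u ∈ forgotten n w s → u = y := by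
  have hun : ∀ v : Fin n, v ∉ coverSet n w →
      (unseenCount n a w s v n = 0 ↔ ∀ u, G.Adj v u → u ∈ introduced n w s) := by
    intro v hv
    rw [h.unseenCount_eq_zero]
    exact forall₂_congr fun u hu => by simp [(h.adj_mem_cover v u hu).resolve_left hv, -mem_coverSet]
  push Not
  constructor
  · intro hno v hvC hvx hvy hvA
    by_contra hc
    push Not at hc
    refine (h.goneCount_lt_two hvy hy).2 hc (hno v v.2 ((h.adj v x).2 hvx) ((h.adj v y).2 hvy) ?_
      ((hun v hvC).2 hvA))
    simpa using hvC
  · intro hno v hv hvx hvy hvw hvu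
    have hvC : (⟨v, hv⟩ : Fin n) ∉ coverSet n w := by simpa using hvw
    have hvy' := (h.adj ⟨v, hv⟩ y).1 hvy
    by_contra hc
    obtain ⟨u, hu, hu', hne⟩ := hno ⟨v, hv⟩ hvC ((h.adj ⟨v, hv⟩ x).1 hvx) hvy'
      ((hun ⟨v, hv⟩ hvC).1 hvu)
    exact hne ((h.goneCount_lt_two (v := ⟨v, hv⟩) hvy' hy).1 hc u hu hu')

/-- In a state without violations, each vertex contributes `1` or `0` according to whether it is
active. A forgotten vertex with an unseen neighbour in the cover contributes `n`, which exceeds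
every `W < n`. -/
theorem stateCost_le_iff (h : Encodes G a w p) {s W : ℕ} (hW : W < n) :
    stateCost n a w s n ≤ W ↔
      Admissible G (coverSet n w) W (introduced n w s) (forgotten n w s) := by
  classical
  have hsum : stateCost n a w s n = ∑ v : Fin n, vertexCost n a w s v := Finset.sum_range _
  rw [hsum]
  by_cases hvalid : ∀ b ∈ forgotten n w s, ∀ u ∈ coverSet n w, G.Adj b u → u ∈ introduced n w s
  · rw [Admissible, and_iff_right hvalid, active, Finset.card_filter]
    have : ∀ v : Fin n, vertexCost n a w s v = if (v ∈ introduced n w s ∧ v ∉ forgotten n w s) ∨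
        (v ∉ coverSet n w ∧ (∃ u, G.Adj v u ∧ u ∈ forgotten n w s) ∧
          ∃ u, G.Adj v u ∧ u ∉ introduced n w s) then 1 else 0 := by
      intro v
      have hd := digit_le_two w s v
      by_cases hv : w v = 0
      · have hvC : v ∉ coverSet n w := by simpa using hv
        have hvA : v ∉ introduced n w s := by simp [digit_of_wt_eq_zero hv]
        have h1 : unseenCount n a w s v n ≠ 0 ↔ ∃ u, G.Adj v u ∧ u ∉ introduced n w s := by
          rw [Ne, h.unseenCount_eq_zero]
          push Not
          exact exists_congr fun u =>
            ⟨fun hu => ⟨hu.1, hu.2.2⟩, fun hu =>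
              ⟨hu.1, (h.adj_mem_cover v u hu.1).resolve_left hvC, hu.2⟩⟩
        simp only [vertexCost, hv, ne_eq, not_true_eq_false, if_false]
        congr 1
        rw [← ne_eq, ← ne_eq, h1, h.goneCount_ne_zero]
        simp only [hvA, false_and, false_or, hvC, not_false_eq_true, true_and, eq_iff_iff]
        exact and_comm
      · have hvC : v ∈ coverSet n w := by simpa using hv
        have h1 : digit w s v = 2 → unseenCount n a w s v n = 0 := by
          intro hd
          rw [h.unseenCount_eq_zero]
          exact fun u hu huC => hvalid v (by simpa using hd) u huC hu
        simp only [vertexCost, ne_eq, hv, not_false_eq_true, if_true, hvC, not_true_eq_false,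
          false_and, or_false, mem_introduced, mem_forgotten]
        split_ifs <;> first | rfl | omega
    simp only [this]
    refine Eq.to_iff ?_
    congr 1
    exact Finset.sum_congr rfl fun v _ => by congr
  · refine ⟨fun hle => ?_, fun hle => absurd hle.1 hvalid⟩
    push Not at hvalid
    obtain ⟨v, hv, u, hu, hvu, huA⟩ := hvalid
    exfalso
    have h1 : vertexCost n a w s v = n := by
      have hd : digit w s v = 2 := by simpa using hv
      have hwv : w v ≠ 0 := wt_ne_zero_of_digit (s := s) (by omega)
      have hun : unseenCount n a w s v n ≠ 0 := fun e =>
        huA ((h.unseenCount_eq_zero s v).1 e u hvu hu)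
      simp [vertexCost, hd, hwv, hun]
    have h2 := Finset.single_le_sum (f := fun v : Fin n => vertexCost n a w s v)
      (fun _ _ => Nat.zero_le _) (Finset.mem_univ v)
    simp only [h1] at h2
    omega

/-- Strong induction along predecessors. In the single step, the digit of `x` decides: `1` means
that `x` was just introduced, `2` that it was just forgotten. -/
theorem sweep_of_le (h : Encodes G a w p) (hb : ∀ s < p, CorrectEntry n a w b s) {W : ℕ}
    (hW : W < n) (s : ℕ) (hs : s < p) (hle : b s ≤ W) :
    Sweep G (coverSet n w) W (introduced n w s) (forgotten n w s) := by
  induction s using Nat.strong_induction_on with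
  | _ s ih =>
    obtain ⟨hcost, hstep⟩ := (hb s hs W hW).1 hle
    have hok := (h.stateCost_le_iff hW).1 hcost
    rcases hstep with rfl | ⟨x, hx, hdx, hstep⟩
    · have h1 : introduced n w 0 = ∅ := by ext v; simp [digit]
      have h2 : forgotten n w 0 = ∅ := by ext v; simp [digit]
      rw [h1, h2]
      exact .start
    have hwx := wt_ne_zero_of_digit hdx
    have hlex := wt_le_of_digit hdx
    have hsubx := h.digit_sub hdx
    have hd2 := digit_le_two w s x
    have hxx := hsubx x
    rw [if_pos rfl] at hxx
    rcases hstep with hstep | ⟨y, hy, hdy, hxy, hno, hstep⟩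
    · have hsw := ih (s - w x) (by omega) (by omega) hstep
      by_cases hd1 : digit w s x = 1
      · have h1 : introduced n w s = insert ⟨x, hx⟩ (introduced n w (s - w x)) := by
          ext v
          have := hsubx v
          simp only [mem_introduced, Finset.mem_insert, Fin.ext_iff]
          split_ifs at this with hv <;> simp only [hv, true_or, false_or, iff_true] <;> omega
        have h2 : forgotten n w s = forgotten n w (s - w x) := by
          ext v
          have := hsubx v
          simp only [mem_forgotten]
          split_ifs at this with hv
          · rw [hv] at this ⊢; omega
          · omega
        rw [h1, h2] at hok ⊢
        exact .introduce _ _ _ hsw (by simpa using hwx) (by simp; omega) hok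
      · have h1 : introduced n w s = introduced n w (s - w x) := by
          ext v
          have := hsubx v
          simp only [mem_introduced]
          split_ifs at this with hv
          · rw [hv] at this ⊢; omega
          · omega
        have h2 : forgotten n w s = insert ⟨x, hx⟩ (forgotten n w (s - w x)) := by
          ext v
          simp only [mem_forgotten, Finset.mem_insert, Fin.ext_iff]
          by_cases hv : v.val = x
          · simp only [hv, true_or, iff_true]; omega
          · have := hsubx v
            rw [if_neg hv] at this
            simp only [hv, false_or]
            omega
        rw [h1, h2] at hok ⊢
        exact .forget _ _ _ hsw (by simp; omega) (by simp; omega) hok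
    · have hdy' : 1 ≤ digit w (s - w x) y := by
        have := hsubx y
        split_ifs at this with e
        · omega
        · omega
      have hwy := wt_ne_zero_of_digit hdy'
      have hley := wt_le_of_digit hdy'
      have hsuby := h.digit_sub hdy'
      have hsw := ih (s - w x - w y) (by omega) (by omega) hstep
      have hno' := (h.noCommon_iff (x := ⟨x, hx⟩) (y := ⟨y, hy⟩) (s := s) (by simpa using hdy)).1 hno
      have hyx := hsuby x
      have hyy := hsuby y
      have h1 : introduced n w s = insert ⟨x, hx⟩ (introduced n w (s - w x - w y)) := by
        ext v
        have e1 := hsubx v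
        have e2 := hsuby v
        have e3 := hsubx y
        simp only [mem_introduced, Finset.mem_insert, Fin.ext_iff]
        by_cases hvx : v.val = x
        · simp only [hvx, true_or, iff_true]; exact hdx
        · rw [if_neg hvx] at e1
          by_cases hvy : v.val = y
          · rw [← hvy] at hdy hsuby hdy'
            rw [if_pos hvy] at e2
            simp only [hvx, false_or]
            rw [← hvy] at hyy
            omega
          · rw [if_neg hvy] at e2
            simp only [hvx, false_or]
            omega
      have h2 : forgotten n w s = insert ⟨y, hy⟩ (forgotten n w (s - w x - w y)) := by
        ext v
        have e1 := hsubx v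
        have e2 := hsuby v
        simp only [mem_forgotten, Finset.mem_insert, Fin.ext_iff]
        by_cases hvy : v.val = y
        · simp only [hvy, true_or, iff_true]; exact hdy
        · rw [if_neg hvy] at e2
          by_cases hvx : v.val = x
          · have : digit w s x = 1 := hxy.resolve_right fun e => hvy (hvx.trans e)
            rw [hvx] at e1 e2
            simp only [hvx] at *
            omega
          · rw [if_neg hvx] at e1
            simp only [hvy, false_or]
            omega
      rw [h1, h2] at hok hno' ⊢
      refine .replace ⟨x, hx⟩ ⟨y, hy⟩ _ _ hsw (by simpa using hwx) ?_ ?_ ?_ hno' hok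
      -- Before the double step the digit of `x` was `0`: it drops from `1` to `0`, or from `2` to
      -- `0` if `x = y`.
      · simp only [mem_introduced]
        rcases hxy with e | e
        · split_ifs at hyx <;> omega
        · rw [if_pos e] at hyx; omega
      · rw [← h1, mem_introduced]
        simp only
        omega
      · have := hsubx y
        simp only [mem_forgotten]
        rw [if_pos rfl] at hyy
        omega

/-- The state `s` uses no digits beyond those of the vertices. -/
def IsState (n : ℕ) (w : ℕ → ℕ) (s : ℕ) : Prop :=
  s = ∑ v ∈ Finset.range n, digit w s v * w v

theorem IsState.lt (h : Encodes G a w p) {s : ℕ} (hs : IsState n w s) : s < p := by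
  have h1 : ∑ v ∈ Finset.range n, digit w s v * w v ≤ ∑ v ∈ Finset.range n, 2 * w v :=
    Finset.sum_le_sum fun v _ => Nat.mul_le_mul_right _ (digit_le_two w s v)
  rw [← Finset.mul_sum] at h1
  have h2 := h.sum_eq
  rw [IsState] at hs
  omega

theorem IsState.add (h : Encodes G a w p) {s x : ℕ} (hs : IsState n w s) (hx : w x ≠ 0)
    (hd : digit w s x ≤ 1) : IsState n w (s + w x) := by
  have hxn := (h.wt_eq x hx).1
  rw [IsState]
  simp only [h.digit_add hx hd, add_mul, Finset.sum_add_distrib, ite_mul, one_mul, zero_mul]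
  rw [Finset.sum_ite_eq', if_pos (Finset.mem_range.2 hxn), ← hs]

theorem introduced_add (h : Encodes G a w p) {s : ℕ} {x : Fin n} (hx : w x ≠ 0)
    (hd : digit w s x ≤ 1) : introduced n w (s + w x) = insert x (introduced n w s) := by
  ext v
  simp only [mem_introduced, Finset.mem_insert, h.digit_add hx hd, Fin.ext_iff]
  split_ifs with hv <;> simp [hv]

theorem forgotten_add (h : Encodes G a w p) {s : ℕ} {x : Fin n} (hd : digit w s x = 1) :
    forgotten n w (s + w x) = insert x (forgotten n w s) := by
  have hx : w x ≠ 0 := wt_ne_zero_of_digit hd.ge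
  ext v
  simp only [mem_forgotten, Finset.mem_insert, h.digit_add hx hd.le, Fin.ext_iff]
  split_ifs with hv <;> simp [hv, hd]

theorem forgotten_add_of_eq_zero (h : Encodes G a w p) {s : ℕ} {x : Fin n} (hx : w x ≠ 0)
    (hd : digit w s x = 0) : forgotten n w (s + w x) = forgotten n w s := by
  ext v
  simp only [mem_forgotten, h.digit_add hx (by omega : digit w s x ≤ 1)]
  split_ifs with hv <;> simp [hv, hd]

/-- Each step of the sweep adds weights to the number. Carrying `IsState` along keeps the number
below `p`, where the table is correct, and later identifies the final state. -/
theorem exists_state_of_sweep (h : Encodes G a w p) (hb : ∀ s < p, CorrectEntry n a w b s) {W : ℕ}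
    (hW : W < n) {A B : Finset (Fin n)} (hS : Sweep G (coverSet n w) W A B) :
    ∃ s, IsState n w s ∧ introduced n w s = A ∧ forgotten n w s = B ∧ b s ≤ W := by
  induction hS with
  | start =>
    have h1 : introduced n w 0 = ∅ := by ext v; simp [digit]
    have h2 : forgotten n w 0 = ∅ := by ext v; simp [digit]
    have hs : IsState n w 0 := by simp [IsState, digit]
    refine ⟨0, hs, h1, h2, (hb 0 (hs.lt h) W hW).2 ⟨(h.stateCost_le_iff hW).2 ?_, .inl rfl⟩⟩
    simp [h1, h2, Admissible, active]
  | introduce x A B _ hx hxA hok ih =>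
    obtain ⟨s, hs, rfl, rfl, hle⟩ := ih
    have hwx : w x ≠ 0 := by simpa using hx
    have hd : digit w s x = 0 := by simpa using hxA
    have h1 := h.introduced_add hwx (by omega : digit w s x ≤ 1)
    have h2 := h.forgotten_add_of_eq_zero hwx hd
    have hs' := hs.add h hwx (by omega)
    refine ⟨s + w x, hs', h1, h2, (hb _ (hs'.lt h) W hW).2
      ⟨(h.stateCost_le_iff hW).2 (h1 ▸ h2 ▸ hok), .inr ⟨x, x.2, ?_, .inl (by simpa using hle)⟩⟩⟩
    rw [h.digit_add hwx (by omega), if_pos rfl]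
    omega
  | forget x A B _ hx hxB hok ih =>
    obtain ⟨s, hs, rfl, rfl, hle⟩ := ih
    have hd2 := digit_le_two w s x
    simp only [mem_introduced] at hx
    simp only [mem_forgotten] at hxB
    have hwx : w x ≠ 0 := wt_ne_zero_of_digit hx
    have hd : digit w s x = 1 := by omega
    have h1 := h.introduced_add hwx hd.le
    rw [Finset.insert_eq_of_mem (by simpa using hx)] at h1
    have h2 := h.forgotten_add hd
    have hs' := hs.add h hwx hd.le
    refine ⟨s + w x, hs', h1, h2, (hb _ (hs'.lt h) W hW).2
      ⟨(h.stateCost_le_iff hW).2 (h1 ▸ h2 ▸ hok), .inr ⟨x, x.2, ?_, .inl (by simpa using hle)⟩⟩⟩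
    rw [h.digit_add hwx (by omega), if_pos rfl]
    omega
  | replace x y A B _ hx hxA hy hyB hfree hok ih =>
    obtain ⟨s, hs, rfl, rfl, hle⟩ := ih
    have hwx : w x ≠ 0 := by simpa using hx
    have hd : digit w s x = 0 := by simpa using hxA
    have h1 := h.introduced_add hwx (by omega : digit w s x ≤ 1)
    have h2 := h.forgotten_add_of_eq_zero hwx hd
    have hs' := hs.add h hwx (by omega)
    rw [← h1] at hy hfree hok
    rw [← h2] at hyB hfree hok
    have hd2 := digit_le_two w (s + w x) y
    have hy' : 1 ≤ digit w (s + w x) y := by simpa using hy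
    simp only [mem_forgotten] at hyB
    have hdy : digit w (s + w x) y = 1 := by omega
    have hwy : w y ≠ 0 := wt_ne_zero_of_digit hy'
    have h3 := h.introduced_add hwy hdy.le
    rw [Finset.insert_eq_of_mem hy] at h3
    have h4 := h.forgotten_add hdy
    have hs'' := hs'.add h hwy hdy.le
    have hyx := h.digit_add hwy hdy.le x
    have hxx := h.digit_add hwx (by omega : digit w s x ≤ 1) x
    rw [if_pos rfl] at hxx
    rw [← h3] at hfree hok
    rw [← h4] at hfree hok
    refine ⟨s + w x + w y, hs'', by rw [h3, h1], by rw [h4, h2], (hb _ (hs''.lt h) W hW).2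
      ⟨(h.stateCost_le_iff hW).2 hok, .inr ⟨x, x.2, by omega, .inr ⟨y, y.2, ?_, ?_, ?_, ?_⟩⟩⟩⟩
    · rw [h.digit_add hwy hdy.le, if_pos rfl, hdy]
    · by_cases hxy : (x : ℕ) = y
      · exact .inr hxy
      · rw [if_neg hxy] at hyx
        exact .inl (by omega)
    · exact (h.noCommon_iff (by rw [h4]; simp)).2 hfree
    · have : s + w x + w y - w x - w y = s := by omega
      rwa [this]

/-- All ternary digits of `3 ^ q - 1` are `2`. -/
theorem digit_last (h : Encodes G a w p) {v : ℕ} (hv : w v ≠ 0) : digit w (p - 1) v = 2 := by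
  obtain ⟨q, rfl⟩ := h.exists_pow
  obtain ⟨-, hlt, i, hi⟩ := h.wt_eq v hv
  rw [hi] at hlt
  have hiq := (Nat.pow_lt_pow_iff_right (by omega : 1 < 3)).1 hlt
  obtain ⟨r, rfl⟩ : ∃ r, q = i + 1 + r := ⟨q - i - 1, by omega⟩
  have hi0 : 0 < 3 ^ i := pow_pos (by omega) i
  have hr0 : 0 < 3 ^ r := pow_pos (by omega) r
  have h1 : 3 ^ (i + 1 + r) - 1 = (3 ^ i - 1) + 3 ^ i * (3 * 3 ^ r - 1) := by
    have : 3 ^ (i + 1 + r) = 3 ^ i * (3 * 3 ^ r) := by ring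
    rw [this, Nat.mul_sub_one]
    have := Nat.le_mul_of_pos_right (3 ^ i) (by omega : 0 < 3 * 3 ^ r)
    omega
  rw [digit, hi, h1, Nat.add_mul_div_left _ _ hi0, Nat.div_eq_of_lt (by omega)]
  omega

/-- The last table entry tells how large the bags have to be. -/
theorem last_le_iff (h : Encodes G a w p) (hb : ∀ s < p, CorrectEntry n a w b s) {W : ℕ}
    (hW : W < n) : b (p - 1) ≤ W ↔ Separable G W Finset.univ := by
  have h1 : introduced n w (p - 1) = coverSet n w := by
    ext v
    rw [mem_introduced, mem_coverSet]
    exact ⟨wt_ne_zero_of_digit, fun hv => by rw [h.digit_last hv]; omega⟩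
  have h2 : forgotten n w (p - 1) = coverSet n w := by
    ext v
    rw [mem_forgotten, mem_coverSet]
    exact ⟨fun hv => wt_ne_zero_of_digit (s := p - 1) (by omega), h.digit_last⟩
  have hsum := h.sum_eq
  rw [← Sweep.iff_separable h.adj_mem_cover]
  constructor
  · intro hle
    have := h.sweep_of_le hb hW (p - 1) (by omega) hle
    rwa [h1, h2] at this
  · intro hS
    obtain ⟨s, hs, -, hf, hle⟩ := h.exists_state_of_sweep hb hW hS
    -- A state with digit `2` on the whole cover is twice the sum of the weights, which is `p - 1`.
    have : s = p - 1 := by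
      rw [IsState] at hs
      rw [← hsum, hs, Nat.add_sub_cancel_left, Finset.mul_sum]
      refine Finset.sum_congr rfl fun v hv => ?_
      by_cases hv0 : w v = 0
      · simp [hv0]
      · have : (⟨v, Finset.mem_range.1 hv⟩ : Fin n) ∈ forgotten n w s := by
          rw [hf]; simpa using hv0
        rw [mem_forgotten] at this
        rw [← this]
    rwa [← this]

end Encodes

end RAM

namespace RAM

/-! ### The algorithm -/

/-- Predecessors have smaller or equal numbers, even with truncated subtraction, so an entry written
later does not matter. -/
theorem CorrectEntry.update {n s j : ℕ} {a w b : ℕ → ℕ} {c : ℕ} (hs : s < j)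
    (h : CorrectEntry n a w b s) : CorrectEntry n a w (Function.update b j c) s := by
  intro W hW
  have hb : ∀ t ≤ s, Function.update b j c t = b t := fun t ht =>
    Function.update_of_ne (by omega) _ _
  have hstep : ∀ x, Step n a w (Function.update b j c) s W x n ↔ Step n a w b s W x n := by
    intro x
    simp only [Step, PairStep, hb _ (Nat.sub_le s (w x)),
      hb _ ((Nat.sub_le (s - w x) (w _)).trans (Nat.sub_le s (w x)))]
  rw [hb s le_rfl, h W hW]
  simp only [hstep]

/-- A nonzero digit forces a positive weight not exceeding the state, so every predecessor is
strictly smaller and not overwritten. -/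
theorem correctEntry_update_self {n j : ℕ} {a w b : ℕ → ℕ} {c : ℕ}
    (h : ∀ W < n, c ≤ W ↔ stateCost n a w j n ≤ W ∧ (j = 0 ∨ ∃ x < n, Step n a w b j W x n)) :
    CorrectEntry n a w (Function.update b j c) j := by
  intro W hW
  rw [Function.update_self, h W hW]
  have hstep : ∀ x, Step n a w (Function.update b j c) j W x n ↔ Step n a w b j W x n := by
    intro x
    refine and_congr_right fun hd => ?_
    have hwx : 0 < w x := Nat.pos_of_ne_zero (Encodes.wt_ne_zero_of_digit hd)
    have hle := Encodes.wt_le_of_digit hd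
    have hb : ∀ t < j, Function.update b j c t = b t := fun t ht =>
      Function.update_of_ne (by omega) _ _
    simp only [PairStep, hb (j - w x) (by omega), fun y => hb (j - w x - w y) (by omega)]
  simp only [hstep]

/-- Make the loop over the guesses start. -/
def startGuess : Stmt := .assign .fail (.const 1)

/-- Prepare the loop over the states. -/
def startTable : Stmt := .seq (.assign .st (.const 0)) (.assign .left (.var .pow))

/-- Write the last table entry into the output register. -/
def output : Stmt := .assign .res (.best (.var .pow - .const 1))

/-- The algorithm for the pathwidth: guess a vertex cover, starting with the small ones, and then
fill the table of the states of a sweep over it. -/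
def pathwidthProgram : Program :=
  .seq startGuess.compile <| .seq (.loop Var.fail.idx Stmt.tryGuess.compile) <|
    .seq startTable.compile <| .seq (.loop Var.left.idx Stmt.fillEntry.compile) output.compile

open Classical in
/-- The adjacency matrix of a graph, as an array. -/
noncomputable def adjArray {n : ℕ} (G : SimpleGraph (Fin n)) (i : ℕ) : ℕ :=
  if ∃ u v : Fin n, i = n * (u : ℕ) + (v : ℕ) ∧ G.Adj u v then 1 else 0

theorem adjArray_ne_zero {n : ℕ} (G : SimpleGraph (Fin n)) (u v : Fin n) :
    adjArray G (n * u + v) ≠ 0 ↔ G.Adj u v := by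
  rw [adjArray]
  have hn : 0 < n := u.pos
  have : (∃ u' v' : Fin n, n * (u : ℕ) + v = n * (u' : ℕ) + v' ∧ G.Adj u' v') ↔ G.Adj u v := by
    refine ⟨?_, fun h => ⟨u, v, rfl, h⟩⟩
    rintro ⟨u', v', h, hadj⟩
    have h1 : (n * (u : ℕ) + v) / n = u := by
      rw [Nat.mul_add_div hn, Nat.div_eq_of_lt v.2, Nat.add_zero]
    have h2 : (n * (u' : ℕ) + v') / n = u' := by
      rw [Nat.mul_add_div hn, Nat.div_eq_of_lt v'.2, Nat.add_zero]
    have h3 : u = u' := Fin.ext (by rw [← h1, ← h2, h])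
    subst h3
    have h4 : v = v' := Fin.ext (by omega)
    rwa [h4]
  simp [this]

theorem graphInput_mem {n : ℕ} (G : SimpleGraph (Fin n)) :
    (graphInput G).mem = layout n (adjArray G) (fun _ => 0) fun _ => 0 := by
  funext i
  rw [layout]
  simp only [graphInput]
  by_cases h0 : i = 0
  · simp [h0]
  rw [if_neg h0, if_neg h0, ite_self]
  have hiff : (∃ u v : Fin n, i = 1 + (n * (u : ℕ) + (v : ℕ)) ∧ G.Adj u v) ↔
      ∃ u v : Fin n, i - 1 = n * (u : ℕ) + (v : ℕ) ∧ G.Adj u v :=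
    exists₂_congr fun u v => and_congr_left fun _ => by omega
  split_ifs with h1 h2 h2
  · rw [adjArray, if_pos (hiff.1 h1)]
  · obtain ⟨u, v, h3, -⟩ := h1
    have := mul_add_lt u.2 v.2
    omega
  · rw [adjArray, if_neg fun h => h1 (hiff.2 h)]
  · rfl

/-- The store at the start of the algorithm. -/
noncomputable def initialStore {n : ℕ} (G : SimpleGraph (Fin n)) : Store :=
  ⟨fun _ => 0, (graphInput G).mem⟩

theorem represents_graphInput {n B : ℕ} (G : SimpleGraph (Fin n)) (hn : n ≤ B) (h1 : 1 ≤ B) :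
    Represents B (initialStore G) (graphInput G) := by
  refine ⟨fun _ => rfl, rfl, fun _ => Nat.zero_le B, fun i => ?_⟩
  simp only [graphInput]
  split_ifs <;> omega

/-- A bound for all values in a run of the algorithm. -/
def valueBound (n k : ℕ) : ℕ := n * n + n + 1 + 3 ^ k * 3

/-- The invariant records that all guesses so far have failed as long as the loop goes on; as some
guess below `3 ^ k` succeeds, this bounds the rounds. The first success yields a cover with weights,
and `pow ≤ 3 ^ k`. -/
theorem runs_tryGuess_loop {n k : ℕ} {G : SimpleGraph (Fin n)} {σ : Store}
    (hcover : ∃ y < 3 ^ k, ((Search.init y).run n (adjArray G) (allPairs n n)).fail = 0)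
    (hr : Ready (valueBound n k) n (adjArray G) (fun _ => 0) (fun _ => 0) σ)
    (hg : σ.vars .guess = 0) (hf : σ.vars .fail ≠ 0) :
    Runs (valueBound n k) (1 + 3 ^ k * (Stmt.tryGuess.time n + 1))
      (.loop Var.fail.idx Stmt.tryGuess.compile)
      (fun σ' => ∃ w, Encodes G (adjArray G) w (σ'.vars .pow) ∧ σ'.vars .pow ≤ 3 ^ k ∧
        Ready (valueBound n k) n (adjArray G) w (fun _ => 0) σ') σ := by
  obtain ⟨z, hzk, hz⟩ := hcover
  refine (runs_loop (fun j σ' => σ'.vars .guess = j ∧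
    (∃ w, (∀ v, n ≤ v → w v = 0) ∧
      Ready (valueBound n k) n (adjArray G) w (fun _ => 0) σ') ∧
    (σ'.vars .fail ≠ 0 →
      ∀ i < j, ((Search.init i).run n (adjArray G) (allPairs n n)).fail ≠ 0) ∧
    (σ'.vars .fail = 0 → ∃ y < 3 ^ k, Stmt.Holds (valueBound n k) n (adjArray G) (fun _ => 0) j
      ((Search.init y).run n (adjArray G) (allPairs n n)) σ')) (3 ^ k) ?_ ?_ ?_).mono
    le_rfl ?_
  · rintro j σ' - ⟨hgj, ⟨w, hw, hr'⟩, hfail, -⟩ hne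
    have hjk : j < 3 ^ k := by
      by_contra hc
      exact hfail hne z (by omega) hz
    refine ⟨hjk, Stmt.wp_tryGuess hr' hw hgj hjk (by simp only [valueBound]; omega)
      fun σ₁ h₁ => ⟨h₁.guess, ⟨_, fun v hv => ?_, h₁.ready⟩, fun hne' i hi => ?_,
        fun _ => ⟨j, hjk, h₁⟩⟩⟩
    · have hvalid := (Search.valid_init n j).run (a := adjArray G) (l := allPairs n n)
        fun e he => mem_allPairs.1 he
      by_contra hc
      have := (hvalid.wt_eq v hc).1
      omega
    · rcases Nat.lt_succ_iff_lt_or_eq.1 hi with hi | rfl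
      · exact hfail hne i hi
      · rwa [← h₁.fail]
  · simp [hr.mem]
  · exact ⟨hg, ⟨_, fun _ _ => rfl, hr⟩, fun _ i hi => absurd hi (Nat.not_lt_zero i),
      fun h => absurd h hf⟩
  · rintro σ' - ⟨hf0, j, -, -, -, hj⟩
    obtain ⟨y, hy, h⟩ := hj hf0
    have hpairs : ∀ e ∈ allPairs n n, e.1 < n ∧ e.2 < n := fun e he => mem_allPairs.1 he
    have hvalid := (Search.valid_init n y).run (a := adjArray G) hpairs
    have hple := (Search.valid_init n y).pow_le_run (a := adjArray G) hy
      (Nat.one_le_pow _ _ (by omega)) hpairs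
    rw [h.pow]
    refine ⟨_, ⟨adjArray_ne_zero G, hvalid.exists_pow, hvalid.sum_eq, hvalid.wt_eq, hvalid.inj,
      fun v u hvu => ?_⟩, hple, h.ready⟩
    exact Search.covered_of_fail_eq_zero (n := n) (a := adjArray G) (c := Search.init y)
      (by simp [Search.init]) (h.fail ▸ hf0) (v, u)
      (mem_allPairs.2 ⟨v.2, u.2⟩) ((adjArray_ne_zero G v u).2 hvu)

/-- The variable `left` counts down alongside `st`, because a loop can only test a register for
zero. -/
theorem runs_fillEntry_loop {n k p : ℕ} {a w b₀ : ℕ → ℕ} {σ : Store} (hp : p ≤ 3 ^ k)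
    (hr : Ready (valueBound n k) n a w b₀ σ) (hst : σ.vars .st = 0) (hleft : σ.vars .left = p)
    (hpow : σ.vars .pow = p) :
    Runs (valueBound n k) (1 + 3 ^ k * (Stmt.fillEntry.time n + 1))
      (.loop Var.left.idx Stmt.fillEntry.compile)
      (fun σ' => σ'.vars .pow = p ∧ σ'.vars .st = p ∧
        ∃ b, Ready (valueBound n k) n a w b σ' ∧ ∀ s < p, CorrectEntry n a w b s) σ := by
  refine (runs_loop (n := n) (fun j σ' => j ≤ p ∧ σ'.vars .st = j ∧ σ'.vars .left = p - j ∧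
    σ'.vars .pow = p ∧
    ∃ b, Ready (valueBound n k) n a w b σ' ∧ ∀ s < j, CorrectEntry n a w b s) p ?_ ?_ ?_).mono
    ?_ ?_
  · rintro j σ' - ⟨hjp, hj, hl, hpw, b, hr', hb⟩ hne
    refine ⟨by omega, Stmt.wp_fillEntry hr' fun σ₁ c hm hst₁ hl₁ hp₁ hc =>
      ⟨by omega, by omega, by omega, by omega, Function.update b j c,
        ⟨hj ▸ hm, hr'.three_le, hr'.size_le, ?_⟩, fun s hs => ?_⟩⟩
    · simp only [valueBound]
      omega
    · rw [hj] at hc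
      rcases Nat.lt_succ_iff_lt_or_eq.1 hs with hs | rfl
      · exact (hb s hs).update hs
      · exact correctEntry_update_self hc
  · simp [hr.mem]
  · exact ⟨Nat.zero_le p, hst, by omega, hpow, b₀, hr, fun s hs => absurd hs (Nat.not_lt_zero s)⟩
  · exact Nat.add_le_add_left (Nat.mul_le_mul_right _ hp) 1
  · rintro σ' - ⟨hl, j, hjp, hj, hl', hpw, b, hr', hb⟩
    obtain rfl : j = p := by omega
    exact ⟨hpw, hj, b, hr', hb⟩

/-- A bound for the number of instructions of the algorithm. -/
def instructionBound (n k : ℕ) : ℕ :=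
  startGuess.time n + ((1 + 3 ^ k * (Stmt.tryGuess.time n + 1)) + (startTable.time n +
    ((1 + 3 ^ k * (Stmt.fillEntry.time n + 1)) + output.time n)))

theorem runs_pathwidthProgram {n k : ℕ} (hn : 1 ≤ n) {G : SimpleGraph (Fin n)}
    (hcover : ∃ y < 3 ^ k, ((Search.init y).run n (adjArray G) (allPairs n n)).fail = 0) :
    Runs (valueBound n k) (instructionBound n k) pathwidthProgram
      (fun σ => IsPathwidth G (σ.vars .res : ℤ)) (initialStore G) := by
  have hpos : 0 < 3 ^ k := pow_pos (by omega) k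
  have hmem : (initialStore G).mem = layout n (adjArray G) (fun _ => 0) fun _ => 0 :=
    graphInput_mem G
  have h0 : (initialStore G).mem 0 = n := by simp [hmem]
  have h3 : 3 ≤ valueBound n k := by simp only [valueBound]; omega
  have hsz : n * n + n + 1 ≤ valueBound n k := by simp only [valueBound]; omega
  have hr : Ready (valueBound n k) n (adjArray G) (fun _ => 0) (fun _ => 0)
      ((initialStore G).set .fail 1) :=
    ⟨hmem, h3, hsz, by simpa [initialStore] using hsz⟩
  have hstart : Runs (valueBound n k) (startGuess.time n) startGuess.compile
      (fun σ => σ = (initialStore G).set .fail 1) (initialStore G) := by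
    have : startGuess.WP (valueBound n k) (fun σ => σ = (initialStore G).set .fail 1)
        (initialStore G) := Stmt.wp_assign (by simp; omega) rfl
    rwa [Stmt.WP, h0] at this
  refine hstart.seq ?_
  rintro _ - rfl
  refine (runs_tryGuess_loop hcover hr (by simp [initialStore]) (by simp)).seq ?_
  rintro σ₁ - ⟨w, henc, hp, hr₁⟩
  have hm₁ : σ₁.mem 0 = n := by simp [hr₁.mem]
  have htable : startTable.WP (valueBound n k)
      (fun σ => σ = (σ₁.set .st 0).set .left (σ₁.vars .pow)) σ₁ :=
    Stmt.wp_seq (Stmt.wp_assign (Nat.zero_le _) (Stmt.wp_assign (Expr.fits_var _) (by simp)))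
  rw [Stmt.WP, hm₁] at htable
  refine htable.seq ?_
  rintro _ - rfl
  refine (runs_fillEntry_loop (b₀ := fun _ => 0) (a := adjArray G) (w := w)
    (σ := (σ₁.set .st 0).set .left (σ₁.vars .pow)) hp ⟨hr₁.mem, h3, hsz, ?_⟩ ?_ (by rw [Store.set_vars_self]) (by simp)).seq ?_
  · rw [Store.set_vars_of_ne _ _ (by decide), Store.set_vars_self]
    exact hsz
  · rw [Store.set_vars_of_ne _ _ (by decide), Store.set_vars_self]
  rintro σ₂ - ⟨hpow, hst, b, hr₂, hb⟩
  have hm₂ : σ₂.mem 0 = n := by simp [hr₂.mem]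
  have hout : output.WP (valueBound n k) (fun σ => IsPathwidth G (σ.vars .res : ℤ)) σ₂ := by
    refine Stmt.wp_assign (hr₂.fits_best (by simp; omega) (by simp [hpow, hst])) ?_
    have : Nonempty (Fin n) := ⟨⟨0, hn⟩⟩
    rw [Store.set_vars_self, hr₂.eval_best, Expr.eval_sub, Expr.eval_var, Expr.eval_const, hpow]
    refine isPathwidth_of_forall_separable fun W hW => henc.last_le_iff hb ?_
    simpa using hW
  rwa [Stmt.WP, hm₂] at hout

theorem exists_guess_of_vertexCoverNum {n k : ℕ} {G : SimpleGraph (Fin n)}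
    (hk : G.vertexCoverNum = (k : ℕ∞)) :
    ∃ y < 3 ^ k, ((Search.init y).run n (adjArray G) (allPairs n n)).fail = 0 := by
  classical
  obtain ⟨s, hs, hcov⟩ := G.vertexCoverNum_exists
  rw [hk, ← Set.coe_toFinset s, Set.encard_coe_eq_coe_finsetCard] at hs
  have hcard : s.toFinset.card = k := by exact_mod_cast hs
  have hC : ∀ e ∈ allPairs n n, adjArray G (n * e.1 + e.2) ≠ 0 →
      e.1 ∈ s.toFinset.image (fun v : Fin n => (v : ℕ)) ∨
      e.2 ∈ s.toFinset.image (fun v : Fin n => (v : ℕ)) := by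
    rintro ⟨v, u⟩ he ha
    obtain ⟨hv, hu⟩ := mem_allPairs.1 he
    have := hcov ((adjArray_ne_zero G ⟨v, hv⟩ ⟨u, hu⟩).1 ha)
    simp only [Finset.mem_image, Set.mem_toFinset]
    exact this.imp (fun h => ⟨_, h, rfl⟩) fun h => ⟨_, h, rfl⟩
  obtain ⟨y, hy, hf⟩ := Search.exists_guess (n := n) _ (fun _ => 0) 1 hC one_ne_zero
  refine ⟨y, hy.trans_le (Nat.pow_le_pow_right (by omega) ?_), hf⟩
  exact (Finset.card_filter_le _ _).trans (Finset.card_image_le.trans hcard.le)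

/-- The values are at most exponential: `n * n`, `n + 1` and `3 ^ k` are all at most `4 ^ n`, so the
bound is below `8 * 4 ^ n` and has at most `2 * n + 3` binary digits. -/
theorem unitCost_valueBound_le {n k : ℕ} (hn : 1 ≤ n) (hk : k ≤ n) :
    unitCost (valueBound n k) ≤ 13 * n := by
  have h1 : 3 ^ k ≤ 4 ^ n :=
    (Nat.pow_le_pow_left (by omega) k).trans (Nat.pow_le_pow_right (by omega) hk)
  have h2 : n < 2 ^ n := Nat.lt_two_pow_self
  have h3 : n * n ≤ 2 ^ n * 2 ^ n := Nat.mul_le_mul h2.le h2.le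
  have h4 : (4 : ℕ) ^ n = 2 ^ n * 2 ^ n := by rw [← mul_pow]; rfl
  have h5 : 2 ^ n ≤ 2 ^ n * 2 ^ n := Nat.le_mul_of_pos_right _ (by omega)
  have h6 : (2 : ℕ) ^ (2 * n + 3) = 8 * 4 ^ n := by
    rw [pow_add, pow_mul]
    norm_num
    ring
  have h7 : Nat.size (valueBound n k) ≤ 2 * n + 3 := by
    rw [Nat.size_le, h6]
    simp only [valueBound]
    omega
  simp only [unitCost]
  omega

theorem exists_instructionBound_le :
    ∃ c d : ℕ, ∀ n k, 1 ≤ n → instructionBound n k ≤ c * (3 ^ k * n ^ d) := by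
  -- Composing the pieces once, without their outer loops, gives a single polynomial for the sum of
  -- their times. The constant `4` added below pays for the tests of the two loops.
  obtain ⟨c, d, h⟩ := Stmt.exists_time_le (.seq startGuess (.seq Stmt.tryGuess
    (.seq startTable (.seq Stmt.fillEntry output))))
  refine ⟨c + 4, d, fun n k hn => ?_⟩
  have h1 := h n hn
  have hpos : 1 ≤ 3 ^ k := Nat.one_le_pow _ _ (by omega)
  have hn' : 1 ≤ n ^ d := Nat.one_le_pow _ _ hn
  simp only [Stmt.time] at h1
  have h2 : instructionBound n k ≤ 3 ^ k * (startGuess.time n + (Stmt.tryGuess.time n +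
      (startTable.time n + (Stmt.fillEntry.time n + output.time n))) + 4) := by
    have e1 := Nat.mul_le_mul_right (startGuess.time n) hpos
    have e2 := Nat.mul_le_mul_right (startTable.time n) hpos
    have e3 := Nat.mul_le_mul_right (output.time n) hpos
    simp only [instructionBound, Nat.mul_add]
    omega
  refine h2.trans ((Nat.mul_le_mul_left (3 ^ k) ?_).trans
    (Nat.mul_left_comm (3 ^ k) (c + 4) (n ^ d)).le)
  rw [Nat.add_mul]
  omega

end RAM

/-! ### The main theorem -/

theorem mainTheorem2 :
    ∃ (P : RAM.Program) (c d : ℕ), ∀ (n : ℕ), 1 ≤ n → ∀ (G : SimpleGraph (Fin n)) (k : ℕ),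
      G.vertexCoverNum = (k : ℕ∞) →
        ∃ (s : RAM.State) (t : ℕ), RAM.Exec P (RAM.graphInput G) s t ∧
          IsPathwidth G (s.reg 0 : ℤ) ∧ t ≤ c * (3 ^ k * n ^ d) := by
  obtain ⟨c, d, hcd⟩ := RAM.exists_instructionBound_le
  refine ⟨RAM.pathwidthProgram, 13 * c, d + 1, fun n hn G k hk => ?_⟩
  -- This is needed for the size of the numbers: with `k ≤ n`, the logarithmic cost adds only a
  -- factor `13 * n`.
  have hkn : k ≤ n := by
    have h := G.vertexCoverNum_le_card_sub_one.trans tsub_le_self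
    rw [hk, ENat.card_eq_coe_fintype_card, Fintype.card_fin] at h
    exact_mod_cast h
  obtain ⟨s, σ, t, he, ht, hs, -, hQ⟩ :=
    RAM.runs_pathwidthProgram hn (RAM.exists_guess_of_vertexCoverNum hk) _
      (RAM.represents_graphInput (B := RAM.valueBound n k) G
        (by simp only [RAM.valueBound]; omega) (by simp only [RAM.valueBound]; omega))
  refine ⟨s, t, he, ?_, ht.trans ?_⟩
  · rw [show s.reg 0 = σ.vars .res from hs.reg .res]
    exact hQ
  · refine (Nat.mul_le_mul (hcd n k hn) (RAM.unitCost_valueBound_le hn hkn)).trans_eq ?_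
    ring
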